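/- Let $2\omega_1,2\omega_3\in\mathbb C$ be linearly independent over $\mathbb R$, put $\omega_0=0$, $\omega_2=-\omega_1-\omega_3$, let $\wp,\zeta,\sigma$ be the Weierstrass functions of the lattice $L=2\omega_1\mathbb Z\oplus2\omega_3\mathbb Z$, with invariants $g_2,g_3$, and put $e_i=\wp(\omega_i)$, $\eta_i=\zeta(\omega_i)$ $(i=1,2,3)$. Let $l_0,\dots,l_3\in\mathbb Z_{\ge0}$, $M\ge0$, $r_1,\dots,r_M\in\mathbb Z_{>0}$, $\delta_1,\dots,\delta_M\in\mathbb C$ with $2\delta_k\notin L$ and with $b_k=\wp(\delta_k)$ pairwise distinct, and let $s_1,\dots,s_M,E\in\mathbb C$. Put $$v(x)=\sum_{i=0}^3 l_i(l_i+1)\wp(x+\omega_i)+\sum_{k=1}^M\Big(\tfrac{r_k}2\big(\tfrac{r_k}2+1\big)(\wp(x-\delta_k)+\wp(x+\delta_k))+\frac{s_k}{\wp(x)-b_k}\Big).$$ The equation $-f''+vf=Ef$ is equivalent, via $z=\wp(x)$ and $f(x)=\tilde f(z)\prod_{i=1}^3(z-e_i)^{-l_i/2}\prod_{k}(z-b_k)^{-r_k/2}$,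 to the Fuchsian equation $$\tilde f''+\Big(\sum_{i=1}^3\frac{\frac12-l_i}{z-e_i}-\sum_{k=1}^M\frac{r_k}{z-b_k}\Big)\tilde f'+\frac{N(N-2l_0-1)z+p+\sum_k\frac{o_k}{z-b_k}}{4(z-e_1)(z-e_2)(z-e_3)}\tilde f=0,\qquad N=\sum_{i=0}^3 l_i+\sum_k r_k,$$ where $$o_k=-s_k+r_k\Big\{\tfrac18r_k(12b_k^2-g_2)+\tfrac12(4b_k^3-g_2b_k-g_3)\sum_{m\ne k}\frac{r_m}{b_k-b_m}+2\big(l_1(b_k-e_2)(b_k-e_3)+l_2(b_k-e_1)(b_k-e_3)+l_3(b_k-e_1)(b_k-e_2)\big)\Big\},$$ $$p=E+\sum_{i=1}^3e_il_i^2-2(l_1l_2e_3+l_2l_3e_1+l_3l_1e_2)-\tfrac12\sum_kb_kr_k^2+2\sum_k\sum_{i=1}^3l_ir_k(e_i+b_k)+2\Big(\sum_kb_kr_k\Big)\Big(\sum_kr_k\Big).$$ Assume that every point $z=b_k$ is an apparent singularity of the Fuchsian equation (integer exponents and no logarithmic solution). Put $\tilde l_0=l_0+\sum_kr_k$, $\tilde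 l_i=l_i$ $(i=1,2,3)$ and $\Phi_i(x,\alpha)=\frac{\sigma(x+\omega_i-\alpha)}{\sigma(x+\omega_i)}e^{\zeta(\alpha)x}$ $(i=0,1,2,3)$. Then the following hold. There is an even, nonzero, doubly periodic function (periods $2\omega_1,2\omega_3$) of the form $$\Xi(x)=c_0+\sum_{i=0}^3\sum_{j=0}^{l_i-1}c^{(i)}_j\wp(x+\omega_i)^{l_i-j}+\sum_{k=1}^M\sum_{j=0}^{r_k-1}\frac{d^{(k)}_j}{(\wp(x)-b_k)^{r_k-j}}$$ with constant coefficients, satisfying $\Xi'''-4(v-E)\Xi'-2v'\Xi=0$. For every such $\Xi$ the expression $Q=\Xi^2(E-v)+\frac12\Xi\Xi''-\frac14(\Xi')^2$ is constant, and every branch (on a domain where everything is holomorphic and $\Xi\ne0$) of $$\Lambda_g(x)=\Psi_g(x)\sqrt{\Xi(x)}\,\exp\int\frac{\sqrt{-Q}\,dx}{\Xi(x)},\qquad\Psi_g(x)=\prod_{k=1}^M(\wp(x)-b_k)^{r_k/2},$$ extends to a single-valued meromorphic function $\Lambda_g$ on $\mathbb C$, holomorphic off $\omega_1\mathbb Z\oplus\omega_3\mathbb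 Z$, for which $\Lambda_g/\Psi_g$ solves $-f''+vf=Ef$; equivalently $(H_g-E-C_g)\Lambda_g=0$ with $$H_g=-\frac{d^2}{dx^2}+\sum_k\frac{r_k\wp'(x)}{\wp(x)-b_k}\frac d{dx}+\Big(l_0+\sum_kr_k\Big)\Big(l_0+1-\sum_kr_k\Big)\wp(x)+\sum_{i=1}^3l_i(l_i+1)\wp(x+\omega_i)+\sum_k\frac{\tilde s_k}{\wp(x)-b_k},$$ $$\tilde s_k=s_k-r_k\Big\{\tfrac18r_k(12b_k^2-g_2)+\tfrac12(4b_k^3-g_2b_k-g_3)\sum_{m\ne k}\frac{r_m}{b_k-b_m}\Big\},\qquad C_g=-\tfrac12\sum_kb_kr_k^2+2\Big(\sum_kb_kr_k\Big)\Big(\sum_kr_k\Big).$$ Moreover, for this $\Lambda_g$: (1) either $$\Lambda_g(x)=e^{\kappa x}\sum_{i=0}^3\sum_{j=0}^{\tilde l_i-1}\tilde b^{(i)}_j\Big(\frac d{dx}\Big)^j\Phi_i(x,\alpha)\tag{A}$$ for some $\alpha\in\mathbb C\setminus L$ and $\kappa,\tilde b^{(i)}_j\in\mathbb C$, or $$\Lambda_g(x)=e^{\bar\kappa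 x}\Big(\bar c+\sum_{i=0}^3\sum_{j=0}^{\tilde l_i-2}\bar b^{(i)}_j\Big(\frac d{dx}\Big)^j\wp(x+\omega_i)+\sum_{i=1}^3\bar c_i\frac{\wp'(x)}{\wp(x)-e_i}\Big)\tag{B}$$ for some $\bar\kappa,\bar c,\bar c_i,\bar b^{(i)}_j\in\mathbb C$; (2) whenever $\Lambda_g$ is expressed as (A), $\Lambda_g(x+2\omega_j)=\exp(-2\eta_j\alpha+2\omega_j\zeta(\alpha)+2\kappa\omega_j)\Lambda_g(x)$ for $j=1,3$; whenever it is expressed as (B), $\Lambda_g(x+2\omega_j)=\exp(2\bar\kappa\omega_j)\Lambda_g(x)$ for $j=1,3$. -/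

import Mathlib

open Filter Topology

noncomputable section

namespace HermiteKrichever

/-! ### Weierstrass sigma and zeta functions -/

/-- The Weierstrass sigma function of the lattice `L`. -/
def sigma (L : PeriodPair) (z : ℂ) : ℂ :=
  z * ∏' l : {l : L.lattice // l ≠ 0},
    ((1 - z / (l.1 : ℂ)) * Complex.exp (z / (l.1 : ℂ) + z ^ 2 / (2 * (l.1 : ℂ) ^ 2)))

/-- The Weierstrass zeta function `σ' / σ` (meaningful off the lattice). -/
def zeta (L : PeriodPair) (z : ℂ) : ℂ := deriv (sigma L) z / sigma L z

/-! ### Apparent singularities of `f'' + P f' + Q f = 0` -/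

/-- `f` is a holomorphic solution of `f'' + P f' + Q f = 0` on the open set `U`. -/
def IsSolutionOn (P Q : ℂ → ℂ) (U : Set ℂ) (f : ℂ → ℂ) : Prop :=
  DifferentiableOn ℂ f U ∧ ∀ z ∈ U, deriv (deriv f) z + P z * deriv f z + Q z * f z = 0

/-- `a` is a (possibly removable) regular singular point with exponents `m`, `n`: the roots of the
indicial polynomial `t ^ 2 + (p₀ - 1) t + q₀`. -/
def HasExponents (P Q : ℂ → ℂ) (a m n : ℂ) : Prop :=
  ∃ p₀ q₀ : ℂ, Tendsto (fun z => (z - a) * P z) (𝓝[≠] a) (𝓝 p₀) ∧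
    Tendsto (fun z => (z - a) ^ 2 * Q z) (𝓝[≠] a) (𝓝 q₀) ∧
    ∀ t : ℂ, t ^ 2 + (p₀ - 1) * t + q₀ = (t - m) * (t - n)

/-- No solution is logarithmic at `a`: on a punctured disc around `a`, every initial value problem
has a single-valued solution, and this solution is meromorphic at `a`. -/
def NoLogarithmicSolution (P Q : ℂ → ℂ) (a : ℂ) : Prop :=
  ∃ ρ : ℝ, 0 < ρ ∧ ∀ z₀ ∈ Metric.ball a ρ \ {a}, ∀ c₀ c₁ : ℂ,
    ∃ f : ℂ → ℂ, IsSolutionOn P Q (Metric.ball a ρ \ {a}) f ∧ MeromorphicAt f a ∧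
      f z₀ = c₀ ∧ deriv f z₀ = c₁

/-- The point `a` is an apparent singularity: the exponents are integers and there is no
logarithmic solution. -/
def IsApparent (P Q : ℂ → ℂ) (a : ℂ) : Prop :=
  (∃ m n : ℤ, HasExponents P Q a m n) ∧ NoLogarithmicSolution P Q a

/-! ### The data of the equation -/

/-- The data of the equation. The periods are `2 ω₁ = L.ω₁` and `2 ω₃ = L.ω₂`. -/
structure HKData where
  L : PeriodPair
  l : Fin 4 → ℕ
  M : ℕ
  r : Fin M → ℕ
  δ : Fin M → ℂ
  s : Fin M → ℂ
  E : ℂ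

namespace HKData

variable (D : HKData)

/-- The half periods `ω₀ = 0`, `ω₁`, `ω₂ = - ω₁ - ω₃`, `ω₃`. -/
def ω : Fin 4 → ℂ := ![0, D.L.ω₁ / 2, -(D.L.ω₁ / 2) - D.L.ω₂ / 2, D.L.ω₂ / 2]

/-- `e i = ℘(ω i)`, used for `i = 1, 2, 3` only. -/
def e (i : Fin 4) : ℂ := D.L.weierstrassP (D.ω i)

/-- `η i = ζ(ω i)`, used for `i = 1, 3` only. -/
def η (i : Fin 4) : ℂ := zeta D.L (D.ω i)

/-- `b i = ℘(δ i)`. -/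
def b (i : Fin D.M) : ℂ := D.L.weierstrassP (D.δ i)

/-- The sum of all `r i`. -/
def R : ℕ := ∑ i, D.r i

/-- The integers `l₀ + ∑ r`, `l₁`, `l₂`, `l₃`. -/
def lt : Fin 4 → ℕ := ![D.l 0 + D.R, D.l 1, D.l 2, D.l 3]

/-- `ℤ ω₁ ⊕ ℤ ω₃`. -/
def halfLattice : Set ℂ := {x | 2 * x ∈ D.L.lattice}

/-- The singular points of the elliptic form: the half lattice and the points `± δ i` modulo the
lattice. -/
def sing : Set ℂ := D.halfLattice ∪ {x | ∃ i, x - D.δ i ∈ D.L.lattice ∨ x + D.δ i ∈ D.L.lattice}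

/-! ### The Fuchsian equation in the variable `z` -/

/-- The accessory parameters attached to the points `b i`. -/
def o (i : Fin D.M) : ℂ :=
  -D.s i + D.r i *
    ((1 / 8 : ℂ) * D.r i * (12 * D.b i ^ 2 - D.L.g₂)
      + (1 / 2 : ℂ) * (4 * D.b i ^ 3 - D.L.g₂ * D.b i - D.L.g₃) *
          (∑ k ∈ Finset.univ.erase i, (D.r k : ℂ) / (D.b i - D.b k))
      + 2 * (D.l 1 * (D.b i - D.e 2) * (D.b i - D.e 3)
        + D.l 2 * (D.b i - D.e 1) * (D.b i - D.e 3)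
        + D.l 3 * (D.b i - D.e 1) * (D.b i - D.e 2)))

/-- The remaining accessory parameter. -/
def p : ℂ :=
  D.E + (D.e 1 * D.l 1 ^ 2 + D.e 2 * D.l 2 ^ 2 + D.e 3 * D.l 3 ^ 2)
    - 2 * (D.l 1 * D.l 2 * D.e 3 + D.l 2 * D.l 3 * D.e 1 + D.l 3 * D.l 1 * D.e 2)
    - (1 / 2 : ℂ) * ∑ k, D.b k * D.r k ^ 2
    + 2 * ∑ k, ∑ i : Fin 3, D.l i.succ * D.r k * (D.e i.succ + D.b k)
    + 2 * (∑ k, D.b k * D.r k) * (∑ k, (D.r k : ℂ))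

/-- `N = l₀ + l₁ + l₂ + l₃ + ∑ r`. -/
def N : ℂ := (∑ i, (D.l i : ℂ)) + ∑ k, (D.r k : ℂ)

/-- The coefficient of `d/dz` in the Fuchsian equation. -/
def fuchsP (z : ℂ) : ℂ :=
  (∑ i : Fin 3, ((1 / 2 : ℂ) - D.l i.succ) / (z - D.e i.succ)) + ∑ k, -(D.r k : ℂ) / (z - D.b k)

/-- The coefficient of order zero in the Fuchsian equation. -/
def fuchsQ (z : ℂ) : ℂ :=
  (D.N * (D.N - 2 * D.l 0 - 1) * z + D.p + ∑ k, D.o k / (z - D.b k)) /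
    (4 * (z - D.e 1) * (z - D.e 2) * (z - D.e 3))

/-! ### The elliptic forms of the equation -/

/-- The potential of `H = - d²/dx² + v`. -/
def v (x : ℂ) : ℂ :=
  (∑ i, (D.l i : ℂ) * (D.l i + 1) * D.L.weierstrassP (x + D.ω i))
    + ∑ k, ((D.r k : ℂ) / 2 * ((D.r k : ℂ) / 2 + 1) *
        (D.L.weierstrassP (x - D.δ k) + D.L.weierstrassP (x + D.δ k))
      + D.s k / (D.L.weierstrassP x - D.b k))

/-- The parameters of the gauge transformed operator `H_g`. -/
def st (i : Fin D.M) : ℂ :=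
  D.s i - D.r i *
    ((1 / 8 : ℂ) * D.r i * (12 * D.b i ^ 2 - D.L.g₂)
      + (1 / 2 : ℂ) * (4 * D.b i ^ 3 - D.L.g₂ * D.b i - D.L.g₃) *
          (∑ k ∈ Finset.univ.erase i, (D.r k : ℂ) / (D.b i - D.b k)))

/-- The constant `C_g`. -/
def Cg : ℂ :=
  -(1 / 2 : ℂ) * (∑ k, D.b k * D.r k ^ 2) + 2 * (∑ k, D.b k * D.r k) * (∑ k, (D.r k : ℂ))

/-- The operator `H_g`. -/
def Hg (f : ℂ → ℂ) (x : ℂ) : ℂ :=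
  -deriv (deriv f) x
    + (∑ k, D.r k * D.L.derivWeierstrassP x / (D.L.weierstrassP x - D.b k)) * deriv f x
    + (((D.l 0 : ℂ) + D.R) * ((D.l 0 : ℂ) + 1 - D.R) * D.L.weierstrassP x
      + (∑ i : Fin 3, (D.l i.succ : ℂ) * (D.l i.succ + 1) * D.L.weierstrassP (x + D.ω i.succ))
      + ∑ k, D.st k / (D.L.weierstrassP x - D.b k)) * f x

/-! ### The function `Ξ`, the constant `Q` and the function `Λ_g` -/

/-- `Ξ` is an even, nonzero, doubly periodic solution of
`Ξ''' - 4 (v - E) Ξ' - 2 v' Ξ = 0` with the finite expansion in terms of `℘`. -/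
structure IsXi (Ξ : ℂ → ℂ) : Prop where
  even : ∀ x ∉ D.sing, Ξ (-x) = Ξ x
  periodic : ∀ x ∉ D.sing, Ξ (x + 2 * D.ω 1) = Ξ x ∧ Ξ (x + 2 * D.ω 3) = Ξ x
  nonzero : ∃ x ∉ D.sing, Ξ x ≠ 0
  equation : ∀ x ∉ D.sing,
    iteratedDeriv 3 Ξ x - 4 * (D.v x - D.E) * deriv Ξ x - 2 * deriv D.v x * Ξ x = 0
  expansion : ∃ (c₀ : ℂ) (c : Fin 4 → ℕ → ℂ) (d : Fin D.M → ℕ → ℂ), ∀ x ∉ D.sing,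
    Ξ x = c₀
      + (∑ i, ∑ j ∈ Finset.range (D.l i), c i j * D.L.weierstrassP (x + D.ω i) ^ (D.l i - j))
      + ∑ k, ∑ j ∈ Finset.range (D.r k), d k j / (D.L.weierstrassP x - D.b k) ^ (D.r k - j)

/-- The expression `Ξ² (E - v) + Ξ Ξ'' / 2 - Ξ'² / 4`. -/
def Qfun (Ξ : ℂ → ℂ) (x : ℂ) : ℂ :=
  Ξ x ^ 2 * (D.E - D.v x) + (1 / 2 : ℂ) * Ξ x * deriv (deriv Ξ) x - (1 / 4 : ℂ) * deriv Ξ x ^ 2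

/-- `F` is, on the domain `U`, a branch of the multivalued function
`Ψ_g √Ξ exp (∫ √(-Q) dx / Ξ)` with `Ψ_g = ∏ (℘ - b i) ^ (r i / 2)`: here `ψ` is a branch of `Ψ_g`,
`ξ` a branch of `√Ξ`, `q` a square root of `-Q` and `I` a primitive of `q / Ξ`. -/
def IsLambdaBranch (Ξ : ℂ → ℂ) (Q : ℂ) (U : Set ℂ) (F : ℂ → ℂ) : Prop :=
  IsOpen U ∧ IsConnected U ∧ (∀ x ∈ U, x ∉ D.sing ∧ Ξ x ≠ 0) ∧
    ∃ (ψ ξ I : ℂ → ℂ) (q : ℂ), q ^ 2 = -Q ∧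
      DifferentiableOn ℂ ψ U ∧ DifferentiableOn ℂ ξ U ∧
      (∀ x ∈ U, ψ x ^ 2 = ∏ k, (D.L.weierstrassP x - D.b k) ^ D.r k) ∧
      (∀ x ∈ U, ξ x ^ 2 = Ξ x) ∧
      (∀ x ∈ U, HasDerivAt I (q / Ξ x) x) ∧
      ∀ x ∈ U, F x = ψ x * ξ x * Complex.exp (I x)

/-! ### The two forms of the Ansatz -/

/-- `Φ_i(x, α) = σ(x + ω_i - α) / σ(x + ω_i) * exp (ζ(α) x)`. -/
def Phi (i : Fin 4) (α x : ℂ) : ℂ :=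
  sigma D.L (x + D.ω i - α) / sigma D.L (x + D.ω i) * Complex.exp (zeta D.L α * x)

/-- `Λ` is written in the generic form, with `α` not a period. -/
def IsAnsatz (Λ : ℂ → ℂ) (α κ : ℂ) (c : Fin 4 → ℕ → ℂ) : Prop :=
  α ∉ D.L.lattice ∧ ∀ x ∉ D.halfLattice,
    Λ x = Complex.exp (κ * x) *
      ∑ i, ∑ j ∈ Finset.range (D.lt i), c i j * iteratedDeriv j (D.Phi i α) x

/-- `Λ` is written in the degenerate form. -/
def IsDegenerateAnsatz (Λ : ℂ → ℂ) (κ c₀ : ℂ) (c : Fin 4 → ℕ → ℂ) (c' : Fin 3 → ℂ) : Prop :=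
  ∀ x ∉ D.halfLattice,
    Λ x = Complex.exp (κ * x) *
      (c₀ + (∑ i, ∑ j ∈ Finset.range (D.lt i - 1),
          c i j * iteratedDeriv j (fun y => D.L.weierstrassP (y + D.ω i)) x)
        + ∑ i : Fin 3, c' i * (D.L.derivWeierstrassP x / (D.L.weierstrassP x - D.e i.succ)))

end HKData

end HermiteKrichever

end

noncomputable section
namespace HermiteKrichever

/-! ### Sigma and zeta -/

/-! Multiplying solutions of `-f'' + v f = E f` by `Ψ_g` turns the equation into `Λ'' = A Λ' + B Λ`
with elliptic coefficients (`gauge_identity`). The point is that every solution of the new equation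
is meromorphic on the whole plane. At a half period the potential is `l (l + 1) / t ^ 2` plus an
even holomorphic function, and evenness makes the Frobenius recursion consistent at its resonance,
so no logarithm occurs (`exists_frobenius`, `localBasis_frobenius`). At `± δ k` the function `℘` is
a local coordinate, so the absence of logarithms at `z = b k` carries over (`exists_fullOn_delta`).
Local solvability glues to solvability on the plane because the plane is simply connected
(`fullOn_univ`). The solutions therefore form a space determined by Cauchy data at one point and
stable under translation by periods and under `x ↦ -x`. The indicial equations bound their poles:
order at most `lt i` at `ω i`, and none off the half lattice.

Two commuting translations of a nonzero finite-dimensional space have a common eigenvector `f`. In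
`f(x) f(-x) / Ψ_g(x) ^ 2` the multipliers cancel. The quotient is even and elliptic, solves the
symmetric square equation, and has poles of orders controlled by the exponents; removing them one at
a time gives the expansion required of `Ξ` (`exists_isXi`).

For any `Ξ`, the derivative of `Q` is `Ξ / 2` times the third order equation, so `Q` is constant. A
branch of `Λ_g` has logarithmic derivative `Ψ_g' / Ψ_g + (Ξ' / 2 + q) / Ξ` with `q ^ 2 = -Q`; the
definition of `Q` makes this a Riccati solution, so the branch solves the equation of `H_g` and
extends to the plane. The logarithmic derivative is elliptic, so the extension is multiplied by
constants `μ₁`, `μ₂` under the two periods (`IsLambdaBranch.exists_extension`).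

It remains to describe quasi-periodic functions with bounded poles at the half periods. A
determinant in the quasi-periods of `ζ` is nonzero (`zeta_det_ne_zero`), so `μ₁`, `μ₂` are the
multipliers of some `exp(κ x) σ(x - α) / σ(x)`. If they are not those of an exponential, then `α` is
not a period, derivatives of the `Φ_i` remove all poles, and Liouville's theorem kills the
remainder: form (A). If they are, dividing by the exponential leaves an elliptic function;
derivatives of `℘(x + ω i)` remove the poles of order at least two, the functions `℘' / (℘ - e i)`
remove the simple poles at `ω 1`, `ω 2`, `ω 3`, and an elliptic function with at most one simple
pole is constant: form (B).

The theory of `σ` and `ζ` needed for this is built first from the product, including `ζ' = -℘`,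
quasi-periodicity and the `σ`-quotient formula for `℘(x) - ℘(a)`. -/

lemma norm_primary_factor_sub_one_le (w : ℂ) (hw : ‖w‖ ≤ 1) :
    ‖(1 - w) * Complex.exp (w + w ^ 2 / 2) - 1‖ ≤ Real.exp 2 * ‖w‖ ^ 3 := by
  have hd : ∀ z : ℂ, HasDerivAt (fun z : ℂ => (1 - z) * Complex.exp (z + z ^ 2 / 2))
      (-(z ^ 2) * Complex.exp (z + z ^ 2 / 2)) z := by
    intro z
    have h1 : HasDerivAt (fun z : ℂ => z + z ^ 2 / 2) (1 + z) z := by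
      have := (hasDerivAt_id z).add (((hasDerivAt_id z).pow 2).div_const 2)
      refine this.congr_deriv ?_
      simp
    refine (((hasDerivAt_id z).const_sub 1).mul h1.cexp).congr_deriv ?_
    simp; ring
  -- The derivative carries the factor `z ^ 2`, so the mean value inequality yields the third power
  -- of `‖w‖`, which is summable over a lattice of rank two.
  have key := (convex_closedBall (0 : ℂ) ‖w‖).norm_image_sub_le_of_norm_hasDerivWithin_le
    (f := fun z : ℂ => (1 - z) * Complex.exp (z + z ^ 2 / 2)) (C := Real.exp 2 * ‖w‖ ^ 2)
    (x := 0) (y := w) (fun z _ => (hd z).hasDerivWithinAt) (fun z hz => ?_) (by simp) (by simp)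
  · simp only [sub_zero] at key
    refine le_trans (le_of_eq ?_) (key.trans (le_of_eq (by ring)))
    simp
  · have hz' : ‖z‖ ≤ ‖w‖ := by simpa using hz
    rw [norm_mul, norm_neg, norm_pow, Complex.norm_exp, mul_comm]
    refine mul_le_mul (Real.exp_le_exp.mpr ?_) (by gcongr) (by positivity) (by positivity)
    refine (Complex.re_le_norm _).trans ((norm_add_le _ _).trans ?_)
    have h1 : ‖z‖ ≤ 1 := hz'.trans hw
    rw [norm_div, norm_pow]
    simp only [Complex.norm_ofNat]
    nlinarith [norm_nonneg z]

/-- The Weierstrass primary factor attached to a lattice point, equal to `1` at the point `0`. -/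
def primaryFactor (l z : ℂ) : ℂ := (1 - z / l) * Complex.exp (z / l + z ^ 2 / (2 * l ^ 2))

lemma primaryFactor_zero (z : ℂ) : primaryFactor 0 z = 1 := by simp [primaryFactor]

lemma differentiable_primaryFactor (l : ℂ) : Differentiable ℂ (primaryFactor l) := by
  unfold primaryFactor; fun_prop

lemma norm_primaryFactor_sub_one_le {l z : ℂ} {r : ℝ} (hz : ‖z‖ < r) (hl : r ≤ ‖l‖) :
    ‖primaryFactor l z - 1‖ ≤ Real.exp 2 * r ^ 3 * ‖l‖ ^ (-3 : ℝ) := by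
  have hr : 0 < r := (norm_nonneg z).trans_lt hz
  have hl0 : 0 < ‖l‖ := hr.trans_le hl
  have h := norm_primary_factor_sub_one_le (z / l) (by
    rw [norm_div, div_le_one hl0]; exact hz.le.trans hl)
  have e : primaryFactor l z = (1 - z / l) * Complex.exp (z / l + (z / l) ^ 2 / 2) := by
    unfold primaryFactor; congr 2; rw [div_pow]; field_simp
  rw [e]
  refine h.trans ?_
  rw [norm_div, div_pow]
  have : ‖l‖ ^ (-3 : ℝ) = (‖l‖ ^ 3)⁻¹ := by norm_cast
  rw [this, mul_assoc, ← div_eq_mul_inv]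
  gcongr

variable (L : PeriodPair)

lemma eventually_cofinite_le_norm (r : ℝ) : ∀ᶠ l : L.lattice in cofinite, r ≤ ‖(l : ℂ)‖ := by
  refine (isCompact_iff_finite.mp (isCompact_closedBall (0 : L.lattice) r)).subset ?_
  intro l hl
  simp only [Set.mem_compl_iff, Set.mem_ofPred_eq, not_le] at hl
  simpa using hl.le

/-- The entire function `σ(z) / z`. -/
def sigmaDiv (z : ℂ) : ℂ := ∏' l : L.lattice, primaryFactor l z

/-- Division by zero makes the factor at `l = 0` equal to `1`, so the product may run over the whole
lattice, where reindexing by negation is available. -/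
lemma sigma_eq (z : ℂ) : sigma L z = z * sigmaDiv L z := by
  unfold sigma sigmaDiv
  congr 1
  have h := tprod_subtype {l : L.lattice | l ≠ 0} (fun l : L.lattice => primaryFactor l z)
  rw [show (∏' l : L.lattice, primaryFactor l z) = ∏' l : L.lattice,
    ({l : L.lattice | l ≠ 0}.mulIndicator (fun l : L.lattice => primaryFactor l z)) l from ?_, ← h]
  · rfl
  · congr 1; ext l
    by_cases hl : l = 0
    · simp [hl, primaryFactor_zero]
    · simp [hl]

lemma summable_bound (r : ℝ) :
    Summable fun l : L.lattice => Real.exp 2 * r ^ 3 * ‖(l : ℂ)‖ ^ (-3 : ℝ) :=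
  (ZLattice.summable_norm_rpow _ _ (by simp; norm_num)).mul_left _

/-- The cubic bound holds on the ball for all lattice points with `r ≤ ‖l‖`, that is for all but
finitely many; hence the restriction to balls. -/
lemma hasProdLocallyUniformlyOn_sigmaDiv (r : ℝ) :
    HasProdLocallyUniformlyOn (fun (l : L.lattice) z => primaryFactor l z) (sigmaDiv L)
      (Metric.ball 0 r) := by
  have := Summable.hasProdLocallyUniformlyOn_one_add (K := Metric.ball (0 : ℂ) r) (hu := summable_bound L r)
    Metric.isOpen_ball (f := fun (l : L.lattice) z => primaryFactor l z - 1) ?_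
    (fun l => ((differentiable_primaryFactor _).continuous.sub continuous_const).continuousOn)
  · simp only [add_sub_cancel] at this
    exact this
  · filter_upwards [eventually_cofinite_le_norm L r] with l hl z hz
    exact norm_primaryFactor_sub_one_le (by simpa using hz) hl

lemma tendstoLocallyUniformlyOn_sigmaDiv (r : ℝ) :
    TendstoLocallyUniformlyOn (fun (s : Finset L.lattice) z => ∏ l ∈ s, primaryFactor l z)
      (sigmaDiv L) atTop (Metric.ball 0 r) :=
  hasProdLocallyUniformlyOn_sigmaDiv L r

lemma differentiable_prod_primaryFactor (s : Finset L.lattice) :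
    Differentiable ℂ fun z => ∏ l ∈ s, primaryFactor l z := by
  have := fun l => differentiable_primaryFactor l
  fun_prop

lemma differentiable_sigmaDiv : Differentiable ℂ (sigmaDiv L) := by
  intro z
  have hz : z ∈ Metric.ball (0 : ℂ) (‖z‖ + 1) := by simp
  exact ((tendstoLocallyUniformlyOn_sigmaDiv L (‖z‖ + 1)).differentiableOn
    (.of_forall fun s => (differentiable_prod_primaryFactor L s).differentiableOn)
    Metric.isOpen_ball).differentiableAt (Metric.isOpen_ball.mem_nhds hz)

lemma primaryFactor_eq_zero_iff {l z : ℂ} : primaryFactor l z = 0 ↔ l ≠ 0 ∧ z = l := by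
  by_cases hl : l = 0
  · simp [hl, primaryFactor_zero]
  · simp [primaryFactor, Complex.exp_ne_zero, hl, sub_eq_zero, eq_div_iff hl, eq_comm (a := z)]

lemma sigmaDiv_eq_zero_iff (z : ℂ) : sigmaDiv L z = 0 ↔ z ∈ L.lattice ∧ z ≠ 0 := by
  constructor
  · intro h
    by_contra hz
    have hne : ∀ l : L.lattice, 1 + (primaryFactor l z - 1) ≠ 0 := by
      intro l h0
      rw [add_sub_cancel, primaryFactor_eq_zero_iff] at h0
      exact hz ⟨h0.2 ▸ l.2, h0.2 ▸ h0.1⟩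
    refine tprod_one_add_ne_zero_of_summable hne ?_ (by simpa [sigmaDiv] using h)
    refine (summable_bound L (‖z‖ + 1)).of_norm_bounded_eventually ?_
    filter_upwards [eventually_cofinite_le_norm L (‖z‖ + 1)] with l hl
    rw [norm_norm]
    exact norm_primaryFactor_sub_one_le (by simp) hl
  · rintro ⟨hz, h0⟩
    exact tprod_of_exists_eq_zero ⟨⟨z, hz⟩, primaryFactor_eq_zero_iff.mpr ⟨h0, rfl⟩⟩

lemma sigmaDiv_zero : sigmaDiv L 0 = 1 := by simp [sigmaDiv, primaryFactor]

lemma sigmaDiv_neg (z : ℂ) : sigmaDiv L (-z) = sigmaDiv L z := by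
  unfold sigmaDiv
  rw [← (Equiv.neg L.lattice).tprod_eq]
  congr 1; ext l
  simp [primaryFactor]

lemma differentiable_sigma : Differentiable ℂ (sigma L) := by
  rw [funext (sigma_eq L)]
  exact differentiable_id.mul (differentiable_sigmaDiv L)

lemma analyticAt_sigma (z : ℂ) : AnalyticAt ℂ (sigma L) z :=
  (differentiable_sigma L).analyticAt z

lemma sigma_eq_zero_iff {z : ℂ} : sigma L z = 0 ↔ z ∈ L.lattice := by
  rw [sigma_eq, mul_eq_zero, sigmaDiv_eq_zero_iff]
  by_cases h : z = 0 <;> simp [h]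

lemma sigma_neg (z : ℂ) : sigma L (-z) = -sigma L z := by
  rw [sigma_eq, sigma_eq, sigmaDiv_neg, neg_mul]

lemma deriv_sigma_zero : deriv (sigma L) 0 = 1 := by
  rw [funext (sigma_eq L), deriv_fun_mul (by fun_prop) (differentiable_sigmaDiv L 0)]
  simp [sigmaDiv_zero]

lemma deriv_sigma_neg (z : ℂ) : deriv (sigma L) (-z) = deriv (sigma L) z := by
  have h := deriv_comp_neg (sigma L) z
  rw [funext (sigma_neg L), deriv.fun_neg] at h
  exact (neg_injective h).symm

lemma zeta_neg (z : ℂ) : zeta L (-z) = -zeta L z := by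
  rw [zeta, zeta, deriv_sigma_neg, sigma_neg, div_neg]

open PeriodPair in
-- Locally uniform convergence passes to the first two derivatives of the partial products. The
-- logarithmic derivative of a finite product is a sum, and differentiating it termwise produces
-- minus the summands of `℘` other than `1 / z ^ 2`.
lemma deriv_logDeriv_sigmaDiv {z : ℂ} (hz : z ∉ L.lattice) :
    deriv (logDeriv (sigmaDiv L)) z = -L.weierstrassPExcept 0 z := by
  have hne : ∀ l : L.lattice, primaryFactor l z ≠ 0 := fun l h =>
    hz ((primaryFactor_eq_zero_iff.mp h).2 ▸ l.2)
  have h0 : sigmaDiv L z ≠ 0 := fun h => hz ((sigmaDiv_eq_zero_iff L z).mp h).1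
  have hzb : z ∈ Metric.ball (0 : ℂ) (‖z‖ + 1) := by simp
  have t0 := tendstoLocallyUniformlyOn_sigmaDiv L (‖z‖ + 1)
  have hD := fun s : Finset L.lattice => differentiable_prod_primaryFactor L s
  have t1 := t0.deriv (.of_forall fun s => (hD s).differentiableOn) Metric.isOpen_ball
  have t2 := t1.deriv (.of_forall fun s => (hD s).deriv.differentiableOn) Metric.isOpen_ball
  have c0 := t0.tendsto_at hzb
  have c1 := t1.tendsto_at hzb
  have c2 := t2.tendsto_at hzb
  simp only [Function.comp_apply] at c0 c1 c2
  have dlog : ∀ f : ℂ → ℂ, Differentiable ℂ f → f z ≠ 0 → deriv (logDeriv f) z =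
      deriv (deriv f) z / f z - (deriv f z / f z) ^ 2 := by
    intro f hf h
    unfold logDeriv
    rw [deriv_div (hf.deriv z) (hf z) h]
    field_simp
  have lim := (c2.div c0 h0).sub ((c1.div c0 h0).pow 2)
  rw [← dlog _ (differentiable_sigmaDiv L) h0] at lim
  refine tendsto_nhds_unique lim ?_
  refine (L.hasSum_weierstrassPExcept 0 z).neg.congr fun s => ?_
  simp only [Pi.div_apply]
  rw [← dlog _ (hD s) (Finset.prod_ne_zero_iff.mpr fun l _ => hne l)]
  have hev : ∀ᶠ y in 𝓝 z, y ∉ L.lattice := L.isClosed_lattice.isOpen_compl.mem_nhds hz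
  have e1 : logDeriv (fun z => ∏ l ∈ s, primaryFactor l z) =ᶠ[𝓝 z]
      fun y => ∑ l ∈ s, logDeriv (primaryFactor l) y := by
    filter_upwards [hev] with y hy
    exact logDeriv_prod (fun l _ h => hy ((primaryFactor_eq_zero_iff.mp h).2 ▸ l.2))
      (fun l _ => differentiable_primaryFactor _ _)
  have e2 : ∀ l : L.lattice, HasDerivAt (logDeriv (primaryFactor l))
      (-(if (l : ℂ) = 0 then 0 else (1 / (z - l) ^ 2 - 1 / (l : ℂ) ^ 2))) z := by
    intro l
    split_ifs with hl
    · rw [hl, show primaryFactor 0 = fun _ => 1 from funext primaryFactor_zero]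
      have : logDeriv (fun _ : ℂ => (1 : ℂ)) = fun _ => 0 := by ext; simp [logDeriv_apply]
      rw [this]
      simpa using! hasDerivAt_const z (0 : ℂ)
    · have hzl : z - l ≠ 0 := fun h => hz (sub_eq_zero.mp h ▸ l.2)
      have h3 : HasDerivAt (fun y : ℂ => (y - l)⁻¹ + (1 / (l : ℂ) + y / (l : ℂ) ^ 2))
          (-1 / (z - l) ^ 2 + (0 + 1 / (l : ℂ) ^ 2)) z :=
        (((hasDerivAt_id z).sub_const (l : ℂ)).inv hzl).add
          ((hasDerivAt_const z _).add ((hasDerivAt_id z).div_const _))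
      refine (h3.congr_deriv (by ring)).congr_of_eventuallyEq ?_
      filter_upwards [hev] with y hy
      have hyl : y - l ≠ 0 := fun h => hy (sub_eq_zero.mp h ▸ l.2)
      have h4 : HasDerivAt (fun y : ℂ => y / l + y ^ 2 / (2 * (l : ℂ) ^ 2))
          (1 / l + y / (l : ℂ) ^ 2) y := by
        have := ((hasDerivAt_id y).div_const (l : ℂ)).add
          (((hasDerivAt_id y).pow 2).div_const (2 * (l : ℂ) ^ 2))
        refine this.congr_deriv ?_
        simp; field_simp
      have h5 : HasDerivAt (primaryFactor l) _ y :=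
        (((hasDerivAt_id y).div_const (l : ℂ)).const_sub 1).mul h4.cexp
      rw [logDeriv_apply, h5.deriv, primaryFactor]
      have hE := Complex.exp_ne_zero (y / l + y ^ 2 / (2 * (l : ℂ) ^ 2))
      have h6 : 1 - y / (l : ℂ) ≠ 0 := by
        rw [sub_ne_zero]; intro h; apply hyl; field_simp at h; rw [h]; ring
      have h6' : (l : ℂ) - y ≠ 0 := by rw [← neg_sub]; exact neg_ne_zero.mpr hyl
      simp only [id]
      field_simp
      ring
  rw [e1.deriv_eq, deriv_fun_sum fun l _ => (e2 l).differentiableAt]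
  simp_rw [(e2 _).deriv]

lemma analyticAt_zeta {z : ℂ} (hz : z ∉ L.lattice) : AnalyticAt ℂ (zeta L) z :=
  (analyticAt_sigma L z).deriv.div (analyticAt_sigma L z) (fun h => hz ((sigma_eq_zero_iff L).mp h))

lemma zeta_eq {z : ℂ} (hz : z ∉ L.lattice) : zeta L z = 1 / z + logDeriv (sigmaDiv L) z := by
  have h0 : sigmaDiv L z ≠ 0 := fun h => hz ((sigmaDiv_eq_zero_iff L z).mp h).1
  have hz0 : z ≠ 0 := fun h => hz (h ▸ zero_mem _)
  rw [zeta, funext (sigma_eq L), deriv_fun_mul (by fun_prop) (differentiable_sigmaDiv L z),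
    logDeriv_apply]
  simp
  field_simp

lemma deriv_zeta {z : ℂ} (hz : z ∉ L.lattice) : deriv (zeta L) z = -L.weierstrassP z := by
  have h0 : sigmaDiv L z ≠ 0 := fun h => hz ((sigmaDiv_eq_zero_iff L z).mp h).1
  have hz0 : z ≠ 0 := fun h => hz (h ▸ zero_mem _)
  have hev : zeta L =ᶠ[𝓝 z] fun y => 1 / y + logDeriv (sigmaDiv L) y := by
    filter_upwards [L.isClosed_lattice.isOpen_compl.mem_nhds hz] with y hy using zeta_eq L hy
  have hd : DifferentiableAt ℂ (logDeriv (sigmaDiv L)) z :=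
    ((differentiable_sigmaDiv L).deriv z).div (differentiable_sigmaDiv L z) h0
  rw [hev.deriv_eq, deriv_fun_add (by fun_prop (disch := exact hz0)) hd,
    deriv_logDeriv_sigmaDiv L hz, ← L.weierstrassPExcept_add 0 z]
  simp
  ring

lemma isPreconnected_compl_lattice : IsPreconnected ((L.lattice : Set ℂ)ᶜ) := by
  have : Countable L.lattice := L.latticeEquivProd.toEquiv.countable_iff.mpr inferInstance
  exact (Set.Countable.isConnected_compl_of_one_lt_rank (by simp)
    (Set.to_countable (L.lattice : Set ℂ))).isPreconnected

/-- Since `ζ' = -℘` is periodic, `ζ(z + 2w) - ζ(z)` is constant on the connected complement of the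
lattice, and at `z = -w` it equals `2 ζ(w)` by oddness. Then `σ(z + 2w) / (exp(2 ζ(w) (z + w))
σ(z))` has derivative zero, and its value at `-w` is `-1`. -/
lemma sigma_add_two_mul {w : ℂ} (hw : w ∉ L.lattice) (h2 : 2 * w ∈ L.lattice) (z : ℂ) :
    sigma L (z + 2 * w) = -Complex.exp (2 * zeta L w * (z + w)) * sigma L z := by
  have hmem : ∀ z, z ∉ L.lattice → z + 2 * w ∉ L.lattice := fun z hz h =>
    hz (by simpa using sub_mem h h2)
  have hw' : -w ∉ L.lattice := by simpa using hw
  have hO := L.isClosed_lattice.isOpen_compl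
  have hz1 : ∀ z ∉ L.lattice, HasDerivAt (fun y => zeta L (y + 2 * w) - zeta L y) 0 z := by
    intro z hz
    have h1 := (analyticAt_zeta L (hmem z hz)).differentiableAt.hasDerivAt.comp_add_const z (2 * w)
    have h2' := (analyticAt_zeta L hz).differentiableAt.hasDerivAt
    refine (h1.sub h2').congr_deriv ?_
    rw [deriv_zeta L hz, deriv_zeta L (hmem z hz), L.weierstrassP_add_coe z ⟨_, h2⟩, sub_self]
  have hconst : ∀ z ∉ L.lattice, zeta L (z + 2 * w) - zeta L z = 2 * zeta L w := by
    intro z hz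
    have := hO.is_const_of_deriv_eq_zero (isPreconnected_compl_lattice L)
      (fun y hy => (hz1 y hy).differentiableAt.differentiableWithinAt)
      (fun y hy => (hz1 y hy).deriv) (x := z) (y := -w) hz hw'
    rw [this, zeta_neg, show -w + 2 * w = w by ring]; ring
  have hs : ∀ z ∉ L.lattice, sigma L z ≠ 0 := fun z hz h => hz ((sigma_eq_zero_iff L).mp h)
  have hq : ∀ z ∉ L.lattice, HasDerivAt (fun y => sigma L (y + 2 * w) /
      (Complex.exp (2 * zeta L w * (y + w)) * sigma L y)) 0 z := by
    intro z hz
    have h1 := (differentiable_sigma L (z + 2 * w)).hasDerivAt.comp_add_const z (2 * w)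
    have h3 : HasDerivAt (fun y : ℂ => 2 * zeta L w * (y + w)) (2 * zeta L w) z := by
      simpa using ((hasDerivAt_id z).add_const w).const_mul (2 * zeta L w)
    have h4 := h3.cexp.mul (differentiable_sigma L z).hasDerivAt
    refine (h1.div h4 (mul_ne_zero (Complex.exp_ne_zero _) (hs z hz))).congr_deriv ?_
    have hc := hconst z hz
    have s1 := hs z hz
    have s2 := hs _ (hmem z hz)
    have e1 : deriv (sigma L) (z + 2 * w) = (zeta L z + 2 * zeta L w) * sigma L (z + 2 * w) := by
      rw [← hc, zeta, zeta]; field_simp; ring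
    have e2 : deriv (sigma L) z = zeta L z * sigma L z := by rw [zeta]; field_simp
    rw [e1, e2]
    simp only [Pi.mul_apply]
    rw [div_eq_zero_iff]; left; ring
  by_cases hz : z ∈ L.lattice
  · rw [(sigma_eq_zero_iff L).mpr hz, (sigma_eq_zero_iff L).mpr (add_mem hz h2), mul_zero]
  · have := hO.is_const_of_deriv_eq_zero (isPreconnected_compl_lattice L)
      (fun y hy => (hq y hy).differentiableAt.differentiableWithinAt)
      (fun y hy => (hq y hy).deriv) (x := z) (y := -w) hz hw'
    have s0 := hs w hw
    rw [show -w + 2 * w = w by ring, sigma_neg, neg_add_cancel, mul_zero, Complex.exp_zero, one_mul,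
      div_neg, div_self s0, div_eq_iff (mul_ne_zero (Complex.exp_ne_zero _) (hs z hz))] at this
    rw [this]; ring

end HermiteKrichever

end

noncomputable section
namespace HermiteKrichever

/-! ### Lower bounds for orders of meromorphic functions -/

/-- The functions that are meromorphic at `x` of order at least `n`. -/
def ordGE (x : ℂ) (n : ℤ) : Submodule ℂ (ℂ → ℂ) where
  carrier := {f | MeromorphicAt f x ∧ (n : WithTop ℤ) ≤ meromorphicOrderAt f x}
  zero_mem' := ⟨MeromorphicAt.const 0 x, by
    rw [(meromorphicOrderAt_eq_top_iff (f := (0 : ℂ → ℂ))).mpr (by simp)]; exact le_top⟩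
  add_mem' hf hg := ⟨hf.1.add hg.1, (le_min hf.2 hg.2).trans (meromorphicOrderAt_add hf.1 hg.1)⟩
  smul_mem' c f hf := by
    refine ⟨hf.1.const_smul c, ?_⟩
    have h : meromorphicOrderAt (c • f) x = meromorphicOrderAt (fun _ => c) x +
        meromorphicOrderAt f x := meromorphicOrderAt_smul (MeromorphicAt.const c x) hf.1
    rw [h]
    have := add_le_add (analyticAt_const (v := c) (x := x) (𝕜 := ℂ)).meromorphicOrderAt_nonneg hf.2
    simpa using this

lemma mem_ordGE {x : ℂ} {n : ℤ} {f : ℂ → ℂ} : f ∈ ordGE x n ↔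
    MeromorphicAt f x ∧ (n : WithTop ℤ) ≤ meromorphicOrderAt f x := Iff.rfl

lemma ordGE_mono {x : ℂ} {m n : ℤ} (h : m ≤ n) : ordGE x n ≤ ordGE x m :=
  fun _ hf => ⟨hf.1, le_trans (by exact_mod_cast h) hf.2⟩

lemma _root_.AnalyticAt.mem_ordGE {x : ℂ} {f : ℂ → ℂ} (hf : AnalyticAt ℂ f x) : f ∈ ordGE x 0 :=
  ⟨hf.meromorphicAt, hf.meromorphicOrderAt_nonneg⟩

lemma ordGE_congr {x : ℂ} {n : ℤ} {f g : ℂ → ℂ} (h : f =ᶠ[𝓝[≠] x] g) :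
    f ∈ ordGE x n ↔ g ∈ ordGE x n := by
  rw [mem_ordGE, mem_ordGE, meromorphicOrderAt_congr h, MeromorphicAt.meromorphicAt_congr h]

lemma mul_mem_ordGE {x : ℂ} {m n : ℤ} {f g : ℂ → ℂ} (hf : f ∈ ordGE x m) (hg : g ∈ ordGE x n) :
    (fun z => f z * g z) ∈ ordGE x (m + n) := by
  refine ⟨hf.1.mul hg.1, ?_⟩
  rw [show (fun z => f z * g z) = f * g from rfl, meromorphicOrderAt_mul hf.1 hg.1]
  exact_mod_cast add_le_add hf.2 hg.2

lemma mem_ordGE_of_eq {x : ℂ} {n : ℤ} {f : ℂ → ℂ} (hf : MeromorphicAt f x)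
    (h : meromorphicOrderAt f x = n) : f ∈ ordGE x n := ⟨hf, h.ge⟩

lemma zpow_mem_ordGE (x : ℂ) (n : ℤ) : (fun z => (z - x) ^ n) ∈ ordGE x n := by
  refine mem_ordGE_of_eq (by fun_prop) ?_
  exact meromorphicOrderAt_zpow_id_sub_const

lemma exists_analyticAt_of_mem_ordGE {x : ℂ} {n : ℤ} {f : ℂ → ℂ} (hf : f ∈ ordGE x n) :
    ∃ g, AnalyticAt ℂ g x ∧ ∀ᶠ z in 𝓝[≠] x, f z = (z - x) ^ n * g z := by
  have h := mul_mem_ordGE (zpow_mem_ordGE x (-n)) hf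
  rw [neg_add_cancel] at h
  obtain ⟨g, hg, hfg⟩ := h.1.meromorphicOrderAt_nonneg_iff.mp h.2
  refine ⟨g, hg, ?_⟩
  filter_upwards [hfg, self_mem_nhdsWithin] with z hz hzx
  have : z - x ≠ 0 := sub_ne_zero.mpr hzx
  rw [← hz, ← mul_assoc, ← zpow_add₀ this]; simp

lemma mem_ordGE_iff {x : ℂ} {n : ℤ} {f : ℂ → ℂ} : f ∈ ordGE x n ↔
    ∃ g, AnalyticAt ℂ g x ∧ ∀ᶠ z in 𝓝[≠] x, f z = (z - x) ^ n * g z := by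
  refine ⟨exists_analyticAt_of_mem_ordGE, fun ⟨g, hg, h⟩ => (ordGE_congr h).mpr ?_⟩
  simpa using mul_mem_ordGE (zpow_mem_ordGE x n) hg.mem_ordGE

lemma deriv_mem_ordGE_zero {x : ℂ} {f : ℂ → ℂ} (hf : f ∈ ordGE x 0) : deriv f ∈ ordGE x 0 := by
  obtain ⟨g, hg, h⟩ := mem_ordGE_iff.mp hf
  simp only [zpow_zero, one_mul] at h
  exact (ordGE_congr (EventuallyEq.nhdsNE_deriv h)).mpr hg.deriv.mem_ordGE

lemma mem_ordGE_zero_of_tendsto {x c : ℂ} {f : ℂ → ℂ} (hf : MeromorphicAt f x)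
    (h : Tendsto f (𝓝[≠] x) (𝓝 c)) : f ∈ ordGE x 0 :=
  ⟨hf, (tendsto_nhds_iff_meromorphicOrderAt_nonneg hf).mp ⟨c, h⟩⟩

lemma mem_ordGE_one_of_tendsto {x : ℂ} {f : ℂ → ℂ} (hf : MeromorphicAt f x)
    (h : Tendsto f (𝓝[≠] x) (𝓝 0)) : f ∈ ordGE x 1 := by
  refine ⟨hf, ?_⟩
  have := (tendsto_zero_iff_meromorphicOrderAt_pos hf).mp h
  cases ho : meromorphicOrderAt f x with
  | top => exact le_top
  | coe n =>
    rw [ho] at this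
    have : (0 : ℤ) < n := by exact_mod_cast this
    exact_mod_cast this

lemma mem_ordGE_of_zpow_mul {x : ℂ} {m n : ℤ} {f : ℂ → ℂ}
    (h : (fun z => (z - x) ^ m * f z) ∈ ordGE x n) : f ∈ ordGE x (n - m) := by
  have := mul_mem_ordGE (zpow_mem_ordGE x (-m)) h
  rw [neg_add_eq_sub] at this
  refine (ordGE_congr ?_).mp this
  filter_upwards [self_mem_nhdsWithin] with z hz
  have : z - x ≠ 0 := sub_ne_zero.mpr hz
  rw [← mul_assoc, ← zpow_add₀ this]; simp

lemma tendsto_of_mem_ordGE_zero {x : ℂ} {f : ℂ → ℂ} (hf : f ∈ ordGE x 0) :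
    ∃ c, Tendsto f (𝓝[≠] x) (𝓝 c) :=
  (tendsto_nhds_iff_meromorphicOrderAt_nonneg hf.1).mpr hf.2

/-- The quotient `f / g` has no pole, and `c` is its limit. This is the elementary step of every
pole removal below. -/
lemma exists_sub_smul_mem_ordGE {x : ℂ} {n : ℤ} {f g : ℂ → ℂ} (hf : f ∈ ordGE x n)
    (hg : MeromorphicAt g x) (hgn : meromorphicOrderAt g x = n) :
    ∃ c : ℂ, f - c • g ∈ ordGE x (n + 1) := by
  have hinv : (fun z => (g z)⁻¹) ∈ ordGE x (-n) := by
    refine mem_ordGE_of_eq hg.inv ?_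
    rw [show (fun z => (g z)⁻¹) = g⁻¹ from rfl, meromorphicOrderAt_inv, hgn]; rfl
  have hq := mul_mem_ordGE hf hinv
  rw [add_neg_cancel] at hq
  obtain ⟨c, hc⟩ := tendsto_of_mem_ordGE_zero hq
  refine ⟨c, ?_⟩
  have h1 : (fun z => f z * (g z)⁻¹ - c) ∈ ordGE x 1 := by
    refine mem_ordGE_one_of_tendsto (hq.1.sub (MeromorphicAt.const c x)) ?_
    simpa using hc.sub_const c
  have h2 := mul_mem_ordGE h1 (mem_ordGE_of_eq hg hgn)
  rw [add_comm]
  refine (ordGE_congr ?_).mp h2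
  have hne : meromorphicOrderAt g x ≠ ⊤ := by rw [hgn]; exact WithTop.coe_ne_top
  filter_upwards [(meromorphicOrderAt_ne_top_iff_eventually_ne_zero hg).mp hne] with z hz
  simp only [Pi.sub_apply, Pi.smul_apply, smul_eq_mul]
  field_simp

lemma eq_of_eventuallyEq_nhdsNE {f g : ℂ → ℂ} {x : ℂ} (hf : ContinuousAt f x)
    (hg : ContinuousAt g x) (h : f =ᶠ[𝓝[≠] x] g) : f x = g x :=
  ((hf.eventuallyEq_nhds_iff_eventuallyEq_nhdsNE hg).mp h).eq_of_nhds

/-- A meromorphic function without poles agrees with an entire function. -/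
lemma exists_entire {f : ℂ → ℂ} (hf : ∀ x, f ∈ ordGE x 0) :
    ∃ g : ℂ → ℂ, Differentiable ℂ g ∧ ∀ x, f =ᶠ[𝓝[≠] x] g := by
  have hm : MeromorphicOn f Set.univ := fun x _ => (hf x).1
  refine ⟨toMeromorphicNFOn f Set.univ, fun x => ?_, fun x =>
    (hm.toMeromorphicNFOn_eq_self_on_nhdsNE (Set.mem_univ x)).symm⟩
  have h1 := meromorphicNFOn_toMeromorphicNFOn f Set.univ (Set.mem_univ x)
  refine (h1.meromorphicOrderAt_nonneg_iff_analyticAt.mp ?_).differentiableAt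
  rw [meromorphicOrderAt_toMeromorphicNFOn hm (Set.mem_univ x)]
  exact (hf x).2

/-! ### Quasi-periodic functions -/

variable {L : PeriodPair}

/-- `f` is multiplied by `μ₁`, `μ₂` under translation by the two basic periods. -/
def QuasiPer (L : PeriodPair) (μ₁ μ₂ : ℂ) (f : ℂ → ℂ) : Prop :=
  (∀ x, f (x + L.ω₁) = μ₁ * f x) ∧ ∀ x, f (x + L.ω₂) = μ₂ * f x

lemma QuasiPer.exists_mul {μ₁ μ₂ : ℂ} {f : ℂ → ℂ} (h : QuasiPer L μ₁ μ₂ f) (h1 : μ₁ ≠ 0)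
    (h2 : μ₂ ≠ 0) {l : ℂ} (hl : l ∈ L.lattice) : ∃ c : ℂ, c ≠ 0 ∧ ∀ x, f (x + l) = c * f x := by
  induction hl using Submodule.span_induction with
  | mem x hx =>
    rcases hx with rfl | rfl
    · exact ⟨μ₁, h1, h.1⟩
    · exact ⟨μ₂, h2, h.2⟩
  | zero => exact ⟨1, one_ne_zero, by simp⟩
  | add x y _ _ hx hy =>
    obtain ⟨c, hc, hx⟩ := hx
    obtain ⟨d, hd, hy⟩ := hy
    exact ⟨d * c, mul_ne_zero hd hc, fun z => by rw [← add_assoc, hy, hx, mul_assoc]⟩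
  | smul n x _ hx =>
    obtain ⟨c, hc, hx⟩ := hx
    have hn : ∀ (n : ℕ) z, f (z + n * x) = c ^ n * f z := by
      intro n
      induction n with
      | zero => simp
      | succ k ih => intro z; push_cast; rw [add_mul, one_mul, ← add_assoc, hx, ih]; ring
    obtain ⟨k, rfl | rfl⟩ := n.eq_nat_or_neg
    · exact ⟨c ^ k, pow_ne_zero _ hc, fun z => by simpa using hn k z⟩
    · refine ⟨(c ^ k)⁻¹, inv_ne_zero (pow_ne_zero _ hc), fun z => ?_⟩
      have := hn k (z + -(k * x))
      simp only [neg_add_cancel_right] at this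
      simp [this, hc]

/-- Elliptic functions: quasi-periodic functions with trivial multipliers. -/
abbrev Ell (L : PeriodPair) (f : ℂ → ℂ) : Prop := QuasiPer L 1 1 f

lemma ell_iff {f : ℂ → ℂ} : Ell L f ↔ ∀ l ∈ L.lattice, ∀ x, f (x + l) = f x := by
  refine ⟨fun h l hl => ?_, fun h => ⟨fun x => by simpa using h _ L.ω₁_mem_lattice x,
    fun x => by simpa using h _ L.ω₂_mem_lattice x⟩⟩
  induction hl using Submodule.span_induction with
  | mem x hx =>
    rcases hx with rfl | rfl
    · simpa using h.1
    · simpa using h.2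
  | zero => simp
  | add x y _ _ hx hy => intro z; rw [← add_assoc, hy, hx]
  | smul n x _ hx =>
    intro z
    have : Function.Periodic f x := hx
    simpa using this.int_mul n z

lemma QuasiPer.mem_ordGE_add {μ₁ μ₂ : ℂ} {f : ℂ → ℂ} (h : QuasiPer L μ₁ μ₂ f) (h1 : μ₁ ≠ 0)
    (h2 : μ₂ ≠ 0) {l : ℂ} (hl : l ∈ L.lattice) {x : ℂ} {n : ℤ} (hf : f ∈ ordGE x n) :
    f ∈ ordGE (x + l) n := by
  obtain ⟨c, hc, hcl⟩ := h.exists_mul h1 h2 hl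
  have e : (fun z => f (z + l)) = c • f := funext fun z => by simp [hcl]
  have h3 : (fun z => f (z + l)) ∈ ordGE x n := e ▸ (ordGE x n).smul_mem c hf
  obtain ⟨g, hg, hgf⟩ := mem_ordGE_iff.mp h3
  refine mem_ordGE_iff.mpr ⟨fun z => g (z - l), ?_, ?_⟩
  · exact AnalyticAt.fun_comp (f := fun z => z - l) (g := g) (x := x + l) (by simpa using hg)
      (by fun_prop)
  · have ht : Tendsto (fun z => z - l) (𝓝[≠] (x + l)) (𝓝[≠] x) := by
      refine tendsto_nhdsWithin_iff.mpr ⟨?_, ?_⟩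
      · refine (Continuous.tendsto' (by fun_prop) _ _ (by simp)).mono_left nhdsWithin_le_nhds
      · filter_upwards [self_mem_nhdsWithin] with z hz h
        exact hz (by simpa [sub_eq_iff_eq_add] using h)
    filter_upwards [ht.eventually hgf] with z hz
    rw [sub_add_cancel] at hz
    rw [hz, sub_sub, add_comm l]

/-- Liouville's theorem for quasi-periodic functions. -/
lemma QuasiPer.liouville {μ₁ μ₂ : ℂ} {f : ℂ → ℂ} (h : QuasiPer L μ₁ μ₂ f)
    (hf : ∀ x, f ∈ ordGE x 0) {lam : ℂ} (h1 : ‖μ₁‖ = ‖Complex.exp (lam * L.ω₁)‖)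
    (h2 : ‖μ₂‖ = ‖Complex.exp (lam * L.ω₂)‖) :
    ∃ C : ℂ, ∀ x, f =ᶠ[𝓝[≠] x] fun z => C * Complex.exp (lam * z) := by
  obtain ⟨g, hg, hfg⟩ := exists_entire hf
  have hq : ∀ w μ : ℂ, (∀ x, f (x + w) = μ * f x) → ∀ x, g (x + w) = μ * g x := by
    intro w μ hw x
    have ht : Tendsto (fun z => z + w) (𝓝[≠] x) (𝓝[≠] (x + w)) := by
      refine tendsto_nhdsWithin_iff.mpr ⟨?_, ?_⟩
      · exact (Continuous.tendsto' (by fun_prop) _ _ rfl).mono_left nhdsWithin_le_nhds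
      · filter_upwards [self_mem_nhdsWithin] with z hz h
        exact hz (by simpa using h)
    refine eq_of_eventuallyEq_nhdsNE (f := fun x => g (x + w)) (g := fun x => μ * g x)
      (hg.continuous.comp (continuous_id.add continuous_const)).continuousAt
      (continuous_const.mul hg.continuous).continuousAt ?_
    filter_upwards [ht.eventually (hfg (x + w)), hfg x] with z hz hz'
    rw [← hz, ← hz', hw]
  -- Only the absolute values of the multipliers have to match: `‖G‖` is then doubly periodic, so
  -- `G` is bounded and entire.
  set G : ℂ → ℂ := fun z => g z * Complex.exp (-(lam * z)) with hG
  have hGd : Differentiable ℂ G := by fun_prop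
  have key : ∀ w μ : ℂ, (∀ x, g (x + w) = μ * g x) → ‖μ‖ = ‖Complex.exp (lam * w)‖ →
      ∀ x, ‖G (x + w)‖ = ‖G x‖ := by
    intro w μ hw hμ x
    simp only [hG]
    rw [hw, norm_mul, norm_mul, hμ, norm_mul, mul_add, neg_add, Complex.exp_add, norm_mul,
      Complex.exp_neg (lam * w), norm_inv]
    have := norm_pos_iff.mpr (Complex.exp_ne_zero (lam * w))
    field_simp
  have hell : Ell L (fun z => ((‖G z‖ : ℝ) : ℂ)) :=
    ⟨fun x => by simp only [key _ _ (hq _ _ h.1) h1, one_mul],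
     fun x => by simp only [key _ _ (hq _ _ h.2) h2, one_mul]⟩
  have hb := (IsZLattice.isCompact_range_of_periodic L.lattice (fun z => ‖G z‖)
    hGd.continuous.norm (fun z w hw => by exact_mod_cast ell_iff.mp hell w hw z)).isBounded
  have hb' : Bornology.IsBounded (Set.range G) := by
    obtain ⟨M, hM⟩ := hb.exists_norm_le
    refine isBounded_iff_forall_norm_le.mpr ⟨M, ?_⟩
    rintro _ ⟨z, rfl⟩
    simpa using hM _ ⟨z, rfl⟩
  obtain ⟨C, hC⟩ := hGd.exists_eq_const_of_bounded hb'
  refine ⟨C, fun x => ?_⟩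
  filter_upwards [hfg x] with z hz
  have : G z = C := by rw [hC]; rfl
  rw [hz, ← this, hG]
  simp only
  rw [mul_assoc, ← Complex.exp_add]; simp

lemma Ell.eventually_const {f : ℂ → ℂ} (h : Ell L f) (hf : ∀ x, f ∈ ordGE x 0) :
    ∃ C : ℂ, ∀ x, f =ᶠ[𝓝[≠] x] fun _ => C := by
  obtain ⟨C, hC⟩ := QuasiPer.liouville h hf (lam := 0) (by simp) (by simp)
  exact ⟨C, fun x => by simpa using hC x⟩

/-- Every pair of nonzero multipliers has the absolute values of the multipliers of an
exponential. -/
lemma exists_norm_exp_eq (L : PeriodPair) {μ₁ μ₂ : ℂ} (h1 : μ₁ ≠ 0) (h2 : μ₂ ≠ 0) :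
    ∃ lam : ℂ, ‖μ₁‖ = ‖Complex.exp (lam * L.ω₁)‖ ∧ ‖μ₂‖ = ‖Complex.exp (lam * L.ω₂)‖ := by
  set φ : ℂ →ₗ[ℝ] ℝ := L.basis.constr ℝ ![Real.log ‖μ₁‖, Real.log ‖μ₂‖] with hφ
  have e1 : φ L.ω₁ = Real.log ‖μ₁‖ := by
    have := L.basis.constr_basis ℝ ![Real.log ‖μ₁‖, Real.log ‖μ₂‖] 0
    rwa [L.basis_zero] at this
  have e2 : φ L.ω₂ = Real.log ‖μ₂‖ := by
    have := L.basis.constr_basis ℝ ![Real.log ‖μ₁‖, Real.log ‖μ₂‖] 1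
    rwa [L.basis_one] at this
  -- Every real linear form on `ℂ` is `z ↦ Re (lam z)`; the form `φ` is the one with the values `log
  -- ‖μ₁‖`, `log ‖μ₂‖` on the periods.
  have hre : ∀ z, (((φ 1 : ℂ) - φ Complex.I * Complex.I) * z).re = φ z := by
    intro z
    conv_rhs => rw [← Complex.re_add_im z]
    have a1 : ((z.re : ℂ)) = z.re • (1 : ℂ) := by simp
    have a2 : ((z.im : ℂ)) * Complex.I = z.im • Complex.I := by simp
    rw [map_add, a1, a2, map_smul, map_smul]
    simp; ring
  refine ⟨(φ 1 : ℂ) - φ Complex.I * Complex.I, ?_, ?_⟩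
  · rw [Complex.norm_exp, hre, e1, Real.exp_log (norm_pos_iff.mpr h1)]
  · rw [Complex.norm_exp, hre, e2, Real.exp_log (norm_pos_iff.mpr h2)]

/-! ### Nondegeneracy of the quasi-periods of zeta -/

lemma two_mul_half_mem₁ : 2 * (L.ω₁ / 2) ∈ L.lattice := by
  rw [mul_div_cancel₀ _ two_ne_zero]; exact L.ω₁_mem_lattice

lemma two_mul_half_mem₂ : 2 * (L.ω₂ / 2) ∈ L.lattice := by
  rw [mul_div_cancel₀ _ two_ne_zero]; exact L.ω₂_mem_lattice

/-- Otherwise `σ(z) exp(-a z ^ 2 / 2)` would be entire with both multipliers `-1`, hence constant by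
Liouville; it vanishes at `0` but not at a half period. -/
lemma not_zeta_proportional (a : ℂ) :
    ¬(zeta L (L.ω₁ / 2) = a * (L.ω₁ / 2) ∧ zeta L (L.ω₂ / 2) = a * (L.ω₂ / 2)) := by
  rintro ⟨h1, h2⟩
  set τ : ℂ → ℂ := fun z => sigma L z * Complex.exp (-(a * z ^ 2 / 2)) with hτ
  have key : ∀ w, w ∉ L.lattice → 2 * w ∈ L.lattice → zeta L w = a * w → ∀ x,
      τ (x + 2 * w) = -1 * τ x := by
    intro w hw h2w hz x
    simp only [hτ]
    rw [sigma_add_two_mul L hw h2w, hz, neg_mul, neg_mul, neg_mul, mul_right_comm, one_mul,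
      ← Complex.exp_add, mul_comm]
    congr 3; ring
  have hq : QuasiPer L (-1) (-1) τ := by
    constructor
    · intro x
      have := key _ L.ω₁_div_two_notMem_lattice two_mul_half_mem₁ h1 x
      rwa [mul_div_cancel₀ _ two_ne_zero] at this
    · intro x
      have := key _ L.ω₂_div_two_notMem_lattice two_mul_half_mem₂ h2 x
      rwa [mul_div_cancel₀ _ two_ne_zero] at this
  have hd : Differentiable ℂ τ := by have := differentiable_sigma L; fun_prop
  obtain ⟨C, hC⟩ := hq.liouville (fun x => (hd.analyticAt x).mem_ordGE) (lam := 0)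
    (by simp) (by simp)
  have hC' : ∀ x, τ x = C := fun x => by
    have := eq_of_eventuallyEq_nhdsNE hd.continuous.continuousAt (by fun_prop) (hC x)
    simpa using this
  have h0 : C = 0 := by rw [← hC' 0, hτ]; simp [(sigma_eq_zero_iff L).mpr (zero_mem _)]
  have hw := hC' (L.ω₁ / 2)
  rw [h0, hτ] at hw
  simp only [mul_eq_zero, Complex.exp_ne_zero, or_false] at hw
  exact L.ω₁_div_two_notMem_lattice ((sigma_eq_zero_iff L).mp hw)

/-- A weak form of the Legendre relation: its exact value is not needed, only the solvability of the
linear system for `α` and `κ` from given multipliers. -/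
lemma zeta_det_ne_zero (L : PeriodPair) :
    zeta L (L.ω₁ / 2) * L.ω₂ - zeta L (L.ω₂ / 2) * L.ω₁ ≠ 0 := by
  intro h
  have h1 : L.ω₁ ≠ 0 := fun h => L.ω₁_div_two_notMem_lattice (by simp [h])
  refine not_zeta_proportional (L := L) (zeta L (L.ω₁ / 2) / (L.ω₁ / 2)) ⟨by field_simp, ?_⟩
  field_simp
  linear_combination -h

lemma zeta_mem_ordGE (L : PeriodPair) : zeta L ∈ ordGE 0 (-1) ∧
    meromorphicOrderAt (zeta L) 0 = (-1 : ℤ) := by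
  have hs : meromorphicOrderAt (sigma L) 0 = (1 : ℤ) := by
    rw [meromorphicOrderAt_eq_int_iff (analyticAt_sigma L 0).meromorphicAt]
    refine ⟨sigmaDiv L, (differentiable_sigmaDiv L).analyticAt 0, by simp [sigmaDiv_zero], ?_⟩
    filter_upwards with z; simp [sigma_eq]
  have h := meromorphicOrderAt_logDeriv_eq_neg_one (analyticAt_sigma L 0).meromorphicAt
    (by rw [hs]; simp) (by rw [hs]; simp)
  have hz : zeta L = logDeriv (sigma L) := rfl
  rw [← hz] at h
  have h' : meromorphicOrderAt (zeta L) 0 = (-1 : ℤ) := by rw [h]; rfl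
  exact ⟨mem_ordGE_of_eq ((analyticAt_sigma L 0).deriv.meromorphicAt.div
    (analyticAt_sigma L 0).meromorphicAt) h', h'⟩

/-- An elliptic function with at most one simple pole modulo periods is constant. -/
lemma Ell.eventually_const_of_simple_pole {f : ℂ → ℂ} (h : Ell L f) (h0 : f ∈ ordGE 0 (-1))
    (hf : ∀ x ∉ L.lattice, f ∈ ordGE x 0) : ∃ C : ℂ, ∀ x, f =ᶠ[𝓝[≠] x] fun _ => C := by
  obtain ⟨c, hc⟩ := exists_sub_smul_mem_ordGE h0 (zeta_mem_ordGE L).1.1 (zeta_mem_ordGE L).2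
  simp only [Int.reduceNeg, neg_add_cancel] at hc
  by_cases hc0 : c = 0
  · simp only [hc0, zero_smul, sub_zero] at hc
    refine h.eventually_const fun x => ?_
    by_cases hx : x ∈ L.lattice
    · simpa using h.mem_ordGE_add one_ne_zero one_ne_zero hx hc
    · exact hf x hx
  exfalso
  -- With `c` the residue, `k` is the derivative of `f - c ζ`. It is elliptic without poles, hence a
  -- constant `A`, and `f = c ζ + A z + const`.
  set k : ℂ → ℂ := deriv f + c • L.weierstrassP with hk
  have hev : ∀ x, ∀ᶠ z in 𝓝[≠] x, z ∉ L.lattice := by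
    intro x
    have := L.compl_lattice_sdiff_singleton_mem_nhds x
    filter_upwards [nhdsWithin_le_nhds this, self_mem_nhdsWithin] with z hz hzx hzl
    exact hz ⟨hzl, hzx⟩
  have hfm : ∀ x, MeromorphicAt f x := fun x => by
    by_cases hx : x ∈ L.lattice
    · have := h.mem_ordGE_add one_ne_zero one_ne_zero hx h0
      rw [zero_add] at this; exact this.1
    · exact (hf x hx).1
  have hdk : ∀ x, deriv (f - c • zeta L) =ᶠ[𝓝[≠] x] k := by
    intro x
    filter_upwards [(hfm x).eventually_analyticAt, hev x] with z hz hzl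
    rw [deriv_sub hz.differentiableAt ((analyticAt_zeta L hzl).differentiableAt.const_smul c),
      deriv_const_smul _ (analyticAt_zeta L hzl).differentiableAt, deriv_zeta L hzl, hk]
    simp
  have hkE : Ell L k := by
    rw [ell_iff]
    intro l hl x
    have e1 : deriv f (x + l) = deriv f x := by
      rw [← deriv_comp_add_const]
      congr 1
      exact funext fun z => ell_iff.mp h l hl z
    simp only [hk, Pi.add_apply, Pi.smul_apply, e1, L.weierstrassP_add_coe x ⟨l, hl⟩]
  have hg0 : ∀ x, f - c • zeta L ∈ ordGE x 0 ∨ x ∈ L.lattice := by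
    intro x
    by_cases hx : x ∈ L.lattice
    · exact Or.inr hx
    · exact Or.inl (sub_mem (hf x hx)
        ((ordGE x 0).smul_mem c (analyticAt_zeta L hx).mem_ordGE))
  have hk0 : ∀ x, k ∈ ordGE x 0 := by
    intro x
    rcases hg0 x with hx | hx
    · exact (ordGE_congr (hdk x)).mp (deriv_mem_ordGE_zero hx)
    · have := hkE.mem_ordGE_add one_ne_zero one_ne_zero hx
        ((ordGE_congr (hdk 0)).mp (deriv_mem_ordGE_zero hc))
      rwa [zero_add] at this
  obtain ⟨A, hA⟩ := hkE.eventually_const hk0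
  -- The values of `f` at removable singularities are arbitrary, so a normal form is needed before
  -- evaluating at points.
  set F : ℂ → ℂ := toMeromorphicNFOn f Set.univ with hF
  have hfO : MeromorphicOn f Set.univ := fun x _ => hfm x
  have hFf : ∀ x, f =ᶠ[𝓝[≠] x] F := fun x =>
    (hfO.toMeromorphicNFOn_eq_self_on_nhdsNE (Set.mem_univ x)).symm
  have hFan : ∀ x ∉ L.lattice, AnalyticAt ℂ F x := by
    intro x hx
    have h1 := meromorphicNFOn_toMeromorphicNFOn f Set.univ (Set.mem_univ x)
    refine h1.meromorphicOrderAt_nonneg_iff_analyticAt.mp ?_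
    rw [meromorphicOrderAt_toMeromorphicNFOn hfO (Set.mem_univ x)]
    exact (hf x hx).2
  set G : ℂ → ℂ := fun z => F z - c * zeta L z - A * z with hG
  have hGan : ∀ x ∉ L.lattice, AnalyticAt ℂ G x := fun x hx =>
    ((hFan x hx).sub (analyticAt_const.mul (analyticAt_zeta L hx))).sub
      (analyticAt_const.mul analyticAt_id)
  have hGd : ∀ x ∉ L.lattice, deriv G x = 0 := by
    intro x hx
    refine eq_of_eventuallyEq_nhdsNE (g := fun _ => 0) (hGan x hx).deriv.continuousAt
      continuousAt_const ?_
    filter_upwards [EventuallyEq.nhdsNE_deriv (hFf x), hA x, hev x, hk0 x |>.1.eventually_analyticAt]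
      with z hz hAz hzl hkz
    have d1 := (hFan z hzl).differentiableAt.hasDerivAt
    have d2 := (analyticAt_zeta L hzl).differentiableAt.hasDerivAt.const_mul c
    have d3 : HasDerivAt (fun z => A * z) A z := by simpa using (hasDerivAt_id z).const_mul A
    rw [((d1.fun_sub d2).fun_sub d3).deriv, deriv_zeta L hzl, ← hz, ← hAz]
    simp [hk]
  have hGc : ∀ x ∉ L.lattice, ∀ y ∉ L.lattice, G x = G y := fun x hx y hy =>
    L.isClosed_lattice.isOpen_compl.is_const_of_deriv_eq_zero (isPreconnected_compl_lattice L)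
      (fun z hz => (hGan z hz).differentiableAt.differentiableWithinAt)
      (fun z hz => hGd z hz) hx hy
  -- Compare `F - c ζ - A z` at the half periods `w` and `-w`: the elliptic part agrees and the rest
  -- is odd. This would make `ζ` proportional to the identity on half periods.
  have key : ∀ w ∉ L.lattice, 2 * w ∈ L.lattice → zeta L w = -(A / c) * w := by
    intro w hw h2w
    have hw' : -w ∉ L.lattice := by simpa using hw
    have e := hGc w hw (-w) hw'
    have hFw : F w = F (-w) := by
      have ht : Tendsto (fun z => z - 2 * w) (𝓝[≠] w) (𝓝[≠] (-w)) := by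
        refine tendsto_nhdsWithin_iff.mpr ⟨?_, ?_⟩
        · exact (Continuous.tendsto' (by fun_prop) _ _ (by ring)).mono_left nhdsWithin_le_nhds
        · filter_upwards [self_mem_nhdsWithin] with z hz hh
          exact hz (by
            have : z - 2 * w = -w := hh
            have : z = w := by linear_combination this
            exact this)
      have := eq_of_eventuallyEq_nhdsNE (f := F) (g := fun z => F (z - 2 * w)) (x := w)
        (hFan w hw).continuousAt (by
          refine ContinuousAt.comp' (g := F) (f := fun z => z - 2 * w) ?_ (by fun_prop)
          rw [show w - 2 * w = -w by ring]; exact (hFan _ hw').continuousAt) (by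
          filter_upwards [hFf w, ht.eventually (hFf (-w))] with z h1 h2
          rw [← h1, ← h2]
          have := ell_iff.mp h (2 * w) h2w (z - 2 * w)
          rwa [sub_add_cancel] at this)
      rwa [show w - 2 * w = -w by ring] at this
    simp only [hG] at e
    rw [hFw, zeta_neg] at e
    field_simp
    linear_combination (-1 / 2 : ℂ) * e
  exact not_zeta_proportional (L := L) (-(A / c))
    ⟨key _ L.ω₁_div_two_notMem_lattice two_mul_half_mem₁,
     key _ L.ω₂_div_two_notMem_lattice two_mul_half_mem₂⟩

end HermiteKrichever

end

noncomputable section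
namespace HermiteKrichever

/-! ### The Weierstrass function `℘` -/

variable (L : PeriodPair)

lemma tendsto_sub_nhdsNE (c x : ℂ) : Tendsto (fun z => z - c) (𝓝[≠] x) (𝓝[≠] (x - c)) := by
  refine tendsto_nhdsWithin_iff.mpr ⟨?_, ?_⟩
  · exact (Continuous.tendsto' (by fun_prop) _ _ rfl).mono_left nhdsWithin_le_nhds
  · filter_upwards [self_mem_nhdsWithin] with z hz h
    exact hz (by simpa using h)

lemma eventually_notMem_lattice (x : ℂ) : ∀ᶠ z in 𝓝[≠] x, z ∉ L.lattice := by
  filter_upwards [nhdsWithin_le_nhds (L.compl_lattice_sdiff_singleton_mem_nhds x),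
    self_mem_nhdsWithin] with z hz hzx hzl
  exact hz ⟨hzl, hzx⟩

lemma sigma_ne_zero {z : ℂ} (hz : z ∉ L.lattice) : sigma L z ≠ 0 :=
  fun h => hz ((sigma_eq_zero_iff L).mp h)

lemma analyticAt_wp {z : ℂ} (hz : z ∉ L.lattice) : AnalyticAt ℂ L.weierstrassP z :=
  L.analyticOnNhd_weierstrassP z hz

lemma analyticAt_wp' {z : ℂ} (hz : z ∉ L.lattice) : AnalyticAt ℂ L.derivWeierstrassP z :=
  L.analyticOnNhd_derivWeierstrassP z hz

lemma hasDerivAt_wp {z : ℂ} (hz : z ∉ L.lattice) :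
    HasDerivAt L.weierstrassP (L.derivWeierstrassP z) z := by
  have := (analyticAt_wp L hz).differentiableAt.hasDerivAt
  rwa [L.deriv_weierstrassP] at this

lemma tendsto_sigma_div : Tendsto (fun z => z / sigma L z) (𝓝[≠] 0) (𝓝 1) := by
  have h : Tendsto (fun z => (sigmaDiv L z)⁻¹) (𝓝[≠] 0) (𝓝 1) := by
    have := (differentiable_sigmaDiv L).continuous.continuousAt (x := 0)
    have h2 := (this.inv₀ (by simp [sigmaDiv_zero])).tendsto.mono_left
      (nhdsWithin_le_nhds (s := {0}ᶜ))
    rw [show (1 : ℂ) = (sigmaDiv L 0)⁻¹ by simp [sigmaDiv_zero]]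
    exact h2
  refine h.congr' ?_
  filter_upwards [self_mem_nhdsWithin] with z hz
  have : z ≠ 0 := hz
  rw [sigma_eq]; field_simp

lemma tendsto_sq_mul_wp : Tendsto (fun z => z ^ 2 * L.weierstrassP z) (𝓝[≠] 0) (𝓝 1) := by
  have h : ContinuousAt (fun z => z ^ 2 * L.weierstrassPExcept 0 z + 1) 0 := by
    have := (L.analyticAt_weierstrassPExcept 0).continuousAt
    fun_prop
  have h2 := h.tendsto
  simp only [ne_eq, OfNat.ofNat_ne_zero, not_false_eq_true, zero_pow, zero_mul, zero_add] at h2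
  refine (h2.mono_left nhdsWithin_le_nhds).congr' ?_
  filter_upwards [self_mem_nhdsWithin] with z hz
  have : z ≠ 0 := hz
  have e := L.weierstrassPExcept_add 0 z
  rw [← e]; simp; field_simp

/-- The exponential multipliers of the `σ`-quotient cancel, and its double pole at `0` cancels that
of `℘`. So `F` is elliptic with at most a simple pole modulo periods, hence constant; the constant
is read off at `x = a`. -/
lemma wp_sub_wp {a x : ℂ} (ha : a ∉ L.lattice) (hx : x ∉ L.lattice) :
    L.weierstrassP x - L.weierstrassP a =
      -(sigma L (x + a) * sigma L (x - a)) / (sigma L x ^ 2 * sigma L a ^ 2) := by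
  set F : ℂ → ℂ := fun x => L.weierstrassP x +
    sigma L (x + a) * sigma L (x - a) / (sigma L x ^ 2 * sigma L a ^ 2) with hF
  have hsa := sigma_ne_zero L ha
  have hper : ∀ w, w ∉ L.lattice → 2 * w ∈ L.lattice → ∀ x, F (x + 2 * w) = F x := by
    intro w hw h2 x
    simp only [hF]
    rw [L.weierstrassP_add_coe x ⟨_, h2⟩, show x + 2 * w + a = x + a + 2 * w by ring,
      show x + 2 * w - a = x - a + 2 * w by ring, sigma_add_two_mul L hw h2,
      sigma_add_two_mul L hw h2, sigma_add_two_mul L hw h2]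
    congr 1
    by_cases hx0 : sigma L x = 0
    · simp [hx0]
    have e : Complex.exp (2 * zeta L w * (x + a + w)) * Complex.exp (2 * zeta L w * (x - a + w)) =
        Complex.exp (2 * zeta L w * (x + w)) ^ 2 := by
      rw [← Complex.exp_add, ← Complex.exp_nat_mul]; congr 1; push_cast; ring
    have := Complex.exp_ne_zero (2 * zeta L w * (x + w))
    rw [div_eq_div_iff (by simp [hx0, hsa, this]) (by simp [hx0, hsa])]
    linear_combination (sigma L (x + a) * sigma L (x - a) * (sigma L x ^ 2 * sigma L a ^ 2)) * e
  have hell : Ell L F := by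
    constructor
    · intro x
      have := hper _ L.ω₁_div_two_notMem_lattice two_mul_half_mem₁ x
      rw [mul_div_cancel₀ _ two_ne_zero] at this; rw [this, one_mul]
    · intro x
      have := hper _ L.ω₂_div_two_notMem_lattice two_mul_half_mem₂ x
      rw [mul_div_cancel₀ _ two_ne_zero] at this; rw [this, one_mul]
  have han : ∀ x ∉ L.lattice, AnalyticAt ℂ F x := by
    intro x hx
    have h1 : AnalyticAt ℂ (fun x => sigma L (x + a)) x :=
      AnalyticAt.fun_comp (f := fun x => x + a) (analyticAt_sigma L _) (by fun_prop)
    have h2 : AnalyticAt ℂ (fun x => sigma L (x - a)) x :=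
      AnalyticAt.fun_comp (f := fun x => x - a) (analyticAt_sigma L _) (by fun_prop)
    exact (analyticAt_wp L hx).add ((h1.mul h2).div
      (((analyticAt_sigma L x).pow 2).mul analyticAt_const)
      (by simp [sigma_ne_zero L hx, hsa]))
  have hm : MeromorphicAt F 0 := by
    have h1 : AnalyticAt ℂ (fun x => sigma L (x + a)) 0 :=
      AnalyticAt.fun_comp (f := fun x => x + a) (analyticAt_sigma L _) (by fun_prop)
    have h2 : AnalyticAt ℂ (fun x => sigma L (x - a)) 0 :=
      AnalyticAt.fun_comp (f := fun x => x - a) (analyticAt_sigma L _) (by fun_prop)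
    exact (L.meromorphic_weierstrassP 0).add ((h1.mul h2).meromorphicAt.div
      (((analyticAt_sigma L 0).pow 2).mul analyticAt_const).meromorphicAt)
  have h0 : F ∈ ordGE 0 (-1) := by
    have ht : Tendsto (fun z => (z - 0) ^ (2 : ℤ) * F z) (𝓝[≠] 0) (𝓝 0) := by
      have hc : Tendsto (fun z => sigma L (z + a) * sigma L (z - a) / sigma L a ^ 2)
          (𝓝[≠] 0) (𝓝 (-1)) := by
        have hcs := (differentiable_sigma L).continuous
        have : Continuous (fun z => sigma L (z + a) * sigma L (z - a) / sigma L a ^ 2) := by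
          fun_prop
        refine (this.tendsto' 0 _ ?_).mono_left nhdsWithin_le_nhds
        simp only [zero_add, zero_sub, sigma_neg]; field_simp
      have := (tendsto_sq_mul_wp L).add (((tendsto_sigma_div L).pow 2).mul hc)
      simp only [one_pow, one_mul, add_neg_cancel] at this
      refine this.congr fun z => ?_
      simp only [hF, sub_zero]
      norm_cast
      ring
    have := mem_ordGE_of_zpow_mul (mem_ordGE_one_of_tendsto
      (((zpow_mem_ordGE 0 2).1).mul hm) ht)
    simpa using this
  obtain ⟨C, hC⟩ := hell.eventually_const_of_simple_pole h0 fun x hx => (han x hx).mem_ordGE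
  have hC' : ∀ x ∉ L.lattice, F x = C := fun x hx =>
    eq_of_eventuallyEq_nhdsNE (han x hx).continuousAt continuousAt_const (hC x)
  have e1 := hC' x hx
  have e2 := hC' a ha
  simp only [hF, sub_self, (sigma_eq_zero_iff L).mpr (zero_mem _), mul_zero, zero_div,
    add_zero] at e2
  rw [e2, neg_div, ← e1]; simp only [hF]; ring

lemma wp_eq_wp_iff {a x : ℂ} (ha : a ∉ L.lattice) (hx : x ∉ L.lattice) :
    L.weierstrassP x = L.weierstrassP a ↔ x - a ∈ L.lattice ∨ x + a ∈ L.lattice := by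
  rw [← sub_eq_zero, wp_sub_wp L ha hx]
  simp [sigma_ne_zero L ha, sigma_ne_zero L hx, sigma_eq_zero_iff, or_comm]

/-- In the `σ`-quotient for `℘(x) - ℘(a)` the factor `σ(x - a)` has derivative `1` at `a`, and the
cofactor contains `σ(2a) ≠ 0`. -/
lemma wp'_ne_zero {a : ℂ} (h2a : 2 * a ∉ L.lattice) : L.derivWeierstrassP a ≠ 0 := by
  have ha : a ∉ L.lattice := fun h => h2a (by rw [two_mul]; exact add_mem h h)
  have hsa := sigma_ne_zero L ha
  have h1 : HasDerivAt (fun x => L.weierstrassP x - L.weierstrassP a) (L.derivWeierstrassP a) a :=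
    (hasDerivAt_wp L ha).sub_const _
  have h2 : HasDerivAt (fun x => sigma L (x - a)) 1 a := by
    have := (differentiable_sigma L (a - a)).hasDerivAt.comp_sub_const a a
    rwa [sub_self, deriv_sigma_zero] at this
  have hd : DifferentiableAt ℂ (fun x => -(sigma L (x + a)) / (sigma L x ^ 2 * sigma L a ^ 2)) a := by
    have := differentiable_sigma L
    fun_prop (disch := simp [hsa])
  have h3 := h2.mul hd.hasDerivAt
  have h4 : (fun x => L.weierstrassP x - L.weierstrassP a) =ᶠ[𝓝 a]
      fun x => sigma L (x - a) * (-(sigma L (x + a)) / (sigma L x ^ 2 * sigma L a ^ 2)) := by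
    filter_upwards [L.isClosed_lattice.isOpen_compl.mem_nhds ha] with x hx
    rw [wp_sub_wp L ha hx]; ring
  rw [h1.unique (h3.congr_of_eventuallyEq h4), sub_self, (sigma_eq_zero_iff L).mpr (zero_mem _),
    zero_mul, add_zero, one_mul, ← two_mul]
  have := sigma_ne_zero L h2a
  simp [hsa, this]

lemma wp'_eq_zero {a : ℂ} (h2a : 2 * a ∈ L.lattice) : L.derivWeierstrassP a = 0 := by
  have h1 := L.derivWeierstrassP_neg a
  have h2 := L.derivWeierstrassP_add_coe (-a) ⟨_, h2a⟩
  simp only at h2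
  rw [show -a + 2 * a = a by ring, h1] at h2
  linear_combination (1 / 2 : ℂ) * h2

/-- The cubic polynomial `4 z ^ 3 - g₂ z - g₃`. -/
def cubic (z : ℂ) : ℂ := 4 * z ^ 3 - L.g₂ * z - L.g₃

lemma wp'_sq {z : ℂ} (hz : z ∉ L.lattice) : L.derivWeierstrassP z ^ 2 = cubic L (L.weierstrassP z) :=
  L.derivWeierstrassP_sq z hz

/-- Differentiate `℘' ^ 2 = 4 ℘ ^ 3 - g₂ ℘ - g₃` and cancel `℘'`. This fails at the half periods,
which are isolated, so continuity supplies the identity there. -/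
lemma deriv_wp' {z : ℂ} (hz : z ∉ L.lattice) :
    deriv L.derivWeierstrassP z = 6 * L.weierstrassP z ^ 2 - L.g₂ / 2 := by
  have gen : ∀ y ∉ L.lattice, L.derivWeierstrassP y ≠ 0 →
      deriv L.derivWeierstrassP y = 6 * L.weierstrassP y ^ 2 - L.g₂ / 2 := by
    intro y hy h0
    have h1 := ((analyticAt_wp' L hy).differentiableAt.hasDerivAt).pow 2
    have w := hasDerivAt_wp L hy
    have h2 := (((w.pow 3).const_mul 4).sub (w.const_mul L.g₂)).sub_const L.g₃
    have h3 := h2.congr_of_eventuallyEq (f₁ := L.derivWeierstrassP ^ 2) (by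
      filter_upwards [L.isClosed_lattice.isOpen_compl.mem_nhds hy] with x hx
      simpa [cubic] using wp'_sq L hx)
    have h4 := h1.unique h3
    simp only [Nat.cast_ofNat, Nat.add_one_sub_one, pow_one] at h4
    apply mul_left_cancel₀ h0
    linear_combination (1 / 2 : ℂ) * h4
  have hw := (analyticAt_wp L hz).continuousAt
  refine eq_of_eventuallyEq_nhdsNE (f := deriv L.derivWeierstrassP)
    (g := fun z => 6 * L.weierstrassP z ^ 2 - L.g₂ / 2)
    (analyticAt_wp' L hz).deriv.continuousAt (by fun_prop) ?_
  have ht : Tendsto (fun y => 2 * y) (𝓝[≠] z) (𝓝[≠] (2 * z)) := by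
    refine tendsto_nhdsWithin_iff.mpr ⟨?_, ?_⟩
    · exact (Continuous.tendsto' (by fun_prop) _ _ rfl).mono_left nhdsWithin_le_nhds
    · filter_upwards [self_mem_nhdsWithin] with y hy h
      exact hy (by simpa using h)
  filter_upwards [eventually_notMem_lattice L z, ht.eventually (eventually_notMem_lattice L _)]
    with y hy h2y
  exact gen y hy (wp'_ne_zero L h2y)

lemma hasDerivAt_wp' {z : ℂ} (hz : z ∉ L.lattice) :
    HasDerivAt L.derivWeierstrassP (6 * L.weierstrassP z ^ 2 - L.g₂ / 2) z := by
  have := (analyticAt_wp' L hz).differentiableAt.hasDerivAt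
  rwa [deriv_wp' L hz] at this

lemma hasDerivAt_zeta {z : ℂ} (hz : z ∉ L.lattice) : HasDerivAt (zeta L) (-L.weierstrassP z) z := by
  have := (analyticAt_zeta L hz).differentiableAt.hasDerivAt
  rwa [deriv_zeta L hz] at this

/-- Both sides are the logarithmic derivative in `x` of the `σ`-quotient for `℘(x) - ℘(y)`. One more
derivative gives the addition formula. -/
lemma wp'_div {x y : ℂ} (hx : x ∉ L.lattice) (hy : y ∉ L.lattice) (hp : x + y ∉ L.lattice)
    (hm : x - y ∉ L.lattice) : L.derivWeierstrassP x / (L.weierstrassP x - L.weierstrassP y) =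
      zeta L (x + y) + zeta L (x - y) - 2 * zeta L x := by
  have s1 := sigma_ne_zero L hx
  have s2 := sigma_ne_zero L hy
  have s3 := sigma_ne_zero L hp
  have s4 := sigma_ne_zero L hm
  have d1 : HasDerivAt (sigma L) (zeta L x * sigma L x) x := by
    rw [zeta, div_mul_cancel₀ _ s1]; exact (differentiable_sigma L x).hasDerivAt
  have d2 : HasDerivAt (fun x => sigma L (x + y)) (zeta L (x + y) * sigma L (x + y)) x := by
    rw [zeta, div_mul_cancel₀ _ s3]
    exact (differentiable_sigma L (x + y)).hasDerivAt.comp_add_const x y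
  have d3 : HasDerivAt (fun x => sigma L (x - y)) (zeta L (x - y) * sigma L (x - y)) x := by
    rw [zeta, div_mul_cancel₀ _ s4]
    exact (differentiable_sigma L (x - y)).hasDerivAt.comp_sub_const x y
  have d4 := (((d2.mul d3).neg).div ((d1.pow 2).mul_const (sigma L y ^ 2)) (by simp [s1, s2]))
  have h4 : (fun x => L.weierstrassP x - L.weierstrassP y) =ᶠ[𝓝 x]
      fun x => -(sigma L (x + y) * sigma L (x - y)) / (sigma L x ^ 2 * sigma L y ^ 2) := by
    filter_upwards [L.isClosed_lattice.isOpen_compl.mem_nhds hx] with x hx using wp_sub_wp L hy hx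
  have h1 : HasDerivAt (fun x => L.weierstrassP x - L.weierstrassP y) (L.derivWeierstrassP x) x :=
    (hasDerivAt_wp L hx).sub_const _
  rw [h1.unique (d4.congr_of_eventuallyEq h4), wp_sub_wp L hy hx]
  simp only [Pi.mul_apply, Pi.pow_apply, Pi.neg_apply]
  field_simp
  push_cast
  ring

/-- The addition formula for `℘` in symmetric form. -/
lemma wp_add_wp {x y : ℂ} (hx : x ∉ L.lattice) (hy : y ∉ L.lattice) (hp : x + y ∉ L.lattice)
    (hm : x - y ∉ L.lattice) : L.weierstrassP (x - y) + L.weierstrassP (x + y) =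
      2 * L.weierstrassP y + (6 * L.weierstrassP y ^ 2 - L.g₂ / 2) /
        (L.weierstrassP x - L.weierstrassP y) +
        cubic L (L.weierstrassP y) / (L.weierstrassP x - L.weierstrassP y) ^ 2 := by
  have hX : L.weierstrassP x - L.weierstrassP y ≠ 0 := fun h => by
    rcases (wp_eq_wp_iff L hy hx).mp (sub_eq_zero.mp h) with h | h
    exacts [hm h, hp h]
  have d1 := (hasDerivAt_wp' L hx).div ((hasDerivAt_wp L hx).sub_const (L.weierstrassP y)) hX
  have d2 := (((hasDerivAt_zeta L hp).comp_add_const x y).add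
    ((hasDerivAt_zeta L hm).comp_sub_const x y)).sub ((hasDerivAt_zeta L hx).const_mul 2)
  have hev : (fun x => L.derivWeierstrassP x / (L.weierstrassP x - L.weierstrassP y)) =ᶠ[𝓝 x]
      fun x => zeta L (x + y) + zeta L (x - y) - 2 * zeta L x := by
    have hO := L.isClosed_lattice.isOpen_compl
    filter_upwards [hO.mem_nhds hx,
      (continuous_id.add continuous_const).continuousAt.eventually_mem (hO.mem_nhds hp),
      (continuous_id.sub continuous_const).continuousAt.eventually_mem (hO.mem_nhds hm)]
      with z h1 h2 h3 using wp'_div L h1 hy h2 h3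
  have h := d1.unique (d2.congr_of_eventuallyEq hev)
  have hsq := wp'_sq L hx
  have h' : L.weierstrassP (x - y) + L.weierstrassP (x + y) = 2 * L.weierstrassP x -
    ((6 * L.weierstrassP x ^ 2 - L.g₂ / 2) * (L.weierstrassP x - L.weierstrassP y) -
      L.derivWeierstrassP x ^ 2) / (L.weierstrassP x - L.weierstrassP y) ^ 2 := by
    rw [sq (L.derivWeierstrassP x), h]; ring
  rw [h', hsq]
  unfold cubic
  field_simp
  ring

/-! ### Half periods -/

namespace HKData
variable (D : HKData)

lemma two_mul_ω_mem (i : Fin 4) : 2 * D.ω i ∈ D.L.lattice := by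
  have h1 := D.L.ω₁_mem_lattice
  have h2 := D.L.ω₂_mem_lattice
  fin_cases i
  · simp [ω]
  · simpa [ω, mul_div_cancel₀] using h1
  · have : 2 * (-(D.L.ω₁ / 2) - D.L.ω₂ / 2) = -D.L.ω₁ - D.L.ω₂ := by ring
    simpa [ω, this] using sub_mem (neg_mem h1) h2
  · simpa [ω, mul_div_cancel₀] using h2

lemma ω_sub_ω_notMem {i j : Fin 4} (h : i ≠ j) : D.ω i - D.ω j ∉ D.L.lattice := by
  have key : ∀ a b : ℚ, (a.den ≠ 1 ∨ b.den ≠ 1) →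
      (a : ℂ) * D.L.ω₁ + b * D.L.ω₂ ∉ D.L.lattice := by
    intro a b hab hm
    rw [PeriodPair.mul_ω₁_add_mul_ω₂_mem_lattice] at hm
    tauto
  -- Up to sign these six coordinate pairs are all the differences `ω i - ω j`; the integer entries
  -- in the fourth and fifth come from `ω 2 = -ω 1 - ω 3`.
  have k1 := key (1 / 2) 0 (by norm_num)
  have k2 := key 0 (1 / 2) (by norm_num)
  have k3 := key (1 / 2) (1 / 2) (by norm_num)
  have k4 := key 1 (1 / 2) (by norm_num)
  have k5 := key (1 / 2) 1 (by norm_num)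
  have k6 := key (1 / 2) (-1 / 2) (by norm_num)
  push_cast at k1 k2 k3 k4 k5 k6
  intro hm
  have hm' := neg_mem hm
  fin_cases i <;> fin_cases j <;> simp [ω] at h hm hm'
  all_goals first
    | (refine k1 ?_; convert hm using 1; ring1)
    | (refine k2 ?_; convert hm using 1; ring1)
    | (refine k3 ?_; convert hm using 1; ring1)
    | (refine k3 ?_; convert hm' using 1; ring1)
    | (refine k4 ?_; convert hm using 1; ring1)
    | (refine k4 ?_; convert hm' using 1; ring1)
    | (refine k5 ?_; convert hm using 1; ring1)
    | (refine k5 ?_; convert hm' using 1; ring1)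
    | (refine k6 ?_; convert hm using 1; ring1)
    | (refine k6 ?_; convert hm' using 1; ring1)

lemma ω_zero : D.ω 0 = 0 := rfl

lemma ω_notMem {i : Fin 4} (h : i ≠ 0) : D.ω i ∉ D.L.lattice := by
  simpa [ω_zero] using D.ω_sub_ω_notMem h

lemma ω_add_ω_notMem {i j : Fin 4} (h : i ≠ j) : D.ω i + D.ω j ∉ D.L.lattice := fun hm =>
  D.ω_sub_ω_notMem h (by
    have := sub_mem hm (D.two_mul_ω_mem j)
    rwa [show D.ω i + D.ω j - 2 * D.ω j = D.ω i - D.ω j by ring] at this)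

lemma mem_halfLattice {x : ℂ} : x ∈ D.halfLattice ↔ 2 * x ∈ D.L.lattice := Iff.rfl

lemma lattice_subset_halfLattice {x : ℂ} (hx : x ∈ D.L.lattice) : x ∈ D.halfLattice := by
  rw [mem_halfLattice, two_mul]; exact add_mem hx hx

lemma add_ω_mem_halfLattice {x : ℂ} {i : Fin 4} (hx : x + D.ω i ∈ D.L.lattice) :
    x ∈ D.halfLattice := by
  rw [mem_halfLattice]
  have := sub_mem (D.lattice_subset_halfLattice hx) (D.two_mul_ω_mem i)
  rwa [show 2 * (x + D.ω i) - 2 * D.ω i = 2 * x by ring] at this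

lemma exists_sub_ω_mem {x : ℂ} (hx : x ∈ D.halfLattice) : ∃ i, x - D.ω i ∈ D.L.lattice := by
  obtain ⟨m, n, h⟩ := PeriodPair.mem_lattice.mp hx
  have hx' : x = m * (D.L.ω₁ / 2) + n * (D.L.ω₂ / 2) := by linear_combination (-1 / 2 : ℂ) * h
  have hmem : ∀ a b : ℤ, (a : ℂ) * D.L.ω₁ + b * D.L.ω₂ ∈ D.L.lattice := fun a b =>
    PeriodPair.mem_lattice.mpr ⟨a, b, rfl⟩
  obtain ⟨a, ha⟩ := Int.even_or_odd' m
  obtain ⟨b, hb⟩ := Int.even_or_odd' n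
  rcases ha with ha | ha <;> rcases hb with hb | hb <;> rw [ha, hb] at hx' <;> push_cast at hx'
  · exact ⟨0, by convert hmem a b using 1; rw [hx']; simp [ω]; ring⟩
  · exact ⟨3, by convert hmem a b using 1; rw [hx']; simp [ω]; ring⟩
  · exact ⟨1, by convert hmem a b using 1; rw [hx']; simp [ω]; ring⟩
  -- Both coordinates of `ω 2` are `-1 / 2`, hence the shift by one.
  · exact ⟨2, by convert hmem (a + 1) (b + 1) using 1; rw [hx']; simp [ω]; ring⟩

lemma cubic_e {i : Fin 4} (hi : i ≠ 0) : cubic D.L (D.e i) = 0 := by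
  rw [e, ← wp'_sq D.L (D.ω_notMem hi), wp'_eq_zero D.L (D.two_mul_ω_mem i)]; simp

lemma e_ne_e {i j : Fin 4} (hi : i ≠ 0) (hj : j ≠ 0) (h : i ≠ j) : D.e i ≠ D.e j := by
  intro he
  rcases (wp_eq_wp_iff D.L (D.ω_notMem hj) (D.ω_notMem hi)).mp he with h' | h'
  exacts [D.ω_sub_ω_notMem h h', D.ω_add_ω_notMem h h']

/-- The `e i` are three distinct roots of the cubic; dividing differences of the root equations by
`e i - e j` gives Vieta's formulas. -/
lemma e_sum : D.e 1 + D.e 2 + D.e 3 = 0 ∧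
    D.L.g₂ = -4 * (D.e 1 * D.e 2 + D.e 2 * D.e 3 + D.e 3 * D.e 1) ∧
    D.L.g₃ = 4 * D.e 1 * D.e 2 * D.e 3 := by
  have h1 := D.cubic_e (i := 1) (by decide)
  have h2 := D.cubic_e (i := 2) (by decide)
  have h3 := D.cubic_e (i := 3) (by decide)
  have n12 := sub_ne_zero.mpr (D.e_ne_e (i := 1) (j := 2) (by decide) (by decide) (by decide))
  have n13 := sub_ne_zero.mpr (D.e_ne_e (i := 1) (j := 3) (by decide) (by decide) (by decide))
  have n23 := sub_ne_zero.mpr (D.e_ne_e (i := 2) (j := 3) (by decide) (by decide) (by decide))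
  unfold cubic at h1 h2 h3
  have a1 : 4 * (D.e 1 ^ 2 + D.e 1 * D.e 2 + D.e 2 ^ 2) - D.L.g₂ = 0 := by
    apply mul_left_cancel₀ n12; linear_combination h1 - h2
  have a2 : 4 * (D.e 1 ^ 2 + D.e 1 * D.e 3 + D.e 3 ^ 2) - D.L.g₂ = 0 := by
    apply mul_left_cancel₀ n13; linear_combination h1 - h3
  have a3 : D.e 1 + D.e 2 + D.e 3 = 0 := by
    apply mul_left_cancel₀ n23; linear_combination (1 / 4 : ℂ) * (a1 - a2)
  have e3 : D.e 3 = -D.e 1 - D.e 2 := by linear_combination a3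
  have a4 : D.L.g₂ = 4 * (D.e 1 ^ 2 + D.e 1 * D.e 2 + D.e 2 ^ 2) := by linear_combination -a1
  refine ⟨a3, ?_, ?_⟩
  · rw [e3]; linear_combination a4
  · rw [a4] at h1; rw [e3]; linear_combination -h1

lemma cubic_eq (z : ℂ) : cubic D.L z = 4 * (z - D.e 1) * (z - D.e 2) * (z - D.e 3) := by
  obtain ⟨h1, h2, h3⟩ := D.e_sum
  rw [cubic, h2, h3]
  linear_combination (4 * z ^ 2) * h1

lemma wp_sub_e_ne_zero {x : ℂ} (hx : x ∉ D.halfLattice) {i : Fin 4} (hi : i ≠ 0) :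
    D.L.weierstrassP x - D.e i ≠ 0 := by
  intro h
  have hxl : x ∉ D.L.lattice := fun h => hx (D.lattice_subset_halfLattice h)
  rcases (wp_eq_wp_iff D.L (D.ω_notMem hi) hxl).mp (sub_eq_zero.mp h) with h' | h'
  · refine hx (D.add_ω_mem_halfLattice (i := i) ?_)
    have := add_mem h' (D.two_mul_ω_mem i)
    rwa [show x - D.ω i + 2 * D.ω i = x + D.ω i by ring] at this
  · exact hx (D.add_ω_mem_halfLattice h')

/-- The translation of `℘` by a half period. -/
lemma wp_add_ω {x : ℂ} (hx : x ∉ D.halfLattice) {i : Fin 4} (hi : i ≠ 0) :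
    D.L.weierstrassP (x + D.ω i) =
      D.e i + (3 * D.e i ^ 2 - D.L.g₂ / 4) / (D.L.weierstrassP x - D.e i) := by
  have hp : x + D.ω i ∉ D.L.lattice := fun h => hx (D.add_ω_mem_halfLattice h)
  have hxl : x ∉ D.L.lattice := fun h => hx (D.lattice_subset_halfLattice h)
  have hm : x - D.ω i ∉ D.L.lattice := fun h => hp (by
    have := add_mem h (D.two_mul_ω_mem i)
    rwa [show x - D.ω i + 2 * D.ω i = x + D.ω i by ring] at this)
  have h := wp_add_wp D.L hxl (D.ω_notMem hi) hp hm
  have h1 : D.L.weierstrassP (x - D.ω i) = D.L.weierstrassP (x + D.ω i) := by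
    have := D.L.weierstrassP_add_coe (x - D.ω i) ⟨_, D.two_mul_ω_mem i⟩
    simp only at this
    rw [← this]; congr 1; ring
  have h2 : D.L.weierstrassP (D.ω i) = D.e i := rfl
  rw [h1, h2, D.cubic_e hi, zero_div, add_zero] at h
  linear_combination (1 / 2 : ℂ) * h

end HKData
end HermiteKrichever

end

noncomputable section
namespace HermiteKrichever

/-! ### Meromorphic solutions of linear equations of second order -/

/-- `f` is meromorphic on `U` and, outside `S`, an analytic solution of `f'' = A f' + B f`. -/
structure IsSol (A B : ℂ → ℂ) (S U : Set ℂ) (f : ℂ → ℂ) : Prop where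
  mero : ∀ x ∈ U, MeromorphicAt f x
  an : ∀ x ∈ U, x ∉ S → AnalyticAt ℂ f x
  eq : ∀ x ∈ U, x ∉ S → deriv (deriv f) x = A x * deriv f x + B x * f x

/-- All initial value problems with data outside `S` are solvable on `U`. -/
def FullOn (A B : ℂ → ℂ) (S U : Set ℂ) : Prop :=
  ∀ x₀ ∈ U, x₀ ∉ S → ∀ c₀ c₁ : ℂ, ∃ f, IsSol A B S U f ∧ f x₀ = c₀ ∧ deriv f x₀ = c₁

variable {A B : ℂ → ℂ} {S : Set ℂ}

lemma IsSol.mono {U V : Set ℂ} {f : ℂ → ℂ} (h : IsSol A B S U f) (hV : V ⊆ U) : IsSol A B S V f :=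
  ⟨fun x hx => h.mero x (hV hx), fun x hx => h.an x (hV hx), fun x hx => h.eq x (hV hx)⟩

lemma FullOn.mono {U V : Set ℂ} (h : FullOn A B S U) (hV : V ⊆ U) : FullOn A B S V :=
  fun x hx hxS c₀ c₁ => by
    obtain ⟨f, hf, h0, h1⟩ := h x (hV hx) hxS c₀ c₁
    exact ⟨f, hf.mono hV, h0, h1⟩

lemma IsSol.sub {U : Set ℂ} {f g : ℂ → ℂ} (hf : IsSol A B S U f) (hg : IsSol A B S U g)
    (hU : IsOpen U) (hSc : ∀ x ∉ S, ∀ᶠ y in 𝓝 x, y ∉ S) : IsSol A B S U (f - g) where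
  mero x hx := (hf.mero x hx).sub (hg.mero x hx)
  an x hx hxS := (hf.an x hx hxS).sub (hg.an x hx hxS)
  eq x hx hxS := by
    have h1 : deriv (f - g) =ᶠ[𝓝 x] deriv f - deriv g := by
      filter_upwards [hU.mem_nhds hx, hSc x hxS] with y hy hyS
      exact deriv_sub (hf.an y hy hyS).differentiableAt (hg.an y hy hyS).differentiableAt
    rw [h1.deriv_eq, h1.eq_of_nhds, deriv_sub (hf.an x hx hxS).deriv.differentiableAt
      (hg.an x hx hxS).deriv.differentiableAt, hf.eq x hx hxS, hg.eq x hx hxS]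
    simp only [Pi.sub_apply]; ring

lemma IsSol.congr {U : Set ℂ} {f g : ℂ → ℂ} (hf : IsSol A B S U f)
    (h1 : ∀ x ∈ U, f =ᶠ[𝓝[≠] x] g) (h2 : ∀ x ∈ U, x ∉ S → f =ᶠ[𝓝 x] g) : IsSol A B S U g where
  mero x hx := (hf.mero x hx).congr (h1 x hx)
  an x hx hxS := (hf.an x hx hxS).congr (h2 x hx hxS)
  eq x hx hxS := by
    rw [← (h2 x hx hxS).deriv.deriv_eq, ← (h2 x hx hxS).deriv_eq, ← (h2 x hx hxS).eq_of_nhds]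
    exact hf.eq x hx hxS

/-- The indicial equation. -/
lemma indicial {f : ℂ → ℂ} {x a b : ℂ} {n : ℤ} (hf : MeromorphicAt f x)
    (hn : meromorphicOrderAt f x = n)
    (hode : ∀ᶠ z in 𝓝[≠] x, deriv (deriv f) z = A z * deriv f z + B z * f z)
    (ha : Tendsto (fun z => (z - x) * A z) (𝓝[≠] x) (𝓝 a))
    (hb : Tendsto (fun z => (z - x) ^ 2 * B z) (𝓝[≠] x) (𝓝 b)) :
    (n : ℂ) * (n - 1) = a * n + b := by
  obtain ⟨g, hg, hg0, hfg⟩ := (meromorphicOrderAt_eq_int_iff hf).mp hn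
  have hz1 : ∀ (m : ℤ) (z : ℂ), z - x ≠ 0 → HasDerivAt (fun z => (z - x) ^ m)
      (m * (z - x) ^ (m - 1)) z := fun m z h0 => by
    have := HasDerivAt.comp (h₂ := fun y : ℂ => y ^ m) z (hasDerivAt_zpow m (z - x) (Or.inl h0))
      ((hasDerivAt_id z).sub_const x)
    rwa [mul_one] at this
  have hzp : ∀ (m : ℤ) (z : ℂ), z - x ≠ 0 → (z - x) ^ m = (z - x) ^ (m - 1) * (z - x) :=
    fun m z h0 => by rw [← zpow_add_one₀ h0]; simp
  have hgn : ∀ᶠ z in 𝓝[≠] x, AnalyticAt ℂ g z :=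
    hg.eventually_analyticAt.filter_mono nhdsWithin_le_nhds
  have e1 : deriv f =ᶠ[𝓝[≠] x] fun z => (z - x) ^ (n - 1) * (n * g z + (z - x) * deriv g z) := by
    filter_upwards [EventuallyEq.nhdsNE_deriv hfg, self_mem_nhdsWithin, hgn] with z hz hzx hgz
    have h0 : z - x ≠ 0 := sub_ne_zero.mpr hzx
    simp only [smul_eq_mul] at hz
    rw [hz, ((hz1 n z h0).fun_mul hgz.differentiableAt.hasDerivAt).deriv, hzp n z h0]
    ring
  have e2 : deriv (deriv f) =ᶠ[𝓝[≠] x] fun z => (z - x) ^ (n - 2) *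
      (n * (n - 1) * g z + 2 * n * (z - x) * deriv g z + (z - x) ^ 2 * deriv (deriv g) z) := by
    filter_upwards [EventuallyEq.nhdsNE_deriv e1, self_mem_nhdsWithin, hgn] with z hz hzx hgz
    have h0 : z - x ≠ 0 := sub_ne_zero.mpr hzx
    have d := (hz1 (n - 1) z h0).fun_mul ((hgz.differentiableAt.hasDerivAt.const_mul (n : ℂ)).fun_add
      (((hasDerivAt_id z).sub_const x).fun_mul hgz.deriv.differentiableAt.hasDerivAt))
    simp only [id] at d
    rw [hz, d.deriv, hzp (n - 1) z h0, show n - 1 - 1 = n - 2 by ring]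
    push_cast
    ring
  -- With `f = (z - x) ^ n g` and `g x ≠ 0`, the factor `(z - x) ^ (n - 2)` cancels from the
  -- equation, and the limit at `x` is the indicial equation times `g x`.
  have e3 : ∀ᶠ z in 𝓝[≠] x, n * (n - 1) * g z + 2 * n * (z - x) * deriv g z +
      (z - x) ^ 2 * deriv (deriv g) z = ((z - x) * A z) * (n * g z + (z - x) * deriv g z) +
        ((z - x) ^ 2 * B z) * g z := by
    filter_upwards [hode, e1, e2, hfg, self_mem_nhdsWithin] with z h h1 h2 h3 hzx
    have h0 : z - x ≠ 0 := sub_ne_zero.mpr hzx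
    rw [h1, h2, h3, smul_eq_mul, hzp n z h0, hzp (n - 1) z h0, show n - 1 - 1 = n - 2 by ring] at h
    apply mul_left_cancel₀ (zpow_ne_zero (n - 2) h0)
    rw [h]; ring
  have c0 := hg.continuousAt
  have c1 := hg.deriv.continuousAt
  have c2 := hg.deriv.deriv.continuousAt
  have l1 : Tendsto (fun z => n * (n - 1) * g z + 2 * n * (z - x) * deriv g z +
      (z - x) ^ 2 * deriv (deriv g) z) (𝓝[≠] x) (𝓝 (n * (n - 1) * g x)) := by
    have : ContinuousAt (fun z => n * (n - 1) * g z + 2 * n * (z - x) * deriv g z +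
      (z - x) ^ 2 * deriv (deriv g) z) x := by fun_prop
    refine (this.tendsto.mono_left nhdsWithin_le_nhds).trans (le_of_eq ?_)
    simp
  have l2 : Tendsto (fun z => (n : ℂ) * g z + (z - x) * deriv g z) (𝓝[≠] x) (𝓝 (n * g x)) := by
    have : ContinuousAt (fun z => (n : ℂ) * g z + (z - x) * deriv g z) x := by fun_prop
    refine (this.tendsto.mono_left nhdsWithin_le_nhds).trans (le_of_eq ?_)
    simp
  have l3 := (ha.mul l2).add (hb.mul (c0.tendsto.mono_left nhdsWithin_le_nhds))
  have := tendsto_nhds_unique (l1.congr' e3) l3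
  apply mul_right_cancel₀ hg0
  rw [this]; ring

/-- At an ordinary point the indicial roots are `0` and `1`, and vanishing Cauchy data exclude both;
so the order at `x₀` is infinite, and infinite order propagates over a connected set. Values on `S`
are arbitrary, hence the punctured conclusion at general points and the full one off `S`. -/
lemma IsSol.eq_zero {U : Set ℂ} (hU : IsOpen U) (hUc : IsPreconnected U)
    (hSc : ∀ x ∉ S, ∀ᶠ y in 𝓝 x, y ∉ S)
    (hA : ∀ x ∉ S, AnalyticAt ℂ A x) (hB : ∀ x ∉ S, AnalyticAt ℂ B x) {f : ℂ → ℂ}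
    (hf : IsSol A B S U f) {x₀ : ℂ} (hx₀ : x₀ ∈ U) (hx₀S : x₀ ∉ S) (h0 : f x₀ = 0)
    (h1 : deriv f x₀ = 0) :
    (∀ x ∈ U, f =ᶠ[𝓝[≠] x] 0) ∧ ∀ x ∈ U, x ∉ S → f =ᶠ[𝓝 x] 0 := by
  have hm : MeromorphicOn f U := fun x hx => hf.mero x hx
  have htop : meromorphicOrderAt f x₀ = ⊤ := by
    by_contra hne
    obtain ⟨n, hn⟩ := WithTop.ne_top_iff_exists.mp hne
    have hz : Tendsto (fun z => z - x₀) (𝓝[≠] x₀) (𝓝 0) :=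
      (Continuous.tendsto' (by fun_prop) _ _ (by simp)).mono_left nhdsWithin_le_nhds
    have ha := hz.mul ((hA x₀ hx₀S).continuousAt.tendsto.mono_left nhdsWithin_le_nhds)
    have hb := (hz.pow 2).mul ((hB x₀ hx₀S).continuousAt.tendsto.mono_left nhdsWithin_le_nhds)
    have hode : ∀ᶠ z in 𝓝[≠] x₀, deriv (deriv f) z = A z * deriv f z + B z * f z := by
      refine Filter.Eventually.filter_mono nhdsWithin_le_nhds ?_
      filter_upwards [hU.mem_nhds hx₀, hSc x₀ hx₀S] with y hy hyS using hf.eq y hy hyS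
    have hind := indicial (hf.mero x₀ hx₀) hn.symm hode ha hb
    simp only [zero_mul, ne_eq, OfNat.ofNat_ne_zero, not_false_eq_true, zero_pow, add_zero] at hind
    obtain ⟨g, hg, hg0, hfg⟩ := (meromorphicOrderAt_eq_int_iff (hf.mero x₀ hx₀)).mp hn.symm
    have hfan := hf.an x₀ hx₀ hx₀S
    rcases mul_eq_zero.mp hind with h | h
    · have : n = 0 := by exact_mod_cast h
      subst this
      refine hg0 ?_
      rw [← h0]
      refine (eq_of_eventuallyEq_nhdsNE hfan.continuousAt hg.continuousAt ?_).symm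
      filter_upwards [hfg] with z hz using by simpa using hz
    · have : n = 1 := by
        have : (n : ℂ) = 1 := sub_eq_zero.mp h
        exact_mod_cast this
      subst this
      have he : f =ᶠ[𝓝 x₀] fun z => (z - x₀) * g z := by
        rw [← hfan.continuousAt.eventuallyEq_nhds_iff_eventuallyEq_nhdsNE]
        · filter_upwards [hfg] with z hz using by simpa using hz
        · have := hg.continuousAt; fun_prop
      have hd := ((hasDerivAt_id x₀).sub_const x₀).fun_mul hg.differentiableAt.hasDerivAt
      refine hg0 ?_
      rw [he.deriv_eq] at h1
      simp only [id] at hd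
      rw [hd.deriv] at h1
      simpa using h1
  have hall : ∀ x ∈ U, f =ᶠ[𝓝[≠] x] 0 := by
    intro x hx
    by_contra hne
    refine MeromorphicOn.meromorphicOrderAt_ne_top_of_isPreconnected hm hUc hx hx₀ ?_ htop
    intro h
    exact hne (meromorphicOrderAt_eq_top_iff.mp h)
  refine ⟨hall, fun x hx hxS => ?_⟩
  exact ((hf.an x hx hxS).continuousAt.eventuallyEq_nhds_iff_eventuallyEq_nhdsNE
    continuousAt_const).mp (hall x hx)

/-- Solvability is preserved under gluing along a nonempty convex overlap. -/
lemma FullOn.union (hS : ∀ x, ∀ᶠ y in 𝓝[≠] x, y ∉ S)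
    (hSc : ∀ x ∉ S, ∀ᶠ y in 𝓝 x, y ∉ S)
    (hA : ∀ x ∉ S, AnalyticAt ℂ A x) (hB : ∀ x ∉ S, AnalyticAt ℂ B x) {U V : Set ℂ}
    (hU : IsOpen U) (hV : IsOpen V) (hUV : IsPreconnected (U ∩ V)) (hne : (U ∩ V).Nonempty)
    (hfU : FullOn A B S U) (hfV : FullOn A B S V) : FullOn A B S (U ∪ V) := by
  classical
  obtain ⟨y, hy⟩ := hne
  obtain ⟨x₁, hx₁S, hx₁⟩ : ∃ x₁, x₁ ∉ S ∧ x₁ ∈ U ∩ V :=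
    ((hS y).and (nhdsWithin_le_nhds ((hU.inter hV).mem_nhds hy))).exists
  have key : ∀ U V : Set ℂ, IsOpen U → IsOpen V → IsPreconnected (U ∩ V) → x₁ ∈ U ∩ V →
      FullOn A B S V → ∀ f, IsSol A B S U f → ∃ g, IsSol A B S (U ∪ V) g ∧ Set.EqOn g f U := by
    intro U V hU hV hUV hx₁ hfV f hf
    -- The solution on `V` with the Cauchy data of `f` at a common point agrees with `f` on the
    -- connected overlap, off `S`.
    obtain ⟨f', hf', h0, h1⟩ := hfV x₁ hx₁.2 hx₁S (f x₁) (deriv f x₁)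
    have hd := (hf.mono (Set.inter_subset_left (t := V))).sub
      (hf'.mono (Set.inter_subset_right (s := U))) (hU.inter hV) hSc
    obtain ⟨z1, z2⟩ := hd.eq_zero (hU.inter hV) hUV hSc hA hB hx₁ hx₁S (by simp [h0]) (by
      rw [deriv_sub (hf.an _ hx₁.1 hx₁S).differentiableAt (hf'.an _ hx₁.2 hx₁S).differentiableAt,
        h1, sub_self])
    set g : ℂ → ℂ := fun x => if x ∈ U then f x else f' x with hg
    have gU : ∀ x ∈ U, f =ᶠ[𝓝 x] g := fun x hx => by
      filter_upwards [hU.mem_nhds hx] with z hz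
      simp [hg, hz]
    refine ⟨g, ?_, fun x hx => by simp [hg, hx]⟩
    have sU : IsSol A B S U g := hf.congr (fun x hx => (gU x hx).filter_mono nhdsWithin_le_nhds)
      (fun x hx _ => gU x hx)
    have hw : ∀ x ∈ V, ∀ F : Filter ℂ, F ≤ 𝓝 x → (x ∈ U → (f - f' =ᶠ[F] 0)) →
        (x ∈ U ∨ (∀ᶠ y in F, y ∈ U → y ∉ S)) → f' =ᶠ[F] g := by
      intro x hx F hF h1 h2
      rcases h2 with h2 | h2
      · filter_upwards [hF (gU x h2), h1 h2] with z hz hz'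
        rw [← hz]
        simpa [sub_eq_zero, eq_comm] using hz'
      · filter_upwards [h2, hF (hV.mem_nhds hx)] with z hz hzV
        by_cases hzU : z ∈ U
        · have := (z2 z ⟨hzU, hzV⟩ (hz hzU)).eq_of_nhds
          simp only [hg, hzU, if_true]
          simpa [sub_eq_zero, eq_comm] using this
        · simp [hg, hzU]
    have sV : IsSol A B S V g := by
      refine hf'.congr (fun x hx => ?_) (fun x hx hxS => ?_)
      · exact hw x hx _ nhdsWithin_le_nhds (fun h => z1 x ⟨h, hx⟩)
          (Or.inr ((hS x).mono fun y hy _ => hy))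
      · exact hw x hx _ le_rfl (fun h => z2 x ⟨h, hx⟩ hxS)
          (Or.inr ((hSc x hxS).mono fun y hy _ => hy))
    exact ⟨fun x hx => hx.elim (sU.mero x) (sV.mero x), fun x hx => hx.elim (sU.an x) (sV.an x),
      fun x hx => hx.elim (sU.eq x) (sV.eq x)⟩
  intro x₀ hx₀ hx₀S c₀ c₁
  have fin : ∀ U V : Set ℂ, IsOpen U → IsOpen V → IsPreconnected (U ∩ V) → x₁ ∈ U ∩ V →
      FullOn A B S U → FullOn A B S V → x₀ ∈ U →
      ∃ f, IsSol A B S (U ∪ V) f ∧ f x₀ = c₀ ∧ deriv f x₀ = c₁ := by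
    intro U V hU hV hUV hx₁ hfU hfV hx₀
    obtain ⟨f, hf, h0, h1⟩ := hfU x₀ hx₀ hx₀S c₀ c₁
    obtain ⟨g, hg, hgf⟩ := key U V hU hV hUV hx₁ hfV f hf
    exact ⟨g, hg, (hgf hx₀).trans h0, ((hgf.eventuallyEq_of_mem (hU.mem_nhds hx₀)).deriv_eq).trans h1⟩
  rcases hx₀ with h | h
  · exact fin U V hU hV hUV hx₁ hfU hfV h
  · rw [Set.union_comm]
    exact fin V U hV hU (by rwa [Set.inter_comm]) ⟨hx₁.2, hx₁.1⟩ hfV hfU h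

/-- Compactness of intervals as a supremum argument: a local property that glues along overlaps
reaches beyond the supremum of the right endpoints attained from `a`. -/
lemma interval_induction {P : ℝ → ℝ → Prop}
    (mono : ∀ a b a' b', a ≤ a' → b' ≤ b → P a b → P a' b')
    (loc : ∀ x, ∃ ε > 0, P (x - ε) (x + ε))
    (glue : ∀ a b c d, a ≤ b → b < c → c ≤ d → P a c → P b d → P a d) (a b : ℝ) : P a b := by
  by_contra hab
  set T : Set ℝ := {x | a ≤ x ∧ ∃ ε > 0, P a (x + ε)} with hT
  have haT : a ∈ T := by
    obtain ⟨ε, hε, h⟩ := loc a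
    exact ⟨le_rfl, ε, hε, mono _ _ _ _ (by linarith) le_rfl h⟩
  have hbd : ∀ x ∈ T, x ≤ b := by
    rintro x ⟨hx, ε, hε, h⟩
    by_contra hlt
    exact hab (mono _ _ _ _ le_rfl (by linarith) h)
  have hT' : BddAbove T := ⟨b, hbd⟩
  obtain ⟨δ, hδ, hP⟩ := loc (sSup T)
  obtain ⟨x, ⟨hax, ε, hε, hx⟩, hxs⟩ := exists_lt_of_lt_csSup ⟨a, haT⟩
    (show sSup T - δ < sSup T by linarith)
  have has : a ≤ sSup T := le_csSup hT' haT
  have hP' : P a (sSup T + δ) := by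
    by_cases h1 : a ≤ sSup T - δ
    · by_cases h2 : x + ε ≤ sSup T + δ
      · exact glue _ _ _ _ h1 (by linarith) h2 hx hP
      · exact mono _ _ _ _ le_rfl (by linarith) hx
    · exact mono _ _ _ _ (by linarith) le_rfl hP
  have : sSup T + δ / 2 ∈ T := ⟨by linarith, δ / 2, by linarith, by
    rwa [add_assoc, add_halves]⟩
  linarith [le_csSup hT' this]

/-- An open rectangle. -/
def rect (a b c d : ℝ) : Set ℂ := Set.Ioo a b ×ℂ Set.Ioo c d

lemma mem_rect {a b c d : ℝ} {z : ℂ} :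
    z ∈ rect a b c d ↔ (a < z.re ∧ z.re < b) ∧ c < z.im ∧ z.im < d := Iff.rfl

lemma isOpen_rect (a b c d : ℝ) : IsOpen (rect a b c d) := isOpen_Ioo.reProdIm isOpen_Ioo

lemma convex_rect (a b c d : ℝ) : Convex ℝ (rect a b c d) :=
  ((convex_Ioo a b).is_linear_preimage Complex.reLm.isLinear).inter
    ((convex_Ioo c d).is_linear_preimage Complex.imLm.isLinear)

/-- Local solvability implies global solvability on the plane. -/
lemma fullOn_univ (hS : ∀ x, ∀ᶠ y in 𝓝[≠] x, y ∉ S)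
    (hSc : ∀ x ∉ S, ∀ᶠ y in 𝓝 x, y ∉ S)
    (hA : ∀ x ∉ S, AnalyticAt ℂ A x) (hB : ∀ x ∉ S, AnalyticAt ℂ B x)
    (hloc : ∀ x, ∃ ρ > 0, FullOn A B S (Metric.ball x ρ)) : FullOn A B S Set.univ := by
  have hglue : ∀ a b c d a' b' c' d', (rect a b c d ∩ rect a' b' c' d').Nonempty →
      FullOn A B S (rect a b c d) → FullOn A B S (rect a' b' c' d') →
      FullOn A B S (rect a b c d ∪ rect a' b' c' d') := fun a b c d a' b' c' d' hne h h' =>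
    h.union hS hSc hA hB (isOpen_rect _ _ _ _) (isOpen_rect _ _ _ _)
      ((convex_rect _ _ _ _).inter (convex_rect _ _ _ _)).isPreconnected hne h'
  have empty : ∀ a b c d, ¬(rect a b c d).Nonempty → FullOn A B S (rect a b c d) :=
    fun a b c d h x hx => (h ⟨x, hx⟩).elim
  -- Rectangles are convex, so overlaps are connected and no monodromy can arise. Interval induction
  -- is applied horizontally to get thin strips, then vertically to get all rectangles.
  have strips : ∀ (y a b : ℝ), ∃ ε > 0, FullOn A B S (rect a b (y - ε) (y + ε)) := by
    intro y
    refine interval_induction ?_ ?_ ?_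
    · rintro a b a' b' h1 h2 ⟨ε, hε, h⟩
      exact ⟨ε, hε, h.mono fun z hz => ⟨⟨h1.trans_lt hz.1.1, hz.1.2.trans_le h2⟩, hz.2⟩⟩
    · intro x
      obtain ⟨ρ, hρ, h⟩ := hloc ⟨x, y⟩
      refine ⟨ρ / 2, by linarith, ρ / 2, by linarith, h.mono fun z hz => ?_⟩
      obtain ⟨⟨h1, h2⟩, h3, h4⟩ := mem_rect.mp hz
      rw [Metric.mem_ball, dist_eq_norm]
      refine (Complex.norm_le_abs_re_add_abs_im _).trans_lt ?_
      have a1 : |(z - ⟨x, y⟩ : ℂ).re| < ρ / 2 := by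
        rw [abs_lt]; simp only [Complex.sub_re]; constructor <;> linarith
      have a2 : |(z - ⟨x, y⟩ : ℂ).im| < ρ / 2 := by
        rw [abs_lt]; simp only [Complex.sub_im]; constructor <;> linarith
      linarith
    · rintro a b c d hab hbc hcd ⟨ε, hε, h⟩ ⟨ε', hε', h'⟩
      refine ⟨min ε ε', lt_min hε hε', ?_⟩
      have m1 := min_le_left ε ε'
      have m2 := min_le_right ε ε'
      have m3 := lt_min hε hε'
      have k1 : FullOn A B S (rect a c (y - min ε ε') (y + min ε ε')) := h.mono fun z hz =>
        ⟨hz.1, by have := hz.2.1; linarith, by have := hz.2.2; linarith⟩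
      have k2 : FullOn A B S (rect b d (y - min ε ε') (y + min ε ε')) := h'.mono fun z hz =>
        ⟨hz.1, by have := hz.2.1; linarith, by have := hz.2.2; linarith⟩
      refine (hglue _ _ _ _ _ _ _ _ ⟨⟨(b + c) / 2, y⟩, ?_, ?_⟩ k1 k2).mono ?_
      · refine mem_rect.mpr ⟨⟨?_, ?_⟩, ?_, ?_⟩ <;> dsimp only <;> linarith
      · refine mem_rect.mpr ⟨⟨?_, ?_⟩, ?_, ?_⟩ <;> dsimp only <;> linarith
      · intro z hz
        by_cases hzc : z.re < c
        · exact Or.inl ⟨⟨hz.1.1, hzc⟩, hz.2⟩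
        · exact Or.inr ⟨⟨by linarith, hz.1.2⟩, hz.2⟩
  have rects : ∀ a b c d : ℝ, FullOn A B S (rect a b c d) := by
    intro a b
    refine interval_induction ?_ ?_ ?_
    · intro c d c' d' h1 h2 h
      exact h.mono fun z hz => ⟨hz.1, h1.trans_lt hz.2.1, hz.2.2.trans_le h2⟩
    · intro y
      exact strips y a b
    · intro c d c' d' h1 h2 h3 h h'
      by_cases hab : a < b
      · refine (hglue _ _ _ _ _ _ _ _ ⟨⟨(a + b) / 2, (d + c') / 2⟩, ?_, ?_⟩ h h').mono ?_
        · refine mem_rect.mpr ⟨⟨?_, ?_⟩, ?_, ?_⟩ <;> dsimp only <;> linarith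
        · refine mem_rect.mpr ⟨⟨?_, ?_⟩, ?_, ?_⟩ <;> dsimp only <;> linarith
        · intro z hz
          by_cases hzc : z.im < c'
          · exact Or.inl ⟨hz.1, hz.2.1, hzc⟩
          · exact Or.inr ⟨hz.1, by linarith, hz.2.2⟩
      · refine empty _ _ _ _ fun ⟨z, hz⟩ => ?_
        have := hz.1.1.trans hz.1.2
        exact hab this
  intro x₀ _ hx₀S c₀ c₁
  set Q : ℕ → Set ℂ := fun n => rect (-(n + ‖x₀‖ + 1)) (n + ‖x₀‖ + 1) (-(n + ‖x₀‖ + 1))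
    (n + ‖x₀‖ + 1) with hQ
  have hQm : ∀ (n : ℕ) z, ‖z‖ < n + ‖x₀‖ + 1 → z ∈ Q n := fun n z hz => by
    have h1 := abs_le.mp (Complex.abs_re_le_norm z)
    have h2 := abs_le.mp (Complex.abs_im_le_norm z)
    exact ⟨⟨by linarith, by linarith⟩, by linarith, by linarith⟩
  have hQmono : ∀ m n, m ≤ n → Q m ⊆ Q n := fun m n hmn z hz => by
    have : (m : ℝ) ≤ n := by exact_mod_cast hmn
    obtain ⟨⟨h1, h2⟩, h3, h4⟩ := mem_rect.mp hz
    exact ⟨⟨by linarith, by linarith⟩, by linarith, by linarith⟩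
  have hx₀Q : ∀ n, x₀ ∈ Q n := fun n => hQm n x₀ (by linarith [Nat.cast_nonneg (α := ℝ) n])
  choose F hF hF0 hF1 using fun n : ℕ => rects (-(n + ‖x₀‖ + 1)) (n + ‖x₀‖ + 1) (-(n + ‖x₀‖ + 1))
    (n + ‖x₀‖ + 1) x₀ (hx₀Q n) hx₀S c₀ c₁
  have hagree : ∀ m n, m ≤ n → (∀ x ∈ Q m, F n - F m =ᶠ[𝓝[≠] x] 0) ∧
      ∀ x ∈ Q m, x ∉ S → F n - F m =ᶠ[𝓝 x] 0 := by
    intro m n hmn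
    refine (((hF n).mono (hQmono m n hmn)).sub (hF m) (isOpen_rect _ _ _ _) hSc).eq_zero
      (isOpen_rect _ _ _ _) (convex_rect _ _ _ _).isPreconnected hSc hA hB (hx₀Q m) hx₀S
      (by simp [hF0]) ?_
    rw [deriv_sub ((hF n).an _ (hx₀Q n) hx₀S).differentiableAt
      ((hF m).an _ (hx₀Q m) hx₀S).differentiableAt, hF1, hF1, sub_self]
  -- The squares `Q n` exhaust the plane and `z` lies in `Q ⌈‖z‖⌉₊`. Solutions on two squares with
  -- the same Cauchy data at `x₀` agree off `S` on the smaller one, so `g` coincides there with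
  -- every `F n`.
  set g : ℂ → ℂ := fun z => F ⌈‖z‖⌉₊ z with hg
  have hmem : ∀ z, z ∈ Q ⌈‖z‖⌉₊ := fun z => hQm _ z (by
    have := Nat.le_ceil ‖z‖
    linarith [norm_nonneg x₀])
  have gval : ∀ n z, z ∈ Q n → z ∉ S → g z = F n z := by
    intro n z hz hzS
    rcases le_total n ⌈‖z‖⌉₊ with h | h
    · have := ((hagree _ _ h).2 z hz hzS).eq_of_nhds
      simpa [sub_eq_zero, hg] using this
    · have := ((hagree _ _ h).2 z (hmem z) hzS).eq_of_nhds
      simp only [Pi.sub_apply, Pi.zero_apply, sub_eq_zero] at this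
      exact this.symm
  have gn1 : ∀ n x, x ∈ Q n → F n =ᶠ[𝓝[≠] x] g := fun n x hx => by
    filter_upwards [hS x, nhdsWithin_le_nhds ((isOpen_rect _ _ _ _).mem_nhds hx)] with z hz hzQ
    exact (gval n z hzQ hz).symm
  have gn2 : ∀ n x, x ∈ Q n → x ∉ S → F n =ᶠ[𝓝 x] g := fun n x hx hxS => by
    filter_upwards [hSc x hxS, (isOpen_rect _ _ _ _).mem_nhds hx] with z hz hzQ
    exact (gval n z hzQ hz).symm
  have sol : ∀ n, IsSol A B S (Q n) g := fun n => (hF n).congr (gn1 n) (gn2 n)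
  refine ⟨g, ⟨fun x _ => (sol _).mero x (hmem x), fun x _ => (sol _).an x (hmem x),
    fun x _ => (sol _).eq x (hmem x)⟩, ?_, ?_⟩
  · rw [gval 0 x₀ (hx₀Q 0) hx₀S, hF0]
  · rw [← (gn2 0 x₀ (hx₀Q 0) hx₀S).deriv_eq, hF1]

end HermiteKrichever

end

noncomputable section
namespace HermiteKrichever

/-! ### The method of Frobenius -/

/-- The sum of the power series with coefficients `a`. -/
def powSum (a : ℕ → ℂ) (t : ℂ) : ℂ := ∑' n, a n * t ^ n

lemma summable_powSum {a : ℕ → ℂ} {M K : ℝ} (hK : 0 < K) (ha : ∀ n, ‖a n‖ ≤ M * K ^ n) {t : ℂ}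
    (ht : ‖t‖ < 1 / K) : Summable fun n => ‖a n * t ^ n‖ := by
  have hq : K * ‖t‖ < 1 := by rwa [lt_div_iff₀ hK, mul_comm] at ht
  refine Summable.of_nonneg_of_le (fun n => norm_nonneg _) (fun n => ?_)
    ((summable_geometric_of_lt_one (by positivity) hq).mul_left M)
  rw [norm_mul, norm_pow, mul_pow, ← mul_assoc]
  exact mul_le_mul_of_nonneg_right (ha n) (by positivity)

lemma hasSum_powSum {a : ℕ → ℂ} {M K : ℝ} (hK : 0 < K) (ha : ∀ n, ‖a n‖ ≤ M * K ^ n) {t : ℂ}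
    (ht : ‖t‖ < 1 / K) : HasSum (fun n => a n * t ^ n) (powSum a t) :=
  (summable_powSum hK ha ht).of_norm.hasSum

lemma powSum_zero (a : ℕ → ℂ) : powSum a 0 = a 0 := by
  rw [powSum, tsum_eq_single 0 (by intro n hn; simp [hn])]; simp

lemma norm_deriv_coeff_le {a : ℕ → ℂ} {M K : ℝ}
    (ha : ∀ n, ‖a n‖ ≤ M * K ^ n) (n : ℕ) :
    ‖((n : ℂ) + 1) * a (n + 1)‖ ≤ (M * K) * (2 * K) ^ n := by
  have h1 : ((n : ℝ) + 1) ≤ 2 ^ n := by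
    exact_mod_cast Nat.lt_two_pow_self
  rw [norm_mul]
  have h2 : ‖(n : ℂ) + 1‖ = (n : ℝ) + 1 := by
    rw [show (n : ℂ) + 1 = ((n + 1 : ℕ) : ℂ) by push_cast; rfl, Complex.norm_natCast]; push_cast; rfl
  rw [h2]
  calc ((n : ℝ) + 1) * ‖a (n + 1)‖ ≤ 2 ^ n * (M * K ^ (n + 1)) := by gcongr; exact ha _
    _ = _ := by ring

lemma hasDerivAt_powSum {a : ℕ → ℂ} {M K : ℝ} (hK : 0 < K) (ha : ∀ n, ‖a n‖ ≤ M * K ^ n)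
    {t : ℂ} (ht : ‖t‖ < 1 / K) :
    HasDerivAt (powSum a) (powSum (fun n => ((n : ℂ) + 1) * a (n + 1)) t) t := by
  obtain ⟨r, hr1, hr2⟩ := exists_between ht
  have hr0 : 0 ≤ r := (norm_nonneg t).trans hr1.le
  have hu : Summable fun n => ‖a n * (r : ℂ) ^ n‖ := summable_powSum hK ha (by
    rwa [Complex.norm_real, Real.norm_of_nonneg hr0])
  have hd : ∀ n : ℕ, DifferentiableOn ℂ (fun t : ℂ => a n * t ^ n) (Metric.ball 0 r) :=
    fun n => by fun_prop
  have hle : ∀ (n : ℕ) (w : ℂ), w ∈ Metric.ball (0 : ℂ) r → ‖a n * w ^ n‖ ≤ ‖a n * (r : ℂ) ^ n‖ := by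
    intro n w hw
    rw [norm_mul, norm_mul, norm_pow, norm_pow, Complex.norm_real, Real.norm_of_nonneg hr0]
    gcongr
    exact (mem_ball_zero_iff.mp hw).le
  have htb : t ∈ Metric.ball (0 : ℂ) r := by simpa using hr1
  have h1 := Complex.hasSum_deriv_of_summable_norm hu hd Metric.isOpen_ball hle htb
  have h2 := Complex.differentiableOn_tsum_of_summable_norm hu hd Metric.isOpen_ball hle
  have h3 := (h2.differentiableAt (Metric.isOpen_ball.mem_nhds htb)).hasDerivAt
  refine h3.congr_deriv ?_
  have h4 := (hasSum_nat_add_iff' 1).mpr h1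
  have h5 : deriv (fun t : ℂ => a 0 * t ^ 0) t = 0 := by simp
  rw [Finset.sum_range_one, h5, sub_zero] at h4
  rw [← h4.tsum_eq, powSum]
  congr 1; ext n
  rw [deriv_const_mul_field, deriv_pow_field]
  push_cast
  ring

/-- The coefficients of the solution `t ^ r * ∑ a n t ^ n` of `f'' = (r (r - 1) / t ^ 2 + q) f`. -/
def frobCoeff (q : ℕ → ℂ) (r : ℤ) : ℕ → ℂ
  | 0 => 1
  | 1 => 0
  -- At a resonance `n + 1 + 2 r = 0` the inverse is `0` by convention, which selects the
  -- coefficient `0`.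
  | n + 2 => (((n : ℂ) + 2) * (n + 1 + 2 * r))⁻¹ *
      ∑ i : Fin (n + 1), q (n - i) * frobCoeff q r i
  decreasing_by exact i.2.trans (by omega)

lemma frobCoeff_add_two (q : ℕ → ℂ) (r : ℤ) (n : ℕ) : frobCoeff q r (n + 2) =
    (((n : ℂ) + 2) * (n + 1 + 2 * r))⁻¹ * ∑ i ∈ Finset.range (n + 1), q (n - i) * frobCoeff q r i := by
  rw [frobCoeff, Finset.sum_range]

/-- The sum has `n + 1` terms of size at most `K ^ (n + 2)`; the factor `n + 2` in the denominator
absorbs their number, and the other factor, a nonzero integer off resonance, has absolute value at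
least `1`. -/
lemma frobCoeff_norm_le {q : ℕ → ℂ} {r : ℤ} {K : ℝ} (hK : 1 ≤ K) (hq : ∀ n, ‖q n‖ ≤ K ^ (n + 2))
    (n : ℕ) : ‖frobCoeff q r n‖ ≤ K ^ n := by
  induction n using Nat.strong_induction_on with
  | _ n ih =>
    match n with
    | 0 => simp [frobCoeff]
    | 1 => simp [frobCoeff]; linarith
    | n + 2 =>
      rw [frobCoeff_add_two, norm_mul, norm_inv, norm_mul]
      have h1 : ‖(n : ℂ) + 2‖ = (n : ℝ) + 2 := by
        rw [show (n : ℂ) + 2 = ((n + 2 : ℕ) : ℂ) by push_cast; rfl, Complex.norm_natCast]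
        push_cast; rfl
      have hsum : ‖∑ i ∈ Finset.range (n + 1), q (n - i) * frobCoeff q r i‖ ≤
          ((n : ℝ) + 2) * K ^ (n + 2) := by
        calc _ ≤ ∑ i ∈ Finset.range (n + 1), K ^ (n + 2) := by
              refine norm_sum_le_of_le _ fun i hi => ?_
              have hi' : i < n + 1 := Finset.mem_range.mp hi
              rw [norm_mul]
              calc _ ≤ K ^ (n - i + 2) * K ^ i := by
                    gcongr
                    · exact hq _
                    · exact ih i (by omega)
                _ = K ^ (n + 2) := by rw [← pow_add]; congr 1; omega
          _ = ((n : ℝ) + 1) * K ^ (n + 2) := by simp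
          _ ≤ _ := by gcongr; linarith
      by_cases hz : (n : ℤ) + 1 + 2 * r = 0
      · have : (n : ℂ) + 1 + 2 * r = 0 := by exact_mod_cast hz
        rw [this]; simp; positivity
      · have h2 : 1 ≤ ‖(n : ℂ) + 1 + 2 * r‖ := by
          rw [show (n : ℂ) + 1 + 2 * r = (((n : ℤ) + 1 + 2 * r : ℤ) : ℂ) by push_cast; rfl,
            Complex.norm_intCast]
          exact_mod_cast Int.one_le_abs hz
        rw [h1, inv_mul_le_iff₀ (by positivity)]
        refine hsum.trans ?_
        have : ((n : ℝ) + 2) * 1 ≤ ((n : ℝ) + 2) * ‖(n : ℂ) + 1 + 2 * r‖ := by gcongr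
        nlinarith [pow_pos (show 0 < K by linarith) (n + 2)]

lemma frobCoeff_odd {q : ℕ → ℂ} (hq : ∀ n, Odd n → q n = 0) (r : ℤ) (n : ℕ) (hn : Odd n) :
    frobCoeff q r n = 0 := by
  induction n using Nat.strong_induction_on with
  | _ n ih =>
    match n with
    | 0 => simp at hn
    | 1 => simp [frobCoeff]
    | n + 2 =>
      have hn' : Odd n := by simpa [Nat.odd_add] using hn
      rw [frobCoeff_add_two, Finset.sum_eq_zero, mul_zero]
      intro i hi
      have hi' : i < n + 1 := Finset.mem_range.mp hi
      by_cases hio : Odd i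
      · rw [ih i (by omega) hio, mul_zero]
      · rw [hq (n - i), zero_mul]
        rw [Nat.odd_sub (by omega)]
        simp only [Nat.not_odd_iff_even] at hio
        simp [hn', hio]

/-- For `r ≥ 0` there is no resonance. Otherwise a resonance forces `n = -2 r - 1` to be odd, so in
each product `q (n - i) * frobCoeff q r i` one index is odd and the right side vanishes: evenness of
the potential is what excludes logarithms. -/
lemma frobCoeff_rec {q : ℕ → ℂ} {r : ℤ} (h : 0 ≤ r ∨ ∀ n, Odd n → q n = 0) (n : ℕ) :
    ((n : ℂ) + 2) * (n + 1 + 2 * r) * frobCoeff q r (n + 2) =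
      ∑ i ∈ Finset.range (n + 1), q (n - i) * frobCoeff q r i := by
  have h2 : (n : ℂ) + 2 ≠ 0 := by exact_mod_cast (show n + 2 ≠ 0 by omega)
  by_cases hz : (n : ℤ) + 1 + 2 * r = 0
  · have hz' : (n : ℂ) + 1 + 2 * r = 0 := by exact_mod_cast hz
    rcases h with h | h
    · omega
    have hn : Odd n := by
      rw [← Int.odd_coe_nat]
      exact ⟨-r - 1, by omega⟩
    have ho : Odd (n + 2) := by simpa [Nat.odd_add] using hn
    rw [hz', mul_zero, zero_mul, Finset.sum_eq_zero]
    intro i hi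
    have hi' : i < n + 1 := Finset.mem_range.mp hi
    by_cases hio : Odd i
    · rw [frobCoeff_odd h r i hio, mul_zero]
    · rw [h (n - i), zero_mul]
      rw [Nat.odd_sub (by omega)]
      simp only [Nat.not_odd_iff_even] at hio
      simp [hn, hio]
  · have hz' : (n : ℂ) + 1 + 2 * r ≠ 0 := by exact_mod_cast hz
    rw [frobCoeff_add_two, ← mul_assoc, mul_inv_cancel₀ (mul_ne_zero h2 hz'), one_mul]

/-- Inserting `t ^ r h` into `f'' = (r (r - 1) / t ^ 2 + q) f` and dividing by `t ^ (r - 1)` gives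
the equation for `h`, which the Frobenius coefficients solve by convergent power series. -/
lemma exists_frobenius {q : ℂ → ℂ} (hq : AnalyticAt ℂ q 0) {r : ℤ}
    (hr : 0 ≤ r ∨ ∀ᶠ t in 𝓝 (0 : ℂ), q (-t) = q t) :
    ∃ h : ℂ → ℂ, AnalyticAt ℂ h 0 ∧ h 0 = 1 ∧
      ∀ᶠ t in 𝓝 (0 : ℂ), t * deriv (deriv h) t + 2 * r * deriv h t = t * q t * h t := by
  obtain ⟨p, hp⟩ := hq
  set c : ℕ → ℂ := fun n => p.coeff n with hc
  have hodd : 0 ≤ r ∨ ∀ n, Odd n → c n = 0 := by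
    refine hr.imp id fun he n hn => ?_
    have hcomp : HasFPowerSeriesAt (fun t => q (-t)) (p.compContinuousLinearMap
        (-ContinuousLinearMap.id ℂ ℂ)) 0 := by
      have hp' : HasFPowerSeriesAt q p ((-ContinuousLinearMap.id ℂ ℂ) 0) := by simpa using hp
      exact hp'.compContinuousLinearMap
    have h1 := (hcomp.congr he).eq_formalMultilinearSeries hp
    have h2 : (p.compContinuousLinearMap (-ContinuousLinearMap.id ℂ ℂ)).coeff n = c n := by
      rw [h1]
    have h3 : (p.compContinuousLinearMap (-ContinuousLinearMap.id ℂ ℂ)).coeff n =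
        (-1) ^ n * c n := by
      simp only [FormalMultilinearSeries.coeff, hc]
      rw [FormalMultilinearSeries.compContinuousLinearMap_apply]
      have : (⇑(-ContinuousLinearMap.id ℂ ℂ) ∘ (1 : Fin n → ℂ)) = fun i => (-1 : ℂ) • (1 : ℂ) := by
        ext i; simp
      rw [this, ContinuousMultilinearMap.map_smul_univ]
      simp
    rw [h3, hn.neg_one_pow] at h2
    linear_combination (-1 / 2 : ℂ) * h2
  obtain ⟨R, hR⟩ := hp
  obtain ⟨s, hs0, hsR⟩ := ENNReal.lt_iff_exists_nnreal_btwn.mp hR.r_pos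
  have hs0' : 0 < s := by exact_mod_cast hs0
  obtain ⟨C, hC, hCb⟩ := p.norm_mul_pow_le_of_lt_radius (hsR.trans_le hR.r_le)
  -- Chosen so that the Cauchy estimate `C / s ^ n` is at most `K ^ (n + 2)`, the form required by
  -- the coefficient bound.
  set K : ℝ := max 1 (max C (1 / s)) with hKdef
  have hK1 : 1 ≤ K := le_max_left _ _
  have hKC : C ≤ K := (le_max_left _ _).trans (le_max_right _ _)
  have hKs : 1 / s ≤ K := (le_max_right _ _).trans (le_max_right _ _)
  have hK : 0 < K := by linarith
  have hcb : ∀ n, ‖c n‖ ≤ K ^ (n + 2) := by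
    intro n
    have h1 : ‖c n‖ ≤ ‖p n‖ := by
      rw [FormalMultilinearSeries.norm_apply_eq_norm_coef]
    have hspos : (0 : ℝ) < s := by exact_mod_cast hs0'
    have h2 : ‖p n‖ ≤ C * (1 / s) ^ n := by
      rw [one_div, inv_pow, ← div_eq_mul_inv, le_div_iff₀ (by positivity)]
      exact hCb n
    refine (h1.trans h2).trans ?_
    calc C * (1 / (s : ℝ)) ^ n ≤ K * K ^ n := by gcongr
      _ = K ^ (n + 1) := by ring
      _ ≤ K ^ (n + 2) := pow_le_pow_right₀ hK1 (by omega)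
  have hcq : ∀ n, ‖c n‖ ≤ K ^ 2 * K ^ n := fun n => (hcb n).trans (le_of_eq (by ring))
  set a : ℕ → ℂ := frobCoeff c r with ha
  have hab : ∀ n, ‖a n‖ ≤ 1 * K ^ n := fun n => by
    rw [one_mul]; exact frobCoeff_norm_le hK1 hcb n
  set a1 : ℕ → ℂ := fun n => ((n : ℂ) + 1) * a (n + 1) with ha1
  have hab1 : ∀ n, ‖a1 n‖ ≤ (1 * K) * (2 * K) ^ n := norm_deriv_coeff_le hab
  set a2 : ℕ → ℂ := fun n => ((n : ℂ) + 1) * a1 (n + 1) with ha2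
  have hab2 : ∀ n, ‖a2 n‖ ≤ (1 * K * (2 * K)) * (2 * (2 * K)) ^ n :=
    norm_deriv_coeff_le hab1
  -- The bound `n + 1 ≤ 2 ^ n` costs a factor two in the radius at each differentiation, hence `1 /
  -- (4 K)` for the second derivative.
  have hdisc : ∀ᶠ t in 𝓝 (0 : ℂ), ‖t‖ < 1 / (4 * K) ∧ t ∈ Metric.eball (0 : ℂ) R := by
    refine (?_ : ∀ᶠ t in 𝓝 (0 : ℂ), ‖t‖ < 1 / (4 * K)).and
      (Metric.isOpen_eball.mem_nhds (by simpa using hR.r_pos))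
    have : Tendsto (fun t : ℂ => ‖t‖) (𝓝 0) (𝓝 0) := by simpa using continuous_norm.tendsto (0 : ℂ)
    exact this.eventually_lt_const (by positivity)
  have hlt : ∀ t : ℂ, ‖t‖ < 1 / (4 * K) → ‖t‖ < 1 / (2 * K) ∧ ‖t‖ < 1 / K := fun t ht =>
    ⟨ht.trans_le (by gcongr; linarith), ht.trans_le (by gcongr; linarith)⟩
  have hd1 : ∀ t : ℂ, ‖t‖ < 1 / K → HasDerivAt (powSum a) (powSum a1 t) t :=
    fun t ht => hasDerivAt_powSum hK hab ht
  have hball : ∀ t : ℂ, ‖t‖ < 1 / K → ∀ᶠ y in 𝓝 t, ‖y‖ < 1 / K := fun t ht =>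
    (continuous_norm.tendsto t).eventually_lt_const ht
  refine ⟨powSum a, ?_, by rw [powSum_zero, ha, frobCoeff], ?_⟩
  · refine (DifferentiableOn.analyticAt (s := Metric.ball 0 (1 / K)) (fun t ht => ?_)
      (Metric.ball_mem_nhds _ (by positivity)))
    exact (hd1 t (by simpa using ht)).differentiableAt.differentiableWithinAt
  filter_upwards [hdisc] with t ht
  obtain ⟨ht4, htR⟩ := ht
  obtain ⟨ht2, ht1⟩ := hlt t ht4
  have e1 : deriv (powSum a) =ᶠ[𝓝 t] powSum a1 := by
    filter_upwards [hball t ht1] with y hy using (hd1 y hy).deriv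
  rw [e1.deriv_eq, e1.eq_of_nhds, (hasDerivAt_powSum (by positivity) hab1 ht2).deriv]
  have s0 := summable_powSum hK hab ht1
  have S0 := hasSum_powSum hK hab ht1
  have S1 := hasSum_powSum (by positivity) hab1 ht2
  have S2 := hasSum_powSum (by positivity) hab2 (ht4.trans_eq (by ring))
  have sq := summable_powSum hK hcq ht1
  have hqt : q t = ∑' n, c n * t ^ n := by
    have := (hR.hasSum htR).tsum_eq
    rw [zero_add] at this
    rw [← this]
    congr 1; ext n
    rw [p.apply_eq_pow_smul_coeff, smul_eq_mul, mul_comm]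
  have prod : HasSum (fun n => t * ((∑ i ∈ Finset.range (n + 1), c (n - i) * a i) * t ^ n))
      (t * (q t * powSum a t)) := by
    have h1 := summable_norm_sum_mul_range_of_summable_norm s0 sq
    have h2 := tsum_mul_tsum_eq_tsum_sum_range_of_summable_norm s0 sq
    have h3 := h1.of_norm.hasSum
    rw [← h2, ← hqt, ← powSum, mul_comm] at h3
    refine (h3.congr_fun fun n => ?_).mul_left t
    rw [Finset.sum_mul]
    refine Finset.sum_congr rfl fun i hi => ?_
    rw [show t ^ n = t ^ i * t ^ (n - i) by
      rw [← pow_add]; congr 1; have := Finset.mem_range.mp hi; omega]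
    ring
  have S1' := (hasSum_nat_add_iff' 1).mpr S1
  rw [Finset.sum_range_one, show a1 0 = 0 by simp [ha1, ha, frobCoeff], zero_mul, sub_zero] at S1'
  rw [mul_assoc t]
  refine ((S2.mul_left t).add (S1'.mul_left (2 * (r : ℂ)))).unique (prod.congr_fun fun n => ?_)
  rw [← frobCoeff_rec hodd n]
  simp only [ha2, ha1, ← ha]
  push_cast
  ring

end HermiteKrichever

end

/-! ### Local bases of meromorphic solutions -/

noncomputable section
namespace HermiteKrichever

/-- Near `x₀` and outside `S` there are two independent meromorphic solutions. -/
def LocalBasis (A B : ℂ → ℂ) (S : Set ℂ) (x₀ : ℂ) : Prop :=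
  ∃ f g : ℂ → ℂ, MeromorphicAt f x₀ ∧ MeromorphicAt g x₀ ∧ ∀ᶠ x in 𝓝 x₀, x ∉ S →
    AnalyticAt ℂ f x ∧ AnalyticAt ℂ g x ∧ deriv (deriv f) x = A x * deriv f x + B x * f x ∧
      deriv (deriv g) x = A x * deriv g x + B x * g x ∧ f x * deriv g x - deriv f x * g x ≠ 0

lemma LocalBasis.fullOn {A B : ℂ → ℂ} {S : Set ℂ} {x₀ : ℂ} (hS : ∀ᶠ y in 𝓝[≠] x₀, y ∉ S)
    (h : LocalBasis A B S x₀) : ∃ ρ > 0, FullOn A B S (Metric.ball x₀ ρ) := by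
  obtain ⟨f, g, hf, hg, h⟩ := h
  obtain ⟨ρ, hρ, hb⟩ := Metric.eventually_nhds_iff_ball.mp (h.and (eventually_nhdsWithin_iff.mp hS))
  refine ⟨ρ, hρ, fun x₁ hx₁ hx₁S c₀ c₁ => ?_⟩
  obtain ⟨f1, g1, -, -, hW⟩ := (hb x₁ hx₁).1 hx₁S
  set W := f x₁ * deriv g x₁ - deriv f x₁ * g x₁ with hWdef
  -- Cramer's rule for the Cauchy data at `x₁`.
  set a := (c₀ * deriv g x₁ - c₁ * g x₁) / W with ha
  set b := (c₁ * f x₁ - c₀ * deriv f x₁) / W with hb'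
  have hd : ∀ x, AnalyticAt ℂ f x → AnalyticAt ℂ g x →
      HasDerivAt (fun z => a * f z + b * g z) (a * deriv f x + b * deriv g x) x := fun x h1 h2 =>
    (h1.differentiableAt.hasDerivAt.const_mul a).fun_add
      (h2.differentiableAt.hasDerivAt.const_mul b)
  refine ⟨fun z => a * f z + b * g z, ⟨fun x hx => ?_, fun x hx hxS => ?_, fun x hx hxS => ?_⟩,
    ?_, ?_⟩
  · by_cases hxS : x ∈ S
    · obtain rfl : x = x₀ := by
        by_contra hne
        exact (hb x hx).2 hne hxS
      fun_prop
    · obtain ⟨h1, h2, -⟩ := (hb x hx).1 hxS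
      exact AnalyticAt.meromorphicAt (by fun_prop)
  · obtain ⟨h1, h2, -⟩ := (hb x hx).1 hxS
    fun_prop
  · obtain ⟨h1, h2, h3, h4, -⟩ := (hb x hx).1 hxS
    have e : deriv (fun z => a * f z + b * g z) =ᶠ[𝓝 x] fun z => a * deriv f z + b * deriv g z := by
      filter_upwards [h1.eventually_analyticAt, h2.eventually_analyticAt] with y k1 k2
      exact (hd y k1 k2).deriv
    rw [e.deriv_eq, e.eq_of_nhds, ((h1.deriv.differentiableAt.hasDerivAt.const_mul a).fun_add
      (h2.deriv.differentiableAt.hasDerivAt.const_mul b)).deriv, h3, h4]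
    ring
  · simp only [ha, hb']
    field_simp
    rw [hWdef]; ring
  · rw [(hd x₁ f1 g1).deriv, ha, hb']
    field_simp
    rw [hWdef]; ring

/-- A gauge transformation maps local bases to local bases. -/
lemma LocalBasis.gauge {V A B u ψ : ℂ → ℂ} {S : Set ℂ} {x₀ : ℂ} (h : LocalBasis 0 V S x₀)
    (hSc : ∀ x ∉ S, ∀ᶠ y in 𝓝 x, y ∉ S)
    (hψ : MeromorphicAt ψ x₀) (hψ' : ∀ᶠ x in 𝓝 x₀, x ∉ S → HasDerivAt ψ (u x * ψ x) x ∧ ψ x ≠ 0)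
    (hA : ∀ᶠ x in 𝓝 x₀, x ∉ S → A x = 2 * u x)
    (hB : ∀ᶠ x in 𝓝 x₀, x ∉ S → ∃ u', HasDerivAt u u' x ∧ B x = V x + u' - u x ^ 2) :
    LocalBasis A B S x₀ := by
  obtain ⟨f, g, hf, hg, h⟩ := h
  refine ⟨fun z => ψ z * f z, fun z => ψ z * g z, hψ.mul hf, hψ.mul hg, ?_⟩
  filter_upwards [h, hψ'.eventually_nhds, hA, hB] with x hx hp' hA hB hxS
  obtain ⟨f1, g1, of, og, hW⟩ := hx hxS
  have hp := hp'.self_of_nhds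
  obtain ⟨p1, p0⟩ := hp hxS
  obtain ⟨u', hu', hB⟩ := hB hxS
  have hA := hA hxS
  have key : ∀ f : ℂ → ℂ, AnalyticAt ℂ f x → deriv (deriv f) x = (0 : ℂ → ℂ) x * deriv f x + V x * f x →
      deriv (fun z => ψ z * f z) x = u x * ψ x * f x + ψ x * deriv f x ∧
      deriv (deriv (fun z => ψ z * f z)) x =
        A x * (u x * ψ x * f x + ψ x * deriv f x) + B x * (ψ x * f x) := by
    intro f hf of
    have e : deriv (fun z => ψ z * f z) =ᶠ[𝓝 x] fun z => u z * ψ z * f z + ψ z * deriv f z := by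
      filter_upwards [hp', hf.eventually_analyticAt, hSc x hxS] with y k1 k2 k3
      exact ((k1 k3).1.fun_mul k2.differentiableAt.hasDerivAt).deriv
    refine ⟨e.eq_of_nhds, ?_⟩
    rw [e.deriv_eq, (((hu'.fun_mul p1).fun_mul hf.differentiableAt.hasDerivAt).fun_add
      (p1.fun_mul hf.deriv.differentiableAt.hasDerivAt)).deriv, of, hA, hB]
    simp only [Pi.zero_apply]
    ring
  have pan : AnalyticAt ℂ ψ x := by
    rw [Complex.analyticAt_iff_eventually_differentiableAt]
    filter_upwards [hp', hSc x hxS] with y k1 k3 using (k1 k3).1.differentiableAt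
  obtain ⟨kf1, kf2⟩ := key f f1 of
  obtain ⟨kg1, kg2⟩ := key g g1 og
  refine ⟨pan.mul f1, pan.mul g1, by rw [kf2, kf1], by rw [kg2, kg1], ?_⟩
  rw [kf1, kg1]
  have : ψ x * f x * (u x * ψ x * g x + ψ x * deriv g x) -
      (u x * ψ x * f x + ψ x * deriv f x) * (ψ x * g x) =
      ψ x ^ 2 * (f x * deriv g x - deriv f x * g x) := by ring
  rw [this]
  exact mul_ne_zero (pow_ne_zero _ p0) hW

/-- Frobenius basis at a point where the potential is `l (l + 1) / t ^ 2 + q t`. -/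
lemma localBasis_frobenius {V q : ℂ → ℂ} {S : Set ℂ} {x₀ : ℂ} {l : ℕ} (hq : AnalyticAt ℂ q 0)
    (hl : l = 0 ∨ x₀ ∈ S ∧ ∀ᶠ t in 𝓝 (0 : ℂ), q (-t) = q t)
    (hV : ∀ᶠ x in 𝓝 x₀, x ∉ S → V x = (l : ℂ) * (l + 1) / (x - x₀) ^ 2 + q (x - x₀)) :
    LocalBasis 0 V S x₀ := by
  have ht : Tendsto (fun x => x - x₀) (𝓝 x₀) (𝓝 0) :=
    Continuous.tendsto' (by fun_prop) _ _ (by simp)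
  -- To be applied to the two exponents `-l` and `l + 1`, the roots of `r (r - 1) = l (l + 1)`.
  have main : ∀ r : ℤ, (0 ≤ r ∨ ∀ᶠ t in 𝓝 (0 : ℂ), q (-t) = q t) → (0 ≤ r ∨ x₀ ∈ S) →
      (r : ℂ) * (r - 1) = l * (l + 1) →
      ∃ h : ℂ → ℂ, AnalyticAt ℂ h x₀ ∧ h x₀ = 1 ∧ MeromorphicAt (fun x => (x - x₀) ^ r * h x) x₀ ∧
        ∀ᶠ x in 𝓝 x₀, x ∉ S → AnalyticAt ℂ (fun x => (x - x₀) ^ r * h x) x ∧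
          HasDerivAt (fun x => (x - x₀) ^ r * h x)
            (r * (x - x₀) ^ (r - 1) * h x + (x - x₀) ^ r * deriv h x) x ∧
          deriv (deriv (fun x => (x - x₀) ^ r * h x)) x = V x * ((x - x₀) ^ r * h x) := by
    intro r hr1 hr2 hrl
    obtain ⟨h₀, h0an, h00, h0⟩ := exists_frobenius hq hr1
    set h : ℂ → ℂ := fun x => h₀ (x - x₀) with hh
    have han : AnalyticAt ℂ h x₀ := AnalyticAt.fun_comp (f := fun x => x - x₀) (by simpa using h0an)
      (by fun_prop)
    have hd1 : deriv h = fun x => deriv h₀ (x - x₀) := funext fun x => deriv_comp_sub_const _ _ _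
    have hd2 : deriv (deriv h) = fun x => deriv (deriv h₀) (x - x₀) := by
      rw [hd1]; exact funext fun x => deriv_comp_sub_const _ _ _
    set f : ℂ → ℂ := fun x => (x - x₀) ^ r * h x with hf
    have hsub : ∀ x, HasDerivAt (fun x => x - x₀) 1 x := fun x => (hasDerivAt_id x).sub_const x₀
    have hz : ∀ (m : ℤ) (x : ℂ), (x - x₀ ≠ 0 ∨ 0 ≤ m) →
        HasDerivAt (fun x => (x - x₀) ^ m) (m * (x - x₀) ^ (m - 1)) x := fun m x hx => by
      have := HasDerivAt.comp (h₂ := fun y : ℂ => y ^ m) x (hasDerivAt_zpow m (x - x₀) hx) (hsub x)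
      rwa [mul_one] at this
    have hne : ∀ x ∉ S, x - x₀ ≠ 0 ∨ 0 ≤ r := fun x hx => by
      rcases hr2 with h | h
      · exact Or.inr h
      · exact Or.inl (sub_ne_zero.mpr fun he => hx (he ▸ h))
    have hfd : ∀ x, (x - x₀ ≠ 0 ∨ 0 ≤ r) → AnalyticAt ℂ h x → HasDerivAt f
        (r * (x - x₀) ^ (r - 1) * h x + (x - x₀) ^ r * deriv h x) x := fun x hx k =>
      (hz r x hx).fun_mul k.differentiableAt.hasDerivAt
    have ode : ∀ᶠ x in 𝓝[≠] x₀, deriv (deriv f) x =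
        ((l : ℂ) * (l + 1) / (x - x₀) ^ 2 + q (x - x₀)) * f x := by
      filter_upwards [self_mem_nhdsWithin, nhdsWithin_le_nhds (ht.eventually h0),
        nhdsWithin_le_nhds han.eventually_analyticAt] with x hx heq hhx
      have hx0 : x - x₀ ≠ 0 := sub_ne_zero.mpr hx
      have e : deriv f =ᶠ[𝓝 x] fun x => r * (x - x₀) ^ (r - 1) * h x + (x - x₀) ^ r * deriv h x := by
        filter_upwards [hhx.eventually_analyticAt, isOpen_ne.mem_nhds hx] with y k1 k2
        exact (hfd y (Or.inl (sub_ne_zero.mpr k2)) k1).deriv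
      have hzp : ∀ (m : ℤ), (x - x₀) ^ m = (x - x₀) ^ (m - 1) * (x - x₀) :=
        fun m => by rw [← zpow_add_one₀ hx0]; simp
      rw [e.deriv_eq, ((((hz (r - 1) x (Or.inl hx0)).const_mul (r : ℂ)).fun_mul
        hhx.differentiableAt.hasDerivAt).fun_add ((hz r x (Or.inl hx0)).fun_mul
        hhx.deriv.differentiableAt.hasDerivAt)).deriv, ← hrl]
      rw [hd2]
      simp only [hf, hd1] at heq ⊢
      rw [hzp r, hzp (r - 1)]
      push_cast
      field_simp
      simp only [hh]
      linear_combination (x - x₀) * heq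
    refine ⟨h, han, by simp [hh, h00], (by fun_prop), ?_⟩
    filter_upwards [eventually_nhdsWithin_iff.mp ode, han.eventually_analyticAt, hV]
      with x h1 h2 h3 hxS
    have fan : AnalyticAt ℂ f x := by
      refine AnalyticAt.fun_mul ?_ h2
      rcases hne x hxS with h | h
      · exact AnalyticAt.zpow (by fun_prop) h
      · lift r to ℕ using h
        simp only [zpow_natCast]; fun_prop
    refine ⟨fan, hfd x (hne x hxS) h2, ?_⟩
    rw [h3 hxS]
    -- The centre lies outside `S` only when `l = 0`; the equation is then extended to it by
    -- continuity.
    by_cases hx : x = x₀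
    · subst hx
      have hl0 : l = 0 := hl.resolve_right fun hh => hxS hh.1
      have hqx : ContinuousAt (fun y => q (y - x) * f y) x := by
        refine ContinuousAt.mul ?_ fan.continuousAt
        exact ContinuousAt.comp (f := fun y => y - x) (by simpa using hq.continuousAt) (by fun_prop)
      have := eq_of_eventuallyEq_nhdsNE fan.deriv.deriv.continuousAt hqx (by
        filter_upwards [ode] with y hy
        rw [hy, hl0]; simp)
      rw [this, hl0, Nat.cast_zero, zero_mul, zero_div, zero_add]
    · exact h1 hx
  have hl' : (0 : ℤ) ≤ -l ∨ l ≠ 0 := by omega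
  obtain ⟨h₁, a1, v1, m1, e1⟩ := main (-l) (by
      rcases hl with h | h
      · left; simp [h]
      · exact Or.inr h.2) (by
      rcases hl with h | h
      · left; simp [h]
      · exact Or.inr h.1) (by push_cast; ring)
  obtain ⟨h₂, a2, v2, m2, e2⟩ := main (l + 1) (Or.inl (by omega)) (Or.inl (by omega))
    (by push_cast; ring)
  refine ⟨_, _, m1, m2, ?_⟩
  -- This is the Wronskian of `t ^ (-l) h₁` and `t ^ (l + 1) h₂`; at the centre it equals `2 l + 1`.
  have hW : ∀ᶠ x in 𝓝 x₀, (2 * l + 1) * h₁ x * h₂ x +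
      (x - x₀) * (h₁ x * deriv h₂ x - deriv h₁ x * h₂ x) ≠ 0 := by
    have c1 := a1.continuousAt
    have c2 := a2.continuousAt
    have c3 := a1.deriv.continuousAt
    have c4 := a2.deriv.continuousAt
    refine ContinuousAt.eventually_ne (by fun_prop) ?_
    rw [v1, v2, sub_self, zero_mul, add_zero, mul_one, mul_one]
    exact_mod_cast (show 2 * l + 1 ≠ 0 by omega)
  filter_upwards [e1, e2, hW] with x k1 k2 k3 hxS
  obtain ⟨b1, b2, b3⟩ := k1 hxS
  obtain ⟨d1, d2, d3⟩ := k2 hxS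
  refine ⟨b1, d1, by rw [b3]; simp, by rw [d3]; simp, ?_⟩
  rw [b2.deriv, d2.deriv]
  convert k3 using 1
  by_cases hx : x - x₀ = 0
  · have hl0 : l = 0 := hl.resolve_right fun hh => hxS (sub_eq_zero.mp hx ▸ hh.1)
    subst hl0
    simp [hx]
  · have : (x - x₀) ^ (-(l : ℤ) - 1) = ((x - x₀) ^ l)⁻¹ * (x - x₀)⁻¹ := by
      rw [zpow_sub_one₀ hx, zpow_neg, zpow_natCast]
    have h2 : (x - x₀) ^ ((l : ℤ) + 1) = (x - x₀) ^ l * (x - x₀) := by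
      rw [zpow_add_one₀ hx, zpow_natCast]
    rw [this, h2, add_sub_cancel_right, zpow_neg, zpow_natCast]
    push_cast
    field_simp
    ring

end HermiteKrichever

end

/-! ### The gauge transformation from `H` to `H_g` -/

noncomputable section
namespace HermiteKrichever

/-- The order of a meromorphic function, read off from a limit. -/
lemma order_eq_of_tendsto {f : ℂ → ℂ} {x c : ℂ} {n : ℤ} (hf : MeromorphicAt f x) (hc : c ≠ 0)
    (h : Tendsto (fun z => (z - x) ^ (-n) * f z) (𝓝[≠] x) (𝓝 c)) : meromorphicOrderAt f x = n := by
  have hz : MeromorphicAt (fun z => (z - x) ^ (-n)) x := by fun_prop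
  have h1 : meromorphicOrderAt ((fun z => (z - x) ^ (-n)) * f) x = 0 :=
    (tendsto_ne_zero_iff_meromorphicOrderAt_eq_zero (hz.mul hf)).mp ⟨c, hc, h⟩
  have h2 : meromorphicOrderAt (fun z => (z - x) ^ (-n)) x = ((-n : ℤ) : WithTop ℤ) :=
    meromorphicOrderAt_zpow_id_sub_const
  rw [meromorphicOrderAt_mul hz hf, h2] at h1
  cases ho : meromorphicOrderAt f x with
  | top => simp [ho] at h1
  | coe m =>
    rw [ho] at h1
    have h2 : -n + m = 0 := by exact_mod_cast h1
    rw [show m = n by omega]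

/-- Local square roots. -/
lemma exists_sqrt {g : ℂ → ℂ} {x₀ : ℂ} (hg : AnalyticAt ℂ g x₀) (h0 : g x₀ ≠ 0) :
    ∃ ψ : ℂ → ℂ, AnalyticAt ℂ ψ x₀ ∧ ∀ᶠ x in 𝓝 x₀, ψ x ^ 2 = g x := by
  obtain ⟨c, hc⟩ := IsAlgClosed.exists_pow_nat_eq (g x₀) (n := 2) (by norm_num)
  have hd : AnalyticAt ℂ (fun x => g x / g x₀) x₀ := hg.div_const
  refine ⟨fun x => c * Complex.exp (Complex.log (g x / g x₀) / 2), ?_, ?_⟩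
  · have : AnalyticAt ℂ (fun x => Complex.log (g x / g x₀)) x₀ :=
      hd.clog (by simp [h0, Complex.one_mem_slitPlane])
    fun_prop
  · filter_upwards [hg.continuousAt.eventually_ne h0] with x hx
    rw [mul_pow, ← Complex.exp_nat_mul, hc]
    push_cast
    rw [mul_div_cancel₀ _ two_ne_zero, Complex.exp_log (div_ne_zero hx h0), mul_div_cancel₀ _ h0]

/-- Logarithmic derivative of a square root. -/
lemma hasDerivAt_of_sq {ψ G : ℂ → ℂ} {x u : ℂ} (hψ : DifferentiableAt ℂ ψ x)
    (h : ∀ᶠ y in 𝓝 x, ψ y ^ 2 = G y) (hG : HasDerivAt G (2 * u * G x) x) (h0 : G x ≠ 0) :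
    HasDerivAt ψ (u * ψ x) x := by
  have h1 := (hψ.hasDerivAt.fun_pow 2).congr_of_eventuallyEq
    (show G =ᶠ[𝓝 x] fun y => ψ y ^ 2 by filter_upwards [h] with y hy using hy.symm)
  have h2 := h1.unique hG
  rw [← h.self_of_nhds] at h2 h0
  have h3 : ψ x ≠ 0 := fun h => h0 (by simp [h])
  have h4 : deriv ψ x = u * ψ x := by
    apply mul_left_cancel₀ (mul_ne_zero two_ne_zero h3)
    simp only [Nat.cast_ofNat, Nat.add_one_sub_one, pow_one] at h2
    linear_combination h2
  rw [← h4]; exact hψ.hasDerivAt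

/-- Logarithmic derivative of a product of powers. -/
lemma hasDerivAt_prod_pow {ι : Type*} (s : Finset ι) {g : ι → ℂ → ℂ} {u : ι → ℂ} {x : ℂ} (n : ι → ℕ)
    (h : ∀ i ∈ s, HasDerivAt (g i) (u i * g i x) x) :
    HasDerivAt (fun y => ∏ i ∈ s, g i y ^ n i) ((∑ i ∈ s, n i * u i) * ∏ i ∈ s, g i x ^ n i) x := by
  classical
  induction s using Finset.induction_on with
  | empty => simpa using hasDerivAt_const x (1 : ℂ)
  | insert a s ha ih =>
    have h1 := (h a (Finset.mem_insert_self a s)).fun_pow (n a)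
    have h2 := ih fun i hi => h i (Finset.mem_insert_of_mem hi)
    simp only [Finset.prod_insert ha, Finset.sum_insert ha]
    refine (h1.fun_mul h2).congr_deriv ?_
    rcases hn : n a with _ | m
    · simp
    · simp only [Nat.add_one_sub_one]
      ring

/-- The partial fraction expansion of `P(z) (∑ r / (z - b)) ^ 2` for a Weierstrass cubic `P`. -/
lemma cubic_mul_sum_sq (L : PeriodPair) {M : ℕ} (b r : Fin M → ℂ) (hb : Function.Injective b) (z : ℂ)
    (hz : ∀ k, z - b k ≠ 0) :
    cubic L z * (∑ k, r k / (z - b k)) ^ 2 =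
      (∑ k, (r k ^ 2 * cubic L z / (z - b k) ^ 2 + 2 * r k * cubic L (b k) / (z - b k) *
        (∑ m ∈ Finset.univ.erase k, r m / (b k - b m)) - 4 * r k ^ 2 * z - 8 * b k * r k ^ 2)) +
      4 * z * (∑ k, r k) ^ 2 + 8 * (∑ k, b k * r k) * ∑ k, r k := by
  set G : Fin M → Fin M → ℂ := fun k m => r k * cubic L (b k) / (z - b k) * (r m / (b k - b m)) with hG
  have hpair : ∀ k m, cubic L z * (r k / (z - b k) * (r m / (z - b m))) =
      4 * r k * r m * (z + b k + b m) + G k m + G m k +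
        if k = m then r k ^ 2 * cubic L z / (z - b k) ^ 2 - 4 * r k ^ 2 * z - 8 * b k * r k ^ 2
        else 0 := by
    -- On the diagonal `G k k = 0` because of the division by `b k - b k = 0`; the conditional term
    -- supplies the double pole and removes the polynomial part wrongly added there.
    intro k m
    have h1 := hz k
    have h2 := hz m
    by_cases hkm : k = m
    · subst hkm
      simp only [hG, sub_self, div_zero, mul_zero, if_true]
      field_simp
      ring
    · have h3 : b k - b m ≠ 0 := sub_ne_zero.mpr fun h => hkm (hb h)
      have h4 : b m - b k ≠ 0 := sub_ne_zero.mpr fun h => hkm (hb h.symm)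
      rw [if_neg hkm]
      simp only [hG, cubic]
      rw [show b m - b k = -(b k - b m) by ring]
      field_simp
      ring
  have hS : ∀ k, ∑ m ∈ Finset.univ.erase k, r m / (b k - b m) = ∑ m, r m / (b k - b m) := fun k => by
    rw [← Finset.add_sum_erase _ _ (Finset.mem_univ k)]; simp
  have hGs : ∑ k, ∑ m, G k m = ∑ k, r k * cubic L (b k) / (z - b k) *
      ∑ m ∈ Finset.univ.erase k, r m / (b k - b m) :=
    Finset.sum_congr rfl fun k _ => by rw [hS, Finset.mul_sum]
  have hlin : ∑ k, ∑ m, 4 * r k * r m * (z + b k + b m) =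
      4 * z * (∑ k, r k) ^ 2 + 8 * (∑ k, b k * r k) * ∑ k, r k := by
    have e1 : ∑ k, ∑ m, b k * r k * r m = (∑ k, b k * r k) * ∑ k, r k := by
      rw [Finset.sum_mul_sum]
    have e2 : ∑ k, ∑ m, r k * r m = (∑ k, r k) ^ 2 := by
      rw [sq, Finset.sum_mul_sum]
    have e3 : ∑ k, ∑ m, b m * r m * r k = (∑ k, b k * r k) * ∑ k, r k := by
      rw [Finset.sum_comm]; exact e1
    have : ∑ k, ∑ m, 4 * r k * r m * (z + b k + b m) = 4 * z * (∑ k, ∑ m, r k * r m) +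
        4 * (∑ k, ∑ m, b k * r k * r m) + 4 * ∑ k, ∑ m, b m * r m * r k := by
      simp only [Finset.mul_sum, ← Finset.sum_add_distrib]
      exact Finset.sum_congr rfl fun k _ => Finset.sum_congr rfl fun m _ => by ring
    rw [this, e1, e2, e3]; ring
  have hsplit : ∑ k, (r k ^ 2 * cubic L z / (z - b k) ^ 2 + 2 * r k * cubic L (b k) / (z - b k) *
      (∑ m ∈ Finset.univ.erase k, r m / (b k - b m)) - 4 * r k ^ 2 * z - 8 * b k * r k ^ 2) =
      2 * (∑ k, r k * cubic L (b k) / (z - b k) * ∑ m ∈ Finset.univ.erase k, r m / (b k - b m)) +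
      ∑ k, (r k ^ 2 * cubic L z / (z - b k) ^ 2 - 4 * r k ^ 2 * z - 8 * b k * r k ^ 2) := by
    rw [Finset.mul_sum, ← Finset.sum_add_distrib]
    exact Finset.sum_congr rfl fun k _ => by ring
  have hexp : cubic L z * (∑ k, r k / (z - b k)) ^ 2 =
      ∑ k, ∑ m, cubic L z * (r k / (z - b k) * (r m / (z - b m))) := by
    rw [sq, Finset.sum_mul_sum]; simp only [Finset.mul_sum]
  rw [hsplit, hexp]
  simp only [hpair, Finset.sum_add_distrib, Finset.sum_ite_eq, Finset.mem_univ, if_true]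
  rw [hlin, Finset.sum_comm (f := fun k m => G m k), hGs]
  ring

namespace HKData

variable {D : HKData}

lemma notMem_lattice_of_notMem_halfLattice {x : ℂ} (hx : x ∉ D.halfLattice) : x ∉ D.L.lattice :=
  fun h => hx (D.lattice_subset_halfLattice h)

lemma notMem_halfLattice_of_notMem_sing {x : ℂ} (hx : x ∉ D.sing) : x ∉ D.halfLattice :=
  fun h => hx (Or.inl h)

lemma δ_notMem (hδ : ∀ k, 2 * D.δ k ∉ D.L.lattice) (k : Fin D.M) : D.δ k ∉ D.L.lattice := fun h =>
  hδ k (by rw [two_mul]; exact add_mem h h)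

lemma wp_eq_b_iff (hδ : ∀ k, 2 * D.δ k ∉ D.L.lattice) {x : ℂ} (hx : x ∉ D.L.lattice) (k : Fin D.M) :
    D.L.weierstrassP x = D.b k ↔ x - D.δ k ∈ D.L.lattice ∨ x + D.δ k ∈ D.L.lattice :=
  wp_eq_wp_iff D.L (δ_notMem hδ k) hx

lemma notMem_sing_iff (hδ : ∀ k, 2 * D.δ k ∉ D.L.lattice) {x : ℂ} :
    x ∉ D.sing ↔ x ∉ D.halfLattice ∧ ∀ k, D.L.weierstrassP x - D.b k ≠ 0 := by
  constructor
  · intro h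
    have h1 := notMem_halfLattice_of_notMem_sing h
    refine ⟨h1, fun k hk => h (Or.inr ⟨k, ?_⟩)⟩
    exact (wp_eq_b_iff hδ (notMem_lattice_of_notMem_halfLattice h1) k).mp (sub_eq_zero.mp hk)
  · rintro ⟨h1, h2⟩ (h | ⟨k, hk⟩)
    · exact h1 h
    · exact h2 k (sub_eq_zero.mpr
        ((wp_eq_b_iff hδ (notMem_lattice_of_notMem_halfLattice h1) k).mpr hk))

lemma eventually_notMem_sing (D : HKData) (x : ℂ) : ∀ᶠ y in 𝓝[≠] x, y ∉ D.sing := by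
  have h1 : ∀ c, ∀ᶠ y in 𝓝[≠] x, y - c ∉ D.L.lattice := fun c =>
    (tendsto_sub_nhdsNE c x).eventually (eventually_notMem_lattice D.L _)
  have h2 : ∀ᶠ y in 𝓝[≠] x, 2 * y ∉ D.L.lattice := by
    have : Tendsto (fun y : ℂ => 2 * y) (𝓝[≠] x) (𝓝[≠] (2 * x)) := by
      refine tendsto_nhdsWithin_iff.mpr ⟨?_, ?_⟩
      · exact (Continuous.tendsto' (by fun_prop) _ _ rfl).mono_left nhdsWithin_le_nhds
      · filter_upwards [self_mem_nhdsWithin] with z hz h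
        exact hz (by simpa using h)
    exact this.eventually (eventually_notMem_lattice D.L _)
  filter_upwards [h2, eventually_all.mpr fun k => h1 (D.δ k), eventually_all.mpr fun k => h1 (-D.δ k)]
    with y k2 k3 k4
  rintro (h | ⟨k, h | h⟩)
  exacts [k2 h, k3 k h, k4 k (by simpa using h)]

lemma eventually_notMem_sing_nhds (D : HKData) (x : ℂ) (hx : x ∉ D.sing) :
    ∀ᶠ y in 𝓝 x, y ∉ D.sing := by
  filter_upwards [eventually_nhdsWithin_iff.mp (D.eventually_notMem_sing x)] with y hy
  by_cases h : y = x
  · rwa [h]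
  · exact hy h

lemma neg_mem_sing {x : ℂ} : -x ∈ D.sing ↔ x ∈ D.sing := by
  have h1 : -x ∈ D.halfLattice ↔ x ∈ D.halfLattice := by
    rw [mem_halfLattice, mem_halfLattice, mul_neg, neg_mem_iff]
  refine or_congr h1 (exists_congr fun i => ?_)
  rw [← neg_mem_iff (x := -x - _), ← neg_mem_iff (x := -x + _), or_comm]
  simp [sub_eq_add_neg, add_comm]

lemma add_mem_halfLattice {l x : ℂ} (hl : l ∈ D.L.lattice) :
    x + l ∈ D.halfLattice ↔ x ∈ D.halfLattice := by
  rw [mem_halfLattice, mem_halfLattice, mul_add, add_mem_cancel_right (D.lattice_subset_halfLattice hl)]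

lemma add_mem_sing {l x : ℂ} (hl : l ∈ D.L.lattice) : x + l ∈ D.sing ↔ x ∈ D.sing := by
  refine or_congr (add_mem_halfLattice hl) (exists_congr fun i => ?_)
  rw [add_sub_right_comm, add_right_comm, add_mem_cancel_right hl, add_mem_cancel_right hl]

/-- The coefficient of the first derivative in `H_g`. -/
def hgA (D : HKData) (x : ℂ) : ℂ :=
  ∑ k, D.r k * D.L.derivWeierstrassP x / (D.L.weierstrassP x - D.b k)

/-- The potential of `H_g`. -/
def hgW (D : HKData) (x : ℂ) : ℂ :=
  ((D.l 0 : ℂ) + D.R) * ((D.l 0 : ℂ) + 1 - D.R) * D.L.weierstrassP x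
      + (∑ i : Fin 3, (D.l i.succ : ℂ) * (D.l i.succ + 1) * D.L.weierstrassP (x + D.ω i.succ))
      + ∑ k, D.st k / (D.L.weierstrassP x - D.b k)

/-- The coefficient of order zero in `Λ'' = A Λ' + B Λ`. -/
def hgB (D : HKData) (x : ℂ) : ℂ := D.hgW x - (D.E + D.Cg)

lemma Hg_eq_iff (D : HKData) (f : ℂ → ℂ) (x : ℂ) : D.Hg f x - (D.E + D.Cg) * f x = 0 ↔
    deriv (deriv f) x = D.hgA x * deriv f x + D.hgB x * f x := by
  rw [show D.Hg f x = -deriv (deriv f) x + D.hgA x * deriv f x + D.hgW x * f x from rfl, hgB]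
  constructor <;> intro h <;> linear_combination -h

/-- Half of `hgA`, the logarithmic derivative of `Ψ_g`. -/
def gauge (D : HKData) (x : ℂ) : ℂ :=
  ∑ k, (D.r k : ℂ) * (D.L.derivWeierstrassP x / (2 * (D.L.weierstrassP x - D.b k)))

lemma hgA_eq (D : HKData) (x : ℂ) : D.hgA x = 2 * D.gauge x := by
  rw [hgA, gauge, Finset.mul_sum]
  refine Finset.sum_congr rfl fun k _ => ?_
  rw [← div_div]; ring

lemma hasDerivAt_gauge {x : ℂ} (hδ : ∀ k, 2 * D.δ k ∉ D.L.lattice) (hx : x ∉ D.sing) :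
    HasDerivAt D.gauge (∑ k, (D.r k : ℂ) * (((6 * D.L.weierstrassP x ^ 2 - D.L.g₂ / 2) *
      (2 * (D.L.weierstrassP x - D.b k)) - D.L.derivWeierstrassP x *
        (2 * D.L.derivWeierstrassP x)) / (2 * (D.L.weierstrassP x - D.b k)) ^ 2)) x := by
  obtain ⟨h1, h2⟩ := (notMem_sing_iff hδ).mp hx
  have hl := notMem_lattice_of_notMem_halfLattice h1
  refine HasDerivAt.fun_sum fun k _ => HasDerivAt.const_mul _ ?_
  exact (hasDerivAt_wp' D.L hl).fun_div (((hasDerivAt_wp D.L hl).sub_const _).const_mul 2)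
    (mul_ne_zero two_ne_zero (h2 k))

/-- This says that `H_g` is the conjugate of `H` by `Ψ_g`, with `u = Ψ_g' / Ψ_g` the gauge. The
addition formula makes both sides rational in `℘(x)`, and the partial fraction expansion of `u ^ 2`
reduces the identity to one for each `k`; its polynomial part accounts for `C_g` and for the change
in the coefficient of `℘`. -/
lemma gauge_identity (hδ : ∀ k, 2 * D.δ k ∉ D.L.lattice) (hb : Function.Injective D.b) {x : ℂ}
    (hx : x ∉ D.sing) : ∃ u', HasDerivAt D.gauge u' x ∧
      D.hgB x = (D.v x - D.E) + u' - D.gauge x ^ 2 := by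
  refine ⟨_, hasDerivAt_gauge hδ hx, ?_⟩
  obtain ⟨h1, h2⟩ := (notMem_sing_iff hδ).mp hx
  have hl := notMem_lattice_of_notMem_halfLattice h1
  have hY := wp'_sq D.L hl
  have hadd : ∀ k, D.L.weierstrassP (x - D.δ k) + D.L.weierstrassP (x + D.δ k) =
      2 * D.b k + (6 * D.b k ^ 2 - D.L.g₂ / 2) / (D.L.weierstrassP x - D.b k) +
        cubic D.L (D.b k) / (D.L.weierstrassP x - D.b k) ^ 2 := fun k =>
    wp_add_wp D.L hl (δ_notMem hδ k) (fun h => hx (Or.inr ⟨k, Or.inr h⟩))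
      (fun h => hx (Or.inr ⟨k, Or.inl h⟩))
  have hpf := cubic_mul_sum_sq D.L D.b (fun k => (D.r k : ℂ)) hb (D.L.weierstrassP x) h2
  have hR : (D.R : ℂ) = ∑ k, (D.r k : ℂ) := by simp [R]
  have hu : D.gauge x ^ 2 = 1 / 4 * (cubic D.L (D.L.weierstrassP x) *
      (∑ k, (D.r k : ℂ) / (D.L.weierstrassP x - D.b k)) ^ 2) := by
    have : D.gauge x = D.L.derivWeierstrassP x / 2 *
        ∑ k, (D.r k : ℂ) / (D.L.weierstrassP x - D.b k) := by
      rw [gauge, Finset.mul_sum]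
      exact Finset.sum_congr rfl fun k _ => by rw [← div_div]; ring
    rw [this, ← hY]; ring
  rw [hgB, hgW, v, hu, hpf, Cg, Fin.sum_univ_succ (n := 3), ω_zero, add_zero, hR]
  have key : (∑ k, ((D.r k : ℂ) / 2 * ((D.r k : ℂ) / 2 + 1) *
        (D.L.weierstrassP (x - D.δ k) + D.L.weierstrassP (x + D.δ k))
      + D.s k / (D.L.weierstrassP x - D.b k))) + (∑ k, (D.r k : ℂ) *
      (((6 * D.L.weierstrassP x ^ 2 - D.L.g₂ / 2) *
      (2 * (D.L.weierstrassP x - D.b k)) - D.L.derivWeierstrassP x *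
        (2 * D.L.derivWeierstrassP x)) / (2 * (D.L.weierstrassP x - D.b k)) ^ 2)) -
      1 / 4 * ∑ k, ((D.r k : ℂ) ^ 2 * cubic D.L (D.L.weierstrassP x) / (D.L.weierstrassP x - D.b k) ^ 2 +
        2 * D.r k * cubic D.L (D.b k) / (D.L.weierstrassP x - D.b k) *
        (∑ m ∈ Finset.univ.erase k, (D.r m : ℂ) / (D.b k - D.b m)) - 4 * D.r k ^ 2 * D.L.weierstrassP x -
          8 * D.b k * D.r k ^ 2) =
      (∑ k, D.st k / (D.L.weierstrassP x - D.b k)) + D.L.weierstrassP x * (∑ k, (D.r k : ℂ)) +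
        (1 / 2 : ℂ) * ∑ k, D.b k * D.r k ^ 2 := by
    rw [Finset.mul_sum, Finset.mul_sum, Finset.mul_sum, ← Finset.sum_add_distrib,
      ← Finset.sum_add_distrib, ← Finset.sum_add_distrib, ← Finset.sum_sub_distrib]
    refine Finset.sum_congr rfl fun k _ => ?_
    have h3 := h2 k
    rw [hadd, st, show D.L.derivWeierstrassP x * (2 * D.L.derivWeierstrassP x) =
      2 * D.L.derivWeierstrassP x ^ 2 by ring, hY]
    simp only [cubic]
    generalize ∑ m ∈ Finset.univ.erase k, (D.r m : ℂ) / (D.b k - D.b m) = S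
    field_simp
    ring
  linear_combination -key

end HKData

end HermiteKrichever

end

/-! ### Local solvability away from the points `± δ k` -/

noncomputable section
namespace HermiteKrichever

lemma ordGE_comp_add {f : ℂ → ℂ} {x c : ℂ} {n : ℤ} (h : f ∈ ordGE (x + c) n) :
    (fun z => f (z + c)) ∈ ordGE x n := by
  obtain ⟨g, hg, hfg⟩ := mem_ordGE_iff.mp h
  refine mem_ordGE_iff.mpr ⟨fun z => g (z + c), AnalyticAt.fun_comp (f := fun z => z + c) hg
    (by fun_prop), ?_⟩
  have := tendsto_sub_nhdsNE (-c) x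
  simp only [sub_neg_eq_add] at this
  filter_upwards [this.eventually hfg] with z hz
  rw [hz]; ring_nf

lemma ordGE_comp_neg {f : ℂ → ℂ} {x : ℂ} {n : ℤ} (h : f ∈ ordGE (-x) n) :
    (fun z => f (-z)) ∈ ordGE x n := by
  obtain ⟨g, hg, hfg⟩ := mem_ordGE_iff.mp h
  refine mem_ordGE_iff.mpr ⟨fun z => (-1) ^ n * g (-z), ?_, ?_⟩
  · exact analyticAt_const.fun_mul (AnalyticAt.fun_comp (f := fun z => -z) hg (by fun_prop))
  have : Tendsto (fun z : ℂ => -z) (𝓝[≠] x) (𝓝[≠] (-x)) := by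
    refine tendsto_nhdsWithin_iff.mpr ⟨?_, ?_⟩
    · exact (Continuous.tendsto' (by fun_prop) _ _ rfl).mono_left nhdsWithin_le_nhds
    · filter_upwards [self_mem_nhdsWithin] with z hz h
      exact hz (by simpa using h)
  filter_upwards [this.eventually hfg] with z hz
  rw [hz, ← mul_assoc, ← mul_zpow]; ring_nf

lemma ordGE_add {x : ℂ} {n : ℤ} {f g : ℂ → ℂ} (hf : f ∈ ordGE x n) (hg : g ∈ ordGE x n) :
    (fun z => f z + g z) ∈ ordGE x n := add_mem hf hg

lemma ordGE_const_mul {x : ℂ} {n : ℤ} {f : ℂ → ℂ} (c : ℂ) (hf : f ∈ ordGE x n) :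
    (fun z => c * f z) ∈ ordGE x n := Submodule.smul_mem _ c hf

lemma ordGE_sum {ι : Type*} {s : Finset ι} {x : ℂ} {n : ℤ} {f : ι → ℂ → ℂ}
    (hf : ∀ i ∈ s, f i ∈ ordGE x n) : (fun z => ∑ i ∈ s, f i z) ∈ ordGE x n := by
  have := Submodule.sum_mem (ordGE x n) hf
  convert this using 1
  ext z; simp

lemma ordGE_const (x c : ℂ) : (fun _ => c) ∈ ordGE x 0 :=
  (analyticAt_const (v := c)).mem_ordGE

lemma order_wp_sub (L : PeriodPair) {x : ℂ} (hx : x ∈ L.lattice) (c : ℂ) :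
    meromorphicOrderAt (fun z => L.weierstrassP z - c) x = ((-2 : ℤ) : WithTop ℤ) := by
  have h1 := L.order_weierstrassP x hx
  have h2 : (0 : WithTop ℤ) ≤ meromorphicOrderAt (fun _ => -c) x :=
    (analyticAt_const (v := -c)).meromorphicOrderAt_nonneg
  rw [show (fun z => L.weierstrassP z - c) = L.weierstrassP + fun _ => -c by
      ext z; simp [sub_eq_add_neg],
    meromorphicOrderAt_add_eq_left_of_lt (MeromorphicAt.const _ _), h1]
  · norm_num
  · rw [h1]; refine lt_of_lt_of_le ?_ h2; decide

lemma inv_wp_sub_mem (L : PeriodPair) {x : ℂ} (hx : x ∈ L.lattice) (c : ℂ) :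
    (fun z => (L.weierstrassP z - c)⁻¹) ∈ ordGE x 2 := by
  have hm : MeromorphicAt (fun z => L.weierstrassP z - c) x :=
    (L.meromorphic_weierstrassP x).sub (MeromorphicAt.const _ _)
  refine mem_ordGE_of_eq hm.inv ?_
  rw [show (fun z => (L.weierstrassP z - c)⁻¹) = (fun z => L.weierstrassP z - c)⁻¹ from rfl,
    meromorphicOrderAt_inv, order_wp_sub L hx]
  rfl

lemma wp_sub_principal (L : PeriodPair) {x : ℂ} (hx : x ∈ L.lattice) :
    (fun z => L.weierstrassP z - 1 / (z - x) ^ 2) ∈ ordGE x 0 := by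
  have h : (fun z => L.weierstrassP z - 1 / (z - x) ^ 2) =
      fun z => L.weierstrassPExcept x z - 1 / x ^ 2 := by
    ext z
    rw [← L.weierstrassPExcept_add ⟨x, hx⟩]
    ring
  rw [h]
  refine AnalyticAt.mem_ordGE ?_
  exact (L.analyticAt_weierstrassPExcept x).fun_sub analyticAt_const

namespace HKData

variable {D : HKData}

lemma wp_add_mem (L : PeriodPair) {l : ℂ} (hl : l ∈ L.lattice) (x : ℂ) :
    L.weierstrassP (x + l) = L.weierstrassP x := L.weierstrassP_add_coe x ⟨l, hl⟩

lemma wp'_add_mem (L : PeriodPair) {l : ℂ} (hl : l ∈ L.lattice) (x : ℂ) :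
    L.derivWeierstrassP (x + l) = L.derivWeierstrassP x := L.derivWeierstrassP_add_coe x ⟨l, hl⟩

lemma wp_neg_add_ω (D : HKData) (i : Fin 4) (x : ℂ) :
    D.L.weierstrassP (-x + D.ω i) = D.L.weierstrassP (x + D.ω i) := by
  rw [← D.L.weierstrassP_neg, ← wp_add_mem D.L (D.two_mul_ω_mem i) (-(-x + D.ω i))]
  ring_nf

lemma v_neg (D : HKData) (x : ℂ) : D.v (-x) = D.v x := by
  simp only [v, wp_neg_add_ω, D.L.weierstrassP_neg]
  congr 1
  refine Finset.sum_congr rfl fun k _ => ?_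
  rw [show -x - D.δ k = -(x + D.δ k) by ring, show -x + D.δ k = -(x - D.δ k) by ring,
    D.L.weierstrassP_neg, D.L.weierstrassP_neg, add_comm (D.L.weierstrassP (x + D.δ k))]

lemma v_add (D : HKData) {l : ℂ} (hl : l ∈ D.L.lattice) (x : ℂ) : D.v (x + l) = D.v x := by
  simp only [v, add_right_comm x l, add_sub_right_comm x l, wp_add_mem D.L hl]

lemma analyticAt_wp_add (L : PeriodPair) {x c : ℂ} (h : x + c ∉ L.lattice) :
    AnalyticAt ℂ (fun z => L.weierstrassP (z + c)) x :=
  AnalyticAt.fun_comp (f := fun z => z + c) (analyticAt_wp L h) (by fun_prop)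

lemma inv_wp_sub_b_mem (hδ : ∀ k, 2 * D.δ k ∉ D.L.lattice) {x : ℂ} {k : Fin D.M}
    (h : x - D.δ k ∉ D.L.lattice ∧ x + D.δ k ∉ D.L.lattice) :
    (fun z => (D.L.weierstrassP z - D.b k)⁻¹) ∈ ordGE x 0 := by
  by_cases hx : x ∈ D.L.lattice
  · exact ordGE_mono (by norm_num) (inv_wp_sub_mem D.L hx _)
  · refine AnalyticAt.mem_ordGE (((analyticAt_wp D.L hx).fun_sub analyticAt_const).fun_inv ?_)
    rw [sub_ne_zero, Ne, wp_eq_b_iff hδ hx]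
    tauto

/-- The part of the potential attached to the points `± δ k` is regular elsewhere. -/
lemma v_delta_mem (hδ : ∀ k, 2 * D.δ k ∉ D.L.lattice) {x : ℂ}
    (h : ∀ k, x - D.δ k ∉ D.L.lattice ∧ x + D.δ k ∉ D.L.lattice) :
    (fun x => ∑ k, ((D.r k : ℂ) / 2 * ((D.r k : ℂ) / 2 + 1) *
        (D.L.weierstrassP (x - D.δ k) + D.L.weierstrassP (x + D.δ k))
      + D.s k / (D.L.weierstrassP x - D.b k))) ∈ ordGE x 0 := by
  refine ordGE_sum fun k _ => ordGE_add (ordGE_const_mul _ (ordGE_add ?_ ?_)) ?_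
  · have := analyticAt_wp_add D.L (x := x) (c := -D.δ k) (by simpa [sub_eq_add_neg] using (h k).1)
    simpa [sub_eq_add_neg] using this.mem_ordGE
  · exact (analyticAt_wp_add D.L (h k).2).mem_ordGE
  · simp only [div_eq_mul_inv]
    exact ordGE_const_mul _ (inv_wp_sub_b_mem hδ (h k))

lemma analyticAt_v (hδ : ∀ k, 2 * D.δ k ∉ D.L.lattice) {x : ℂ} (hx : x ∉ D.sing) :
    AnalyticAt ℂ D.v x := by
  obtain ⟨h1, h2⟩ := (notMem_sing_iff hδ).mp hx
  have hl := analyticAt_wp D.L (notMem_lattice_of_notMem_halfLattice h1)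
  have a1 : ∀ i, AnalyticAt ℂ (fun z => D.L.weierstrassP (z + D.ω i)) x := fun i =>
    analyticAt_wp_add D.L fun h => h1 (D.add_ω_mem_halfLattice h)
  have a2 : ∀ k, AnalyticAt ℂ (fun z => D.L.weierstrassP (z + D.δ k)) x := fun k =>
    analyticAt_wp_add D.L fun h => hx (Or.inr ⟨k, Or.inr h⟩)
  have a3 : ∀ k, AnalyticAt ℂ (fun z => D.L.weierstrassP (z - D.δ k)) x := fun k => by
    simpa only [sub_eq_add_neg] using analyticAt_wp_add D.L (x := x) (c := -D.δ k)
      fun h => hx (Or.inr ⟨k, Or.inl (by simpa [sub_eq_add_neg] using h)⟩)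
  unfold v
  refine AnalyticAt.fun_add (Finset.analyticAt_fun_sum _ fun i _ => ?_)
    (Finset.analyticAt_fun_sum _ fun k _ => ?_)
  · exact analyticAt_const.fun_mul (a1 i)
  · exact (analyticAt_const.fun_mul ((a3 k).fun_add (a2 k))).fun_add
      (analyticAt_const.fun_div (hl.fun_sub analyticAt_const) (h2 k))

/-- The principal part of the potential at a half period. -/
lemma v_principal (hδ : ∀ k, 2 * D.δ k ∉ D.L.lattice) {x : ℂ} {i : Fin 4}
    (hx : x - D.ω i ∈ D.L.lattice) :
    (fun z => D.v z - D.E - (D.l i : ℂ) * (D.l i + 1) / (z - x) ^ 2) ∈ ordGE x 0 := by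
  have hi : x + D.ω i ∈ D.L.lattice := by
    have := add_mem hx (D.two_mul_ω_mem i)
    rwa [show x - D.ω i + 2 * D.ω i = x + D.ω i by ring] at this
  have hh : x ∈ D.halfLattice := D.add_ω_mem_halfLattice hi
  have hj : ∀ j ≠ i, x + D.ω j ∉ D.L.lattice := fun j hj h => D.ω_add_ω_notMem hj (by
    have := sub_mem h hx
    rwa [show x + D.ω j - (x - D.ω i) = D.ω j + D.ω i by ring] at this)
  have hk : ∀ k, x - D.δ k ∉ D.L.lattice ∧ x + D.δ k ∉ D.L.lattice := fun k => by
    constructor <;> intro h <;> refine hδ k ?_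
    · have := sub_mem (mem_halfLattice D |>.mp hh) (mem_halfLattice D |>.mp (D.lattice_subset_halfLattice h))
      rwa [show 2 * x - 2 * (x - D.δ k) = 2 * D.δ k by ring] at this
    · have := sub_mem (mem_halfLattice D |>.mp (D.lattice_subset_halfLattice h)) (mem_halfLattice D |>.mp hh)
      rwa [show 2 * (x + D.δ k) - 2 * x = 2 * D.δ k by ring] at this
  have h1 : (fun z => D.L.weierstrassP (z + D.ω i) - 1 / (z - x) ^ 2) ∈ ordGE x 0 := by
    have := ordGE_comp_add (wp_sub_principal D.L hi)
    simpa using this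
  have h2 : (fun z => ∑ j ∈ Finset.univ.erase i, (D.l j : ℂ) * (D.l j + 1) *
      D.L.weierstrassP (z + D.ω j)) ∈ ordGE x 0 := ordGE_sum fun j hj' =>
    ordGE_const_mul _ (analyticAt_wp_add D.L (hj j (Finset.ne_of_mem_erase hj'))).mem_ordGE
  have h3 := ordGE_add (ordGE_add (ordGE_add (ordGE_const_mul ((D.l i : ℂ) * (D.l i + 1)) h1) h2)
    (v_delta_mem hδ hk)) (ordGE_const x (-D.E))
  convert h3 using 1
  ext z
  rw [v, ← Finset.add_sum_erase _ _ (Finset.mem_univ i)]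
  ring

/-- Away from `± δ k` the function `℘ - b k` has either a double pole, at periods, or a nonzero
value, so its square root is locally meromorphic. -/
lemma exists_sqrt_wp_sub_b (hδ : ∀ k, 2 * D.δ k ∉ D.L.lattice) {x₀ : ℂ} {k : Fin D.M}
    (h : x₀ - D.δ k ∉ D.L.lattice ∧ x₀ + D.δ k ∉ D.L.lattice) :
    ∃ ψ : ℂ → ℂ, MeromorphicAt ψ x₀ ∧ ∀ᶠ x in 𝓝 x₀, x ∉ D.sing →
      DifferentiableAt ℂ ψ x ∧ ψ x ^ 2 = D.L.weierstrassP x - D.b k := by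
  by_cases hx : x₀ ∈ D.L.lattice
  · have hm : MeromorphicAt (fun z => D.L.weierstrassP z - D.b k) x₀ :=
      (D.L.meromorphic_weierstrassP x₀).sub (MeromorphicAt.const _ _)
    obtain ⟨g, hg, hg0, hfg⟩ := (meromorphicOrderAt_eq_int_iff hm).mp (order_wp_sub D.L hx (D.b k))
    obtain ⟨s, hs, hsg⟩ := exists_sqrt hg hg0
    refine ⟨fun z => (z - x₀)⁻¹ * s z, by fun_prop, ?_⟩
    filter_upwards [hsg, eventually_nhdsWithin_iff.mp hfg, hs.eventually_analyticAt]
      with x h1 h2 h3 hxS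
    have hne : x ≠ x₀ := fun he => hxS (Or.inl (he ▸ D.lattice_subset_halfLattice hx))
    have hne' := sub_ne_zero.mpr hne
    refine ⟨?_, ?_⟩
    · have := h3.differentiableAt
      fun_prop (disch := assumption)
    · rw [h2 hne, mul_pow, h1, smul_eq_mul, inv_pow]
      norm_cast
  · have h0 : D.L.weierstrassP x₀ - D.b k ≠ 0 := by
      rw [sub_ne_zero, Ne, wp_eq_b_iff hδ hx]; tauto
    obtain ⟨s, hs, hsg⟩ := exists_sqrt (g := fun z => D.L.weierstrassP z - D.b k)
      ((analyticAt_wp D.L hx).fun_sub analyticAt_const) h0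
    refine ⟨s, hs.meromorphicAt, ?_⟩
    filter_upwards [hsg, hs.eventually_analyticAt] with x h1 h2 _ using ⟨h2.differentiableAt, h1⟩

/-- Away from the points `± δ k` there is a local basis of solutions of `H_g`. -/
lemma localBasis_hg (hδ : ∀ k, 2 * D.δ k ∉ D.L.lattice) (hb : Function.Injective D.b) {x₀ : ℂ}
    (h : ∀ k, x₀ - D.δ k ∉ D.L.lattice ∧ x₀ + D.δ k ∉ D.L.lattice) :
    LocalBasis D.hgA D.hgB D.sing x₀ := by
  have hV : LocalBasis 0 (fun x => D.v x - D.E) D.sing x₀ := by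
    by_cases hx : x₀ ∈ D.sing
    · have hh : x₀ ∈ D.halfLattice := by
        rcases hx with hx | ⟨k, hk⟩
        · exact hx
        · have := h k; tauto
      obtain ⟨i, hi⟩ := D.exists_sub_ω_mem hh
      obtain ⟨g, hg, hfg⟩ := exists_analyticAt_of_mem_ordGE (v_principal hδ hi)
      simp only [zpow_zero, one_mul] at hfg
      have hg' : AnalyticAt ℂ (fun t => g (t + x₀)) 0 :=
        AnalyticAt.fun_comp (f := fun t => t + x₀) (by simpa using hg) (by fun_prop)
      have hfg' : ∀ᶠ t in 𝓝[≠] (0 : ℂ), D.v (t + x₀) - D.E -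
          (D.l i : ℂ) * (D.l i + 1) / (t + x₀ - x₀) ^ 2 = g (t + x₀) := by
        have := tendsto_sub_nhdsNE (-x₀) 0
        simp only [sub_neg_eq_add, zero_add] at this
        exact this.eventually hfg
      refine localBasis_frobenius (q := fun t => g (t + x₀)) (l := D.l i) hg' (Or.inr ⟨hx, ?_⟩) ?_
      · have hneg : Tendsto (fun z : ℂ => -z) (𝓝[≠] 0) (𝓝[≠] 0) := by
          refine tendsto_nhdsWithin_iff.mpr ⟨?_, ?_⟩
          · exact (Continuous.tendsto' (by fun_prop) _ _ (by simp)).mono_left nhdsWithin_le_nhds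
          · filter_upwards [self_mem_nhdsWithin] with z hz h
            exact hz (by simpa using h)
        -- Reflection in the half period `x₀` preserves `v`, which is even and has `2 x₀` as a
        -- period.
        have : ∀ᶠ t in 𝓝[≠] (0 : ℂ), g (-t + x₀) = g (t + x₀) := by
          filter_upwards [hfg', hneg.eventually hfg'] with t h1 h2
          rw [← h1, ← h2, ← D.v_neg (-t + x₀), ← D.v_add hh (-(-t + x₀))]
          ring_nf
        filter_upwards [eventually_nhdsWithin_iff.mp this] with t ht
        by_cases h0 : t = 0
        · simp [h0]
        · exact ht h0
      · filter_upwards [eventually_nhdsWithin_iff.mp hfg] with x hx' hxS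
        simp only [sub_add_cancel]
        rw [← hx' fun he => hxS (he ▸ hx)]; ring
    · refine localBasis_frobenius (q := fun t => D.v (t + x₀) - D.E) (l := 0) ?_ (Or.inl rfl) ?_
      · exact (AnalyticAt.fun_comp (f := fun t => t + x₀) (by simpa using analyticAt_v hδ hx)
          (by fun_prop)).fun_sub analyticAt_const
      · exact Eventually.of_forall fun x _ => by simp
  choose ψ hψ1 hψ2 using fun k => exists_sqrt_wp_sub_b hδ (h k)
  refine hV.gauge D.eventually_notMem_sing_nhds (u := D.gauge) (ψ := fun x => ∏ k, ψ k x ^ D.r k)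
    ?_ ?_ (Eventually.of_forall fun x _ => D.hgA_eq x)
    (Eventually.of_forall fun x hx => gauge_identity hδ hb hx)
  · exact MeromorphicAt.fun_prod fun k _ => (hψ1 k).pow _
  · filter_upwards [eventually_all.mpr fun k => (hψ2 k).eventually_nhds] with x hx hxS
    obtain ⟨h1, h2⟩ := (notMem_sing_iff hδ).mp hxS
    have hl := notMem_lattice_of_notMem_halfLattice h1
    constructor
    · refine hasDerivAt_prod_pow Finset.univ D.r fun k _ => ?_
      refine hasDerivAt_of_sq ((hx k).self_of_nhds hxS).1 (G := fun z => D.L.weierstrassP z - D.b k)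
        ?_ ?_ (h2 k)
      · filter_upwards [hx k, D.eventually_notMem_sing_nhds x hxS] with y k1 k2 using (k1 k2).2
      · refine ((hasDerivAt_wp D.L hl).sub_const _).congr_deriv ?_
        have := h2 k
        field_simp
    · refine Finset.prod_ne_zero_iff.mpr fun k _ => pow_ne_zero _ fun h0 => h2 k ?_
      rw [← ((hx k).self_of_nhds hxS).2, h0]; simp

end HKData

end HermiteKrichever

end

/-! ### The Fuchsian equation and solvability at the points `± δ k` -/

noncomputable section
namespace HermiteKrichever
namespace HKData

variable {D : HKData}

/-- The logarithmic derivative of `∏ (℘ - e i) ^ (- l i / 2)`. -/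
def fuchsGauge (D : HKData) (x : ℂ) : ℂ :=
  ∑ i : Fin 3, (D.l i.succ : ℂ) *
    (-D.L.derivWeierstrassP x / (2 * (D.L.weierstrassP x - D.e i.succ)))

lemma hasDerivAt_fuchsGauge {x : ℂ} (hx : x ∉ D.halfLattice) :
    HasDerivAt D.fuchsGauge (∑ i : Fin 3, (D.l i.succ : ℂ) *
      ((-(6 * D.L.weierstrassP x ^ 2 - D.L.g₂ / 2) * (2 * (D.L.weierstrassP x - D.e i.succ)) -
        -D.L.derivWeierstrassP x * (2 * D.L.derivWeierstrassP x)) /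
          (2 * (D.L.weierstrassP x - D.e i.succ)) ^ 2)) x := by
  have hl := notMem_lattice_of_notMem_halfLattice hx
  refine HasDerivAt.fun_sum fun k _ => HasDerivAt.const_mul _ ?_
  exact (hasDerivAt_wp' D.L hl).fun_neg.fun_div (((hasDerivAt_wp D.L hl).sub_const _).const_mul 2)
    (mul_ne_zero two_ne_zero (D.wp_sub_e_ne_zero hx (Fin.succ_ne_zero k)))

/-- For `Λ(x) = φ(x) F(℘(x))` with `φ' / φ` equal to `fuchsGauge`, this compares the coefficients of
`F'` in the Fuchsian equation and in the equation of `H_g`. The powers of `z - b k` in the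
substitution are cancelled by `Ψ_g`, so `φ` involves only the `e i`. -/
lemma fuchsP_identity (hδ : ∀ k, 2 * D.δ k ∉ D.L.lattice) {x : ℂ} (hx : x ∉ D.sing) :
    2 * D.fuchsGauge x * D.L.derivWeierstrassP x + (6 * D.L.weierstrassP x ^ 2 - D.L.g₂ / 2) -
      D.L.derivWeierstrassP x ^ 2 * D.fuchsP (D.L.weierstrassP x) =
      D.hgA x * D.L.derivWeierstrassP x := by
  obtain ⟨h1, h2⟩ := (notMem_sing_iff hδ).mp hx
  have hl := notMem_lattice_of_notMem_halfLattice h1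
  have hY := wp'_sq D.L hl
  have hA : D.hgA x * D.L.derivWeierstrassP x =
      -(D.L.derivWeierstrassP x ^ 2 * ∑ k, -(D.r k : ℂ) / (D.L.weierstrassP x - D.b k)) := by
    rw [hgA, Finset.sum_mul, Finset.mul_sum, ← Finset.sum_neg_distrib]
    exact Finset.sum_congr rfl fun k _ => by ring
  rw [hA, fuchsP, mul_add]
  have e1 := D.wp_sub_e_ne_zero h1 (i := 1) (by decide)
  have e2 := D.wp_sub_e_ne_zero h1 (i := 2) (by decide)
  have e3 := D.wp_sub_e_ne_zero h1 (i := 3) (by decide)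
  obtain ⟨k1, k2, k3⟩ := D.e_sum
  rw [D.cubic_eq] at hY
  have hw : D.fuchsGauge x * D.L.derivWeierstrassP x = D.L.derivWeierstrassP x ^ 2 *
      ∑ i : Fin 3, (D.l i.succ : ℂ) * (-1 / (2 * (D.L.weierstrassP x - D.e i.succ))) := by
    rw [fuchsGauge, Finset.sum_mul, Finset.mul_sum]
    exact Finset.sum_congr rfl fun k _ => by ring
  rw [mul_assoc 2, hw, hY, k2]
  simp only [Fin.sum_univ_three, show (0 : Fin 3).succ = 1 from rfl,
    show (1 : Fin 3).succ = 2 from rfl, show (2 : Fin 3).succ = 3 from rfl]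
  have k1' : D.e 3 = -D.e 1 - D.e 2 := by linear_combination k1
  generalize D.L.weierstrassP x = X at *
  generalize ∑ k, -(D.r k : ℂ) / (X - D.b k) = T
  rw [k1'] at e3 ⊢
  generalize D.e 1 = a at *
  generalize D.e 2 = b at *
  field_simp
  ring

/-- The comparison of the coefficients of `F` itself under the same substitution. The part attached
to the `b k` and the part attached to the `e i` are verified separately; they account for the
accessory parameters `o` and `p`. -/
lemma fuchsQ_identity (hδ : ∀ k, 2 * D.δ k ∉ D.L.lattice) {x : ℂ} (hx : x ∉ D.sing) :
    ∃ w', HasDerivAt D.fuchsGauge w' x ∧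
    w' + D.fuchsGauge x ^ 2 - D.L.derivWeierstrassP x ^ 2 * D.fuchsQ (D.L.weierstrassP x) =
      D.hgA x * D.fuchsGauge x + D.hgB x := by
  obtain ⟨h1, h2⟩ := (notMem_sing_iff hδ).mp hx
  have hl := notMem_lattice_of_notMem_halfLattice h1
  refine ⟨_, hasDerivAt_fuchsGauge h1, ?_⟩
  have hY := wp'_sq D.L hl
  rw [D.cubic_eq] at hY
  have hω : ∀ i : Fin 3, D.L.weierstrassP (x + D.ω i.succ) = _ := fun i =>
    D.wp_add_ω h1 (Fin.succ_ne_zero i)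
  have e1 := D.wp_sub_e_ne_zero h1 (i := 1) (by decide)
  have e2 := D.wp_sub_e_ne_zero h1 (i := 2) (by decide)
  have e3 := D.wp_sub_e_ne_zero h1 (i := 3) (by decide)
  obtain ⟨k1, k2, k3⟩ := D.e_sum
  have k1' : D.e 3 = -D.e 1 - D.e 2 := by linear_combination k1
  have hR : (D.R : ℂ) = ∑ k, (D.r k : ℂ) := by simp [R]
  set X := D.L.weierstrassP x with hX
  set Y := D.L.derivWeierstrassP x with hYd
  have hAw : D.hgA x * D.fuchsGauge x = -∑ k, (1 / 2 : ℂ) * D.r k * Y ^ 2 / (X - D.b k) *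
      (D.l 1 / (X - D.e 1) + D.l 2 / (X - D.e 2) + D.l 3 / (X - D.e 3)) := by
    rw [hgA, Finset.sum_mul, ← Finset.sum_neg_distrib]
    refine Finset.sum_congr rfl fun k _ => ?_
    rw [fuchsGauge]
    simp only [Fin.sum_univ_three, show (0 : Fin 3).succ = 1 from rfl, ← hX, ← hYd,
      show (1 : Fin 3).succ = 2 from rfl, show (2 : Fin 3).succ = 3 from rfl, ← div_div]
    ring
  have hQ : Y ^ 2 * D.fuchsQ X =
      D.N * (D.N - 2 * D.l 0 - 1) * X + D.p + ∑ k, D.o k / (X - D.b k) := by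
    rw [fuchsQ, hY, mul_div_cancel₀]
    exact mul_ne_zero (mul_ne_zero (mul_ne_zero (by norm_num) e1) e2) e3
  have keyk : (∑ k, (1 / 2 : ℂ) * D.r k * Y ^ 2 / (X - D.b k) *
      (D.l 1 / (X - D.e 1) + D.l 2 / (X - D.e 2) + D.l 3 / (X - D.e 3))) -
      (∑ k, D.o k / (X - D.b k)) - ∑ k, D.st k / (X - D.b k) =
      2 * (∑ k, ∑ i : Fin 3, D.l i.succ * D.r k * (D.e i.succ + D.b k)) +
        2 * X * (D.l 1 + D.l 2 + D.l 3) * ∑ k, (D.r k : ℂ) := by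
    rw [← Finset.sum_sub_distrib, ← Finset.sum_sub_distrib, Finset.mul_sum, Finset.mul_sum,
      ← Finset.sum_add_distrib]
    refine Finset.sum_congr rfl fun k _ => ?_
    have h3 := h2 k
    rw [o, st, hY]
    generalize ∑ m ∈ Finset.univ.erase k, (D.r m : ℂ) / (D.b k - D.b m) = S
    simp only [Fin.sum_univ_three, show (0 : Fin 3).succ = 1 from rfl,
      show (1 : Fin 3).succ = 2 from rfl, show (2 : Fin 3).succ = 3 from rfl]
    rw [k1'] at e3 ⊢
    field_simp
    ring
  have key0 : (∑ i : Fin 3, (D.l i.succ : ℂ) * ((-(6 * X ^ 2 - D.L.g₂ / 2) * (2 * (X - D.e i.succ)) -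
        -Y * (2 * Y)) / (2 * (X - D.e i.succ)) ^ 2)) + D.fuchsGauge x ^ 2 -
      (∑ i : Fin 3, (D.l i.succ : ℂ) * (D.l i.succ + 1) * D.L.weierstrassP (x + D.ω i.succ)) =
      ((D.l 1 + D.l 2 + D.l 3) ^ 2 - (D.l 1 + D.l 2 + D.l 3)) * X +
        (D.e 1 * D.l 1 ^ 2 + D.e 2 * D.l 2 ^ 2 + D.e 3 * D.l 3 ^ 2)
        - 2 * (D.l 1 * D.l 2 * D.e 3 + D.l 2 * D.l 3 * D.e 1 + D.l 3 * D.l 1 * D.e 2) := by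
    have hw : D.fuchsGauge x ^ 2 = Y ^ 2 * (1 / 4 *
        (D.l 1 / (X - D.e 1) + D.l 2 / (X - D.e 2) + D.l 3 / (X - D.e 3)) ^ 2) := by
      rw [fuchsGauge]
      simp only [Fin.sum_univ_three, show (0 : Fin 3).succ = 1 from rfl, ← hX, ← hYd,
        show (1 : Fin 3).succ = 2 from rfl, show (2 : Fin 3).succ = 3 from rfl, ← div_div]
      ring
    simp only [hω]
    rw [hw, show -Y * (2 * Y) = -2 * Y ^ 2 by ring, hY, k2]
    simp only [Fin.sum_univ_three, show (0 : Fin 3).succ = 1 from rfl,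
      show (1 : Fin 3).succ = 2 from rfl, show (2 : Fin 3).succ = 3 from rfl]
    rw [k1'] at e3 ⊢
    generalize X = X at *
    generalize D.e 1 = a at *
    generalize D.e 2 = b at *
    field_simp
    ring
  have hN : D.N = D.l 0 + D.l 1 + D.l 2 + D.l 3 + ∑ k, (D.r k : ℂ) := by
    rw [N, Fin.sum_univ_four]
  rw [hAw, hQ, hgB, hgW, ← hX, hR, hN, p, Cg]
  linear_combination key0 + keyk

lemma exists_fuchs_gauge {x₀ : ℂ} (hx₀ : x₀ ∉ D.halfLattice) : ∃ φ : ℂ → ℂ, AnalyticAt ℂ φ x₀ ∧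
    ∀ᶠ x in 𝓝 x₀, HasDerivAt φ (D.fuchsGauge x * φ x) x ∧ φ x ≠ 0 ∧ x ∉ D.halfLattice := by
  have hl := notMem_lattice_of_notMem_halfLattice hx₀
  have hopen : ∀ᶠ x in 𝓝 x₀, x ∉ D.halfLattice := by
    have h2 : ContinuousAt (fun x : ℂ => 2 * x) x₀ := by fun_prop
    exact h2 (D.L.isClosed_lattice.isOpen_compl.mem_nhds hx₀)
  choose ψ hψ1 hψ2 using fun i : Fin 3 => exists_sqrt
    (g := fun z => (D.L.weierstrassP z - D.e i.succ)⁻¹) (x₀ := x₀)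
    (((analyticAt_wp D.L hl).fun_sub analyticAt_const).fun_inv
      (D.wp_sub_e_ne_zero hx₀ (Fin.succ_ne_zero i)))
    (inv_ne_zero (D.wp_sub_e_ne_zero hx₀ (Fin.succ_ne_zero i)))
  refine ⟨fun x => ∏ i, ψ i x ^ D.l i.succ, Finset.analyticAt_fun_prod _ fun i _ => (hψ1 i).pow _, ?_⟩
  filter_upwards [eventually_all.mpr fun i => (hψ2 i).eventually_nhds, hopen,
    eventually_all.mpr fun i => (hψ1 i).eventually_analyticAt] with x h1 h2 h3
  have hl := notMem_lattice_of_notMem_halfLattice h2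
  have hne : ∀ i : Fin 3, D.L.weierstrassP x - D.e i.succ ≠ 0 := fun i =>
    D.wp_sub_e_ne_zero h2 (Fin.succ_ne_zero i)
  refine ⟨?_, ?_, h2⟩
  · refine hasDerivAt_prod_pow Finset.univ (fun i : Fin 3 => D.l i.succ) fun i _ => ?_
    refine hasDerivAt_of_sq (h3 i).differentiableAt (h1 i) ?_ (inv_ne_zero (hne i))
    refine (((hasDerivAt_wp D.L hl).sub_const _).fun_inv (hne i)).congr_deriv ?_
    have := hne i
    field_simp
  · refine Finset.prod_ne_zero_iff.mpr fun i _ => pow_ne_zero _ fun h0 => inv_ne_zero (hne i) ?_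
    rw [← (h1 i).self_of_nhds, h0]; simp

/-- Solvability near the points `± δ k`, from the absence of logarithmic solutions. -/
lemma exists_fullOn_delta (hδ : ∀ k, 2 * D.δ k ∉ D.L.lattice) {k : Fin D.M}
    (hlog : NoLogarithmicSolution D.fuchsP D.fuchsQ (D.b k)) {x₀ : ℂ} (hx₀ : x₀ ∉ D.halfLattice)
    (hb : D.L.weierstrassP x₀ = D.b k) :
    ∃ ρ > 0, FullOn D.hgA D.hgB D.sing (Metric.ball x₀ ρ) := by
  obtain ⟨ρ, hρ, hlog⟩ := hlog
  obtain ⟨φ, hφ, hφ'⟩ := exists_fuchs_gauge hx₀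
  have hl := notMem_lattice_of_notMem_halfLattice hx₀
  have hball : ∀ᶠ x in 𝓝 x₀, D.L.weierstrassP x ∈ Metric.ball (D.b k) ρ :=
    (analyticAt_wp D.L hl).continuousAt (by rw [hb]; exact Metric.ball_mem_nhds _ hρ)
  obtain ⟨ε, hε, hev⟩ := Metric.eventually_nhds_iff_ball.mp ((hφ'.and hball).and
    (eventually_nhdsWithin_iff.mp (D.eventually_notMem_sing x₀)))
  refine ⟨ε, hε, fun x₁ hx₁ hx₁S c₀ c₁ => ?_⟩
  set P := D.fuchsP
  set Q := D.fuchsQ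
  have hmem : ∀ x ∈ Metric.ball x₀ ε, x ∉ D.sing →
      D.L.weierstrassP x ∈ Metric.ball (D.b k) ρ \ {D.b k} := fun x hx hxS =>
    ⟨(hev x hx).1.2, fun h => ((notMem_sing_iff hδ).mp hxS).2 k (sub_eq_zero.mpr h)⟩
  have hY1 : D.L.derivWeierstrassP x₁ ≠ 0 := wp'_ne_zero D.L (hev x₁ hx₁).1.1.2.2
  have hφ1 := (hev x₁ hx₁).1.1.2.1
  -- The initial data are those that the product and chain rules turn into `c₀`, `c₁` for `φ * f ∘
  -- ℘`; this needs `℘' x₁ ≠ 0`.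
  obtain ⟨f, hf, hfm, hf0, hf1⟩ := hlog _ (hmem x₁ hx₁ hx₁S) (c₀ / φ x₁)
    ((c₁ - D.fuchsGauge x₁ * c₀) / (φ x₁ * D.L.derivWeierstrassP x₁))
  have hopen : IsOpen (Metric.ball (D.b k) ρ \ {D.b k}) :=
    Metric.isOpen_ball.sdiff isClosed_singleton
  have hfan : ∀ x ∈ Metric.ball x₀ ε, x ∉ D.sing → AnalyticAt ℂ f (D.L.weierstrassP x) :=
    fun x hx hxS => hf.1.analyticAt (hopen.mem_nhds (hmem x hx hxS))
  have hl' : ∀ x ∈ Metric.ball x₀ ε, x ∉ D.L.lattice := fun x hx =>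
    notMem_lattice_of_notMem_halfLattice (hev x hx).1.1.2.2
  have hφan : ∀ x ∈ Metric.ball x₀ ε, AnalyticAt ℂ φ x := fun x hx => by
    refine DifferentiableOn.analyticAt (s := Metric.ball x₀ ε) (fun y hy => ?_)
      (Metric.isOpen_ball.mem_nhds hx)
    exact (hev y hy).1.1.1.differentiableAt.differentiableWithinAt
  have han : ∀ x ∈ Metric.ball x₀ ε, x ∉ D.sing →
      AnalyticAt ℂ (fun z => φ z * f (D.L.weierstrassP z)) x := fun x hx hxS =>
    (hφan x hx).fun_mul (AnalyticAt.fun_comp (f := D.L.weierstrassP) (hfan x hx hxS)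
      (analyticAt_wp D.L (hl' x hx)))
  have hcomp : ∀ g : ℂ → ℂ, ∀ x ∈ Metric.ball x₀ ε, AnalyticAt ℂ g (D.L.weierstrassP x) →
      HasDerivAt (fun z => g (D.L.weierstrassP z))
        (deriv g (D.L.weierstrassP x) * D.L.derivWeierstrassP x) x := fun g x hx hg =>
    HasDerivAt.comp (h₂ := g) x hg.differentiableAt.hasDerivAt (hasDerivAt_wp D.L (hl' x hx))
  have hd1 : ∀ x ∈ Metric.ball x₀ ε, x ∉ D.sing →
      HasDerivAt (fun z => φ z * f (D.L.weierstrassP z))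
        (D.fuchsGauge x * φ x * f (D.L.weierstrassP x) +
          φ x * (deriv f (D.L.weierstrassP x) * D.L.derivWeierstrassP x)) x := fun x hx hxS =>
    (hev x hx).1.1.1.fun_mul (hcomp f x hx (hfan x hx hxS))
  refine ⟨fun z => φ z * f (D.L.weierstrassP z), ⟨fun x hx => ?_, han, fun x hx hxS => ?_⟩, ?_, ?_⟩
  · by_cases hxS : x ∈ D.sing
    · obtain rfl : x = x₀ := by
        by_contra hne
        exact (hev x hx).2 hne hxS
      have : MeromorphicAt (f ∘ D.L.weierstrassP) x :=
        MeromorphicAt.comp_analyticAt (by rwa [hb]) (analyticAt_wp D.L hl)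
      exact hφ.meromorphicAt.mul this
    · exact (han x hx hxS).meromorphicAt
  · have e : deriv (fun z => φ z * f (D.L.weierstrassP z)) =ᶠ[𝓝 x] fun x =>
        D.fuchsGauge x * φ x * f (D.L.weierstrassP x) +
          φ x * (deriv f (D.L.weierstrassP x) * D.L.derivWeierstrassP x) := by
      filter_upwards [Metric.isOpen_ball.mem_nhds hx, D.eventually_notMem_sing_nhds x hxS]
        with y hy hyS using (hd1 y hy hyS).deriv
    obtain ⟨w', hw', hQ⟩ := fuchsQ_identity hδ hxS
    have hP := fuchsP_identity hδ hxS
    have hode := hf.2 _ (hmem x hx hxS)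
    have hφx := (hev x hx).1.1.1
    rw [e.deriv_eq, e.eq_of_nhds, (((hw'.fun_mul hφx).fun_mul (hcomp f x hx (hfan x hx hxS))).fun_add
      (hφx.fun_mul ((hcomp (deriv f) x hx (hfan x hx hxS).deriv).fun_mul
        (hasDerivAt_wp' D.L (hl' x hx))))).deriv]
    linear_combination φ x * f (D.L.weierstrassP x) * hQ +
      φ x * deriv f (D.L.weierstrassP x) * hP + φ x * D.L.derivWeierstrassP x ^ 2 * hode
  · simp only [hf0]; field_simp
  · rw [(hd1 x₁ hx₁ hx₁S).deriv, hf0, hf1]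
    field_simp
    ring

lemma analyticAt_hgA (hδ : ∀ k, 2 * D.δ k ∉ D.L.lattice) {x : ℂ} (hx : x ∉ D.sing) :
    AnalyticAt ℂ D.hgA x := by
  obtain ⟨h1, h2⟩ := (notMem_sing_iff hδ).mp hx
  have hl := notMem_lattice_of_notMem_halfLattice h1
  exact Finset.analyticAt_fun_sum _ fun k _ => (analyticAt_const.fun_mul (analyticAt_wp' D.L hl)).fun_div
    ((analyticAt_wp D.L hl).fun_sub analyticAt_const) (h2 k)

lemma analyticAt_hgB (hδ : ∀ k, 2 * D.δ k ∉ D.L.lattice) {x : ℂ} (hx : x ∉ D.sing) :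
    AnalyticAt ℂ D.hgB x := by
  obtain ⟨h1, h2⟩ := (notMem_sing_iff hδ).mp hx
  have hl := analyticAt_wp D.L (notMem_lattice_of_notMem_halfLattice h1)
  refine AnalyticAt.fun_sub (((analyticAt_const.fun_mul hl).fun_add
    (Finset.analyticAt_fun_sum _ fun i _ => analyticAt_const.fun_mul
      (analyticAt_wp_add D.L fun h => h1 (D.add_ω_mem_halfLattice h)))).fun_add
    (Finset.analyticAt_fun_sum _ fun k _ => ?_)) analyticAt_const
  exact analyticAt_const.fun_div (hl.fun_sub analyticAt_const) (h2 k)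

/-- All initial value problems for `H_g` have meromorphic solutions on the plane. -/
lemma fullOn_hg (hδ : ∀ k, 2 * D.δ k ∉ D.L.lattice) (hb : Function.Injective D.b)
    (hlog : ∀ k, NoLogarithmicSolution D.fuchsP D.fuchsQ (D.b k)) :
    FullOn D.hgA D.hgB D.sing Set.univ := by
  refine fullOn_univ D.eventually_notMem_sing D.eventually_notMem_sing_nhds
    (fun x hx => analyticAt_hgA hδ hx) (fun x hx => analyticAt_hgB hδ hx) fun x => ?_
  by_cases h : ∀ k, x - D.δ k ∉ D.L.lattice ∧ x + D.δ k ∉ D.L.lattice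
  · exact (localBasis_hg hδ hb h).fullOn (D.eventually_notMem_sing x)
  · push Not at h
    obtain ⟨k, hk⟩ := h
    have hk' : x - D.δ k ∈ D.L.lattice ∨ x + D.δ k ∈ D.L.lattice := by tauto
    have hx : x ∉ D.halfLattice := by
      intro hx
      refine hδ k ?_
      rcases hk' with h | h
      · have := sub_mem (mem_halfLattice D |>.mp hx)
          (mem_halfLattice D |>.mp (D.lattice_subset_halfLattice h))
        rwa [show 2 * x - 2 * (x - D.δ k) = 2 * D.δ k by ring] at this
      · have := sub_mem (mem_halfLattice D |>.mp (D.lattice_subset_halfLattice h))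
          (mem_halfLattice D |>.mp hx)
        rwa [show 2 * (x + D.δ k) - 2 * x = 2 * D.δ k by ring] at this
    exact exists_fullOn_delta hδ (hlog k) hx
      ((wp_eq_b_iff hδ (notMem_lattice_of_notMem_halfLattice hx) k).mpr hk')

end HKData
end HermiteKrichever

end

/-! ### Exponents of `H_g` -/

noncomputable section
namespace HermiteKrichever

lemma tendsto_zero_of_mem_ordGE_one {x : ℂ} {f : ℂ → ℂ} (hf : f ∈ ordGE x 1) :
    Tendsto f (𝓝[≠] x) (𝓝 0) :=
  (tendsto_zero_iff_meromorphicOrderAt_pos hf.1).mpr (lt_of_lt_of_le (by decide) hf.2)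

/-- The logarithmic derivative has a simple pole with residue the order. -/
lemma tendsto_mul_logDeriv {f : ℂ → ℂ} {x : ℂ} {n : ℤ} (hf : MeromorphicAt f x)
    (hn : meromorphicOrderAt f x = n) :
    Tendsto (fun z => (z - x) * (deriv f z / f z)) (𝓝[≠] x) (𝓝 n) := by
  obtain ⟨g, hg, hg0, hfg⟩ := (meromorphicOrderAt_eq_int_iff hf).mp hn
  have c0 := hg.continuousAt
  have c1 := hg.deriv.continuousAt
  have l1 : Tendsto (fun z => (n * g z + (z - x) * deriv g z) / g z) (𝓝[≠] x) (𝓝 n) := by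
    have : ContinuousAt (fun z => (n * g z + (z - x) * deriv g z) / g z) x :=
      ContinuousAt.div (by fun_prop) c0 hg0
    refine (this.tendsto.mono_left nhdsWithin_le_nhds).trans (le_of_eq ?_)
    simp [hg0]
  refine l1.congr' ?_
  filter_upwards [EventuallyEq.nhdsNE_deriv hfg, hfg, self_mem_nhdsWithin,
    nhdsWithin_le_nhds hg.eventually_analyticAt, nhdsWithin_le_nhds (c0.eventually_ne hg0)]
    with z h1 h2 hz h3 h4
  have h0 : z - x ≠ 0 := sub_ne_zero.mpr hz
  have hd := (HasDerivAt.comp (h₂ := fun y : ℂ => y ^ n) z (hasDerivAt_zpow n (z - x) (Or.inl h0))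
    ((hasDerivAt_id z).sub_const x)).fun_mul h3.differentiableAt.hasDerivAt
  simp only [Function.comp_def, id] at hd
  simp only [smul_eq_mul] at h1 h2
  rw [h1, h2, hd.deriv, zpow_sub_one₀ h0]
  have := zpow_ne_zero n h0
  field_simp

namespace HKData

variable {D : HKData}

lemma sum_wp_principal (c : Fin 4 → ℂ) {x : ℂ} {i : Fin 4} (hx : x - D.ω i ∈ D.L.lattice) :
    (fun z => ∑ j, c j * D.L.weierstrassP (z + D.ω j) - c i / (z - x) ^ 2) ∈ ordGE x 0 := by
  have hi : x + D.ω i ∈ D.L.lattice := by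
    have := add_mem hx (D.two_mul_ω_mem i)
    rwa [show x - D.ω i + 2 * D.ω i = x + D.ω i by ring] at this
  have hj : ∀ j ≠ i, x + D.ω j ∉ D.L.lattice := fun j hj h => D.ω_add_ω_notMem hj (by
    have := sub_mem h hx
    rwa [show x + D.ω j - (x - D.ω i) = D.ω j + D.ω i by ring] at this)
  have h1 : (fun z => D.L.weierstrassP (z + D.ω i) - 1 / (z - x) ^ 2) ∈ ordGE x 0 := by
    have := ordGE_comp_add (wp_sub_principal D.L hi)
    simpa using this
  have h2 : (fun z => ∑ j ∈ Finset.univ.erase i, c j * D.L.weierstrassP (z + D.ω j)) ∈ ordGE x 0 :=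
    ordGE_sum fun j hj' =>
      ordGE_const_mul _ (analyticAt_wp_add D.L (hj j (Finset.ne_of_mem_erase hj'))).mem_ordGE
  convert ordGE_add (ordGE_const_mul (c i) h1) h2 using 1
  ext z
  rw [← Finset.add_sum_erase _ _ (Finset.mem_univ i)]
  ring

lemma notMem_delta_of_mem_halfLattice (hδ : ∀ k, 2 * D.δ k ∉ D.L.lattice) {x : ℂ}
    (hx : x ∈ D.halfLattice) (k : Fin D.M) :
    x - D.δ k ∉ D.L.lattice ∧ x + D.δ k ∉ D.L.lattice := by
  constructor <;> intro h <;> refine hδ k ?_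
  · have := sub_mem (mem_halfLattice D |>.mp hx)
      (mem_halfLattice D |>.mp (D.lattice_subset_halfLattice h))
    rwa [show 2 * x - 2 * (x - D.δ k) = 2 * D.δ k by ring] at this
  · have := sub_mem (mem_halfLattice D |>.mp (D.lattice_subset_halfLattice h))
      (mem_halfLattice D |>.mp hx)
    rwa [show 2 * (x + D.δ k) - 2 * x = 2 * D.δ k by ring] at this

/-- The order of `℘ - b k`. -/
lemma order_wp_sub_b_of_notMem {x : ℂ} (hx : x ∉ D.L.lattice)
    {k : Fin D.M} (h : D.L.weierstrassP x ≠ D.b k) :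
    meromorphicOrderAt (fun z => D.L.weierstrassP z - D.b k) x = ((0 : ℤ) : WithTop ℤ) := by
  have han : AnalyticAt ℂ (fun z => D.L.weierstrassP z - D.b k) x :=
    (analyticAt_wp D.L hx).fun_sub analyticAt_const
  rw [meromorphicOrderAt_eq_int_iff han.meromorphicAt]
  exact ⟨_, han, sub_ne_zero.mpr h, by simp⟩

lemma order_wp_sub_b_delta {x : ℂ} (hx : x ∉ D.halfLattice) {k : Fin D.M}
    (h : D.L.weierstrassP x = D.b k) :
    meromorphicOrderAt (fun z => D.L.weierstrassP z - D.b k) x = ((1 : ℤ) : WithTop ℤ) := by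
  have hl := notMem_lattice_of_notMem_halfLattice hx
  have han : AnalyticAt ℂ (fun z => D.L.weierstrassP z - D.b k) x :=
    (analyticAt_wp D.L hl).fun_sub analyticAt_const
  refine order_eq_of_tendsto han.meromorphicAt (wp'_ne_zero D.L hx) ?_
  have := hasDerivAt_iff_tendsto_slope.mp (hasDerivAt_wp D.L hl)
  refine this.congr fun z => ?_
  rw [slope_def_field, ← h, div_eq_mul_inv, mul_comm]
  simp

lemma meromorphicAt_wp_sub (L : PeriodPair) (c x : ℂ) :
    MeromorphicAt (fun z => L.weierstrassP z - c) x :=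
  (L.meromorphic_weierstrassP x).sub (MeromorphicAt.const _ _)

/-- The coefficient `A` is the logarithmic derivative of `∏ (℘ - b k) ^ r k`, so its residue is the
order of that product. -/
lemma tendsto_mul_hgA {x : ℂ} (n : Fin D.M → ℤ)
    (hn : ∀ k, meromorphicOrderAt (fun z => D.L.weierstrassP z - D.b k) x = (n k : WithTop ℤ)) :
    Tendsto (fun z => (z - x) * D.hgA z) (𝓝[≠] x) (𝓝 (∑ k, (D.r k : ℂ) * n k)) := by
  have h := tendsto_finsetSum Finset.univ fun k _ =>
    (tendsto_mul_logDeriv (meromorphicAt_wp_sub D.L (D.b k) x) (hn k)).const_mul (D.r k : ℂ)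
  refine h.congr fun z => ?_
  rw [hgA, Finset.mul_sum]
  refine Finset.sum_congr rfl fun k _ => ?_
  rw [deriv_sub_const, D.L.deriv_weierstrassP]
  ring

/-- The coefficients of `℘ (x + ω i)` in `H_g`. -/
def hgCoeff (D : HKData) : Fin 4 → ℂ :=
  Fin.cons (((D.l 0 : ℂ) + D.R) * ((D.l 0 : ℂ) + 1 - D.R))
    fun i : Fin 3 => (D.l i.succ : ℂ) * (D.l i.succ + 1)

lemma hgB_eq (D : HKData) (x : ℂ) : D.hgB x = ∑ i, D.hgCoeff i * D.L.weierstrassP (x + D.ω i) +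
    ∑ k, D.st k * (D.L.weierstrassP x - D.b k)⁻¹ + -(D.E + D.Cg) := by
  rw [hgB, hgW, Fin.sum_univ_succ (n := 3), ω_zero, add_zero]
  simp only [hgCoeff, Fin.cons_zero, Fin.cons_succ, div_eq_mul_inv]
  ring

lemma tendsto_sq_mul_of_sub_mem {f : ℂ → ℂ} {x c : ℂ}
    (h : (fun z => f z - c / (z - x) ^ 2) ∈ ordGE x 0) :
    Tendsto (fun z => (z - x) ^ 2 * f z) (𝓝[≠] x) (𝓝 c) := by
  obtain ⟨a, ha⟩ := tendsto_of_mem_ordGE_zero h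
  have hz : Tendsto (fun z => (z - x) ^ 2) (𝓝[≠] x) (𝓝 0) :=
    (Continuous.tendsto' (by fun_prop) _ _ (by simp)).mono_left nhdsWithin_le_nhds
  have := (hz.mul ha).add_const c
  rw [zero_mul, zero_add] at this
  refine this.congr' ?_
  filter_upwards [self_mem_nhdsWithin] with z hzx
  have : z - x ≠ 0 := sub_ne_zero.mpr hzx
  field_simp
  ring

lemma hgB_principal (hδ : ∀ k, 2 * D.δ k ∉ D.L.lattice) {x : ℂ} {i : Fin 4}
    (hx : x - D.ω i ∈ D.L.lattice) :
    (fun z => D.hgB z - D.hgCoeff i / (z - x) ^ 2) ∈ ordGE x 0 := by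
  have hh : x ∈ D.halfLattice := by
    have := add_mem hx (D.two_mul_ω_mem i)
    rw [show x - D.ω i + 2 * D.ω i = x + D.ω i by ring] at this
    exact D.add_ω_mem_halfLattice this
  have h3 : (fun z => ∑ k, D.st k * (D.L.weierstrassP z - D.b k)⁻¹) ∈ ordGE x 0 :=
    ordGE_sum fun k _ => ordGE_const_mul _
      (inv_wp_sub_b_mem hδ (notMem_delta_of_mem_halfLattice hδ hh k))
  convert ordGE_add (ordGE_add (sum_wp_principal D.hgCoeff hx) h3) (ordGE_const x (-(D.E + D.Cg)))
    using 1
  ext z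
  rw [hgB_eq]; ring

/-- Meromorphic solutions of `H_g` on the plane. -/
abbrev Sol (D : HKData) (f : ℂ → ℂ) : Prop := IsSol D.hgA D.hgB D.sing Set.univ f

lemma Sol.eventually_ode {f : ℂ → ℂ} (hf : D.Sol f) (x : ℂ) :
    ∀ᶠ z in 𝓝[≠] x, deriv (deriv f) z = D.hgA z * deriv f z + D.hgB z * f z := by
  filter_upwards [D.eventually_notMem_sing x] with z hz using hf.eq z (Set.mem_univ z) hz

/-- The order of a solution is infinite or an integer root of the indicial equation, so a lower
bound for the integer roots suffices. -/
lemma Sol.mem_ordGE_of_indicial {f : ℂ → ℂ} (hf : D.Sol f) {x a b : ℂ} {m : ℤ}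
    (ha : Tendsto (fun z => (z - x) * D.hgA z) (𝓝[≠] x) (𝓝 a))
    (hb : Tendsto (fun z => (z - x) ^ 2 * D.hgB z) (𝓝[≠] x) (𝓝 b))
    (h : ∀ n : ℤ, (n : ℂ) * (n - 1) = a * n + b → m ≤ n) : f ∈ ordGE x m := by
  refine ⟨hf.mero x (Set.mem_univ x), ?_⟩
  cases ho : meromorphicOrderAt f x with
  | top => exact le_top
  | coe n =>
    exact_mod_cast h n (indicial (hf.mero x (Set.mem_univ x)) ho (hf.eventually_ode x) ha hb)

lemma Sol.mem_ordGE_half (hδ : ∀ k, 2 * D.δ k ∉ D.L.lattice) {f : ℂ → ℂ} (hf : D.Sol f) {x : ℂ}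
    {i : Fin 4} (hx : x - D.ω i ∈ D.L.lattice) : f ∈ ordGE x (-(D.lt i : ℤ)) := by
  have hB := tendsto_sq_mul_of_sub_mem (hgB_principal hδ hx)
  have hR : (D.R : ℂ) = ∑ k, (D.r k : ℂ) := by simp [R]
  have hh : x ∈ D.halfLattice := by
    have := add_mem hx (D.two_mul_ω_mem i)
    rw [show x - D.ω i + 2 * D.ω i = x + D.ω i by ring] at this
    exact D.add_ω_mem_halfLattice this
  have hk := notMem_delta_of_mem_halfLattice hδ hh
  induction i using Fin.cases with
  | zero =>
    have hxL : x ∈ D.L.lattice := by simpa [ω_zero] using hx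
    have hA := tendsto_mul_hgA (fun _ => -2) fun k => order_wp_sub D.L hxL (D.b k)
    refine hf.mem_ordGE_of_indicial hA hB fun n hn => ?_
    rw [← Finset.sum_mul, ← hR] at hn
    simp only [hgCoeff, Fin.cons_zero] at hn
    -- The exponents at a period are `-(l 0 + R)` and `l 0 + 1 - R`; at the other half periods they
    -- are `-l i` and `l i + 1`.
    have h2 : ((n : ℂ) + D.l 0 + D.R) * (n + D.R - D.l 0 - 1) = 0 := by
      push_cast at hn
      linear_combination hn
    have hlt : D.lt 0 = D.l 0 + D.R := rfl
    rw [hlt]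
    rcases mul_eq_zero.mp h2 with h | h
    · have : n + D.l 0 + D.R = 0 := by exact_mod_cast h
      push_cast; omega
    · have : n + D.R - D.l 0 - 1 = 0 := by exact_mod_cast h
      push_cast; omega
  | succ i =>
    have hxL : x ∉ D.L.lattice := fun h => D.ω_notMem (Fin.succ_ne_zero i) (by
      have := sub_mem h hx
      rwa [sub_sub_cancel] at this)
    have hA := tendsto_mul_hgA (fun _ => 0) fun k => order_wp_sub_b_of_notMem hxL (k := k) (by
      rw [Ne, wp_eq_b_iff hδ hxL]
      have := hk k
      tauto)
    refine hf.mem_ordGE_of_indicial hA hB fun n hn => ?_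
    have h2 : ((n : ℂ) + D.l i.succ) * (n - D.l i.succ - 1) = 0 := by
      simp only [hgCoeff, Fin.cons_succ, Int.cast_zero, mul_zero, Finset.sum_const_zero] at hn
      linear_combination hn
    have hlt : D.lt i.succ = D.l i.succ := by fin_cases i <;> rfl
    rw [hlt]
    rcases mul_eq_zero.mp h2 with h | h
    · have : n + D.l i.succ = 0 := by exact_mod_cast h
      omega
    · have : n - D.l i.succ - 1 = 0 := by exact_mod_cast h
      omega

/-- At `± δ k` the residue of `A` is `r k` and `B` has at most a simple pole, so the exponents are
`0` and `r k + 1`, both nonnegative. This is the gain of passing from `H` to `H_g`. -/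
lemma Sol.mem_ordGE_zero (hδ : ∀ k, 2 * D.δ k ∉ D.L.lattice) (hb : Function.Injective D.b)
    {f : ℂ → ℂ} (hf : D.Sol f) {x : ℂ} (hx : x ∉ D.halfLattice) : f ∈ ordGE x 0 := by
  by_cases hxS : x ∈ D.sing
  swap
  · exact (hf.an x (Set.mem_univ x) hxS).mem_ordGE
  have hl := notMem_lattice_of_notMem_halfLattice hx
  obtain ⟨k, hk⟩ := hxS.resolve_left hx
  rw [← wp_eq_b_iff hδ hl] at hk
  have hord : ∀ m, meromorphicOrderAt (fun z => D.L.weierstrassP z - D.b m) x =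
      ((if m = k then 1 else 0 : ℤ) : WithTop ℤ) := fun m => by
    split_ifs with h
    · exact order_wp_sub_b_delta hx (h ▸ hk)
    · exact order_wp_sub_b_of_notMem hl fun h' => h (hb (h'.symm.trans hk))
  have hA := tendsto_mul_hgA _ hord
  have hB : Tendsto (fun z => (z - x) ^ 2 * D.hgB z) (𝓝[≠] x) (𝓝 0) := by
    refine tendsto_zero_of_mem_ordGE_one ?_
    have h2 : (fun z => (z - x) ^ 2) ∈ ordGE x 2 := by simpa using zpow_mem_ordGE x 2
    have h3 : D.hgB ∈ ordGE x (-1) := by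
      rw [show D.hgB = _ from funext D.hgB_eq]
      refine ordGE_add (ordGE_add (ordGE_mono (n := 0) (by norm_num) ?_) (ordGE_sum fun m _ =>
        ordGE_const_mul _ ?_)) (ordGE_mono (by norm_num) (ordGE_const x _))
      · exact ordGE_sum fun i _ => ordGE_const_mul _ (analyticAt_wp_add D.L fun h =>
          hx (D.add_ω_mem_halfLattice h)).mem_ordGE
      · have hm := meromorphicAt_wp_sub D.L (D.b m) x
        refine ⟨hm.inv, ?_⟩
        rw [show (fun z => (D.L.weierstrassP z - D.b m)⁻¹) =
          (fun z => D.L.weierstrassP z - D.b m)⁻¹ from rfl, meromorphicOrderAt_inv, hord]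
        split_ifs <;> decide
    simpa using mul_mem_ordGE h2 h3
  refine hf.mem_ordGE_of_indicial hA hB fun n hn => ?_
  have h2 : (n : ℂ) * (n - 1 - D.r k) = 0 := by
    have : ∑ m, (D.r m : ℂ) * ((if m = k then 1 else 0 : ℤ) : ℂ) = D.r k := by simp
    rw [this] at hn
    linear_combination hn
  rcases mul_eq_zero.mp h2 with h | h
  · have : n = 0 := by exact_mod_cast h
    omega
  · have : n - 1 - D.r k = 0 := by exact_mod_cast h
    omega

end HKData
end HermiteKrichever

end

/-! ### The space of global solutions and its period translations -/

noncomputable section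
namespace HermiteKrichever

lemma IsSol.linear {A B : ℂ → ℂ} {S U : Set ℂ} {f g : ℂ → ℂ} (hf : IsSol A B S U f)
    (hg : IsSol A B S U g) (hU : IsOpen U) (hSc : ∀ x ∉ S, ∀ᶠ y in 𝓝 x, y ∉ S) (a b : ℂ) :
    IsSol A B S U (a • f + b • g) := by
  have hd : ∀ x ∈ U, x ∉ S → HasDerivAt (a • f + b • g) (a * deriv f x + b * deriv g x) x :=
    fun x hx hxS => ((hf.an x hx hxS).differentiableAt.hasDerivAt.const_smul a).add
      ((hg.an x hx hxS).differentiableAt.hasDerivAt.const_smul b)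
  refine ⟨fun x hx => ?_, fun x hx hxS => ?_, fun x hx hxS => ?_⟩
  · exact ((MeromorphicAt.const a x).smul (hf.mero x hx)).add
      ((MeromorphicAt.const b x).smul (hg.mero x hx))
  · exact ((hf.an x hx hxS).const_smul).add ((hg.an x hx hxS).const_smul)
  · have e : deriv (a • f + b • g) =ᶠ[𝓝 x] fun x => a * deriv f x + b * deriv g x := by
      filter_upwards [hU.mem_nhds hx, hSc x hxS] with y hy hyS using (hd y hy hyS).deriv
    rw [e.deriv_eq, e.eq_of_nhds,
      (((hf.an x hx hxS).deriv.differentiableAt.hasDerivAt.const_mul a).fun_add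
        ((hg.an x hx hxS).deriv.differentiableAt.hasDerivAt.const_mul b)).deriv,
      hf.eq x hx hxS, hg.eq x hx hxS]
    simp only [Pi.add_apply, Pi.smul_apply, smul_eq_mul]
    ring

lemma deriv_comp_add (f : ℂ → ℂ) (l : ℂ) : deriv (fun x => f (x + l)) = fun x => deriv f (x + l) :=
  funext fun _ => deriv_comp_add_const _ _ _

lemma deriv_comp_neg' (f : ℂ → ℂ) : deriv (fun x => f (-x)) = fun x => -deriv f (-x) :=
  funext fun _ => deriv_comp_neg _ _

lemma QuasiPer.multiplier_ne_zero {L : PeriodPair} {μ₁ μ₂ : ℂ} {f : ℂ → ℂ} (h : QuasiPer L μ₁ μ₂ f)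
    (hf : f ≠ 0) : μ₁ ≠ 0 ∧ μ₂ ≠ 0 := by
  constructor <;> rintro rfl <;> refine hf (funext fun x => ?_)
  · simpa using h.1 (x - L.ω₁)
  · simpa using h.2 (x - L.ω₂)

namespace HKData

variable {D : HKData}

lemma hgA_neg (D : HKData) (x : ℂ) : D.hgA (-x) = -D.hgA x := by
  simp only [hgA, D.L.weierstrassP_neg, D.L.derivWeierstrassP_neg, ← Finset.sum_neg_distrib]
  exact Finset.sum_congr rfl fun k _ => by ring

lemma hgB_neg (D : HKData) (x : ℂ) : D.hgB (-x) = D.hgB x := by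
  simp only [hgB_eq, wp_neg_add_ω, D.L.weierstrassP_neg]

lemma hgA_add (D : HKData) {l : ℂ} (hl : l ∈ D.L.lattice) (x : ℂ) : D.hgA (x + l) = D.hgA x := by
  simp only [hgA, wp_add_mem D.L hl, wp'_add_mem D.L hl]

lemma hgB_add (D : HKData) {l : ℂ} (hl : l ∈ D.L.lattice) (x : ℂ) : D.hgB (x + l) = D.hgB x := by
  simp only [hgB_eq, add_right_comm x l, wp_add_mem D.L hl]

lemma Sol.comp_add {f : ℂ → ℂ} (hf : D.Sol f) {l : ℂ} (hl : l ∈ D.L.lattice) :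
    D.Sol fun x => f (x + l) := by
  refine ⟨fun x _ => ?_, fun x _ hxS => ?_, fun x _ hxS => ?_⟩
  · exact MeromorphicAt.comp_analyticAt (g := fun x => x + l) (hf.mero _ (Set.mem_univ _))
      (by fun_prop)
  · exact AnalyticAt.fun_comp (f := fun x => x + l) (hf.an (x + l) (Set.mem_univ _)
      (by rwa [add_mem_sing hl])) (by fun_prop)
  · rw [deriv_comp_add, deriv_comp_add]
    beta_reduce
    rw [hf.eq (x + l) (Set.mem_univ _) (by rwa [add_mem_sing hl]),
      hgA_add D hl, hgB_add D hl]

lemma Sol.comp_neg {f : ℂ → ℂ} (hf : D.Sol f) : D.Sol fun x => f (-x) := by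
  refine ⟨fun x _ => ?_, fun x _ hxS => ?_, fun x _ hxS => ?_⟩
  · exact MeromorphicAt.comp_analyticAt (g := fun x => -x) (hf.mero _ (Set.mem_univ _))
      (by fun_prop)
  · exact AnalyticAt.fun_comp (f := fun x => -x) (hf.an (-x) (Set.mem_univ _)
      (by rwa [neg_mem_sing])) (by fun_prop)
  · rw [deriv_comp_neg', deriv.fun_neg, deriv_comp_neg']
    beta_reduce
    rw [hf.eq (-x) (Set.mem_univ _)
      (by rwa [neg_mem_sing]), hgA_neg, hgB_neg]
    ring

/-- A solution with vanishing initial data vanishes. -/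
lemma Sol.eq_zero (hδ : ∀ k, 2 * D.δ k ∉ D.L.lattice) {f : ℂ → ℂ} (hf : D.Sol f) {x₀ : ℂ}
    (hx₀ : x₀ ∉ D.sing) (h0 : f x₀ = 0) (h1 : deriv f x₀ = 0) :
    ∀ x ∉ D.sing, f x = 0 := fun x hx =>
  ((IsSol.eq_zero isOpen_univ isPreconnected_univ D.eventually_notMem_sing_nhds
    (fun _ hx => analyticAt_hgA hδ hx) (fun _ hx => analyticAt_hgB hδ hx) hf (Set.mem_univ x₀) hx₀
    h0 h1).2 x (Set.mem_univ x) hx).eq_of_nhds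

/-- The solutions of `H_g`, normalized to vanish on the singular set. -/
def solSpace (D : HKData) : Submodule ℂ (ℂ → ℂ) where
  carrier := {f | D.Sol f ∧ ∀ x ∈ D.sing, f x = 0}
  zero_mem' := ⟨⟨fun x _ => MeromorphicAt.const 0 x, fun _ _ _ => analyticAt_const, fun _ _ _ => by
    rw [show (0 : ℂ → ℂ) = fun _ => 0 from rfl]; simp⟩, fun _ _ => rfl⟩
  add_mem' {f g} hf hg := ⟨by
    simpa using hf.1.linear hg.1 isOpen_univ D.eventually_notMem_sing_nhds 1 1,
    fun x hx => by simp [hf.2 x hx, hg.2 x hx]⟩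
  smul_mem' c f hf := ⟨by
    simpa using hf.1.linear hf.1 isOpen_univ D.eventually_notMem_sing_nhds c 0,
    fun x hx => by simp [hf.2 x hx]⟩

/-- Setting the values on the singular set to zero makes functions, rather than germs off that set,
into honest vectors determined by Cauchy data. -/
lemma exists_solSpace_eq {f : ℂ → ℂ} (hf : D.Sol f) : ∃ g ∈ D.solSpace,
    ∀ x ∉ D.sing, g =ᶠ[𝓝 x] f := by
  classical
  have e : ∀ x ∉ D.sing, (fun x => if x ∈ D.sing then 0 else f x) =ᶠ[𝓝 x] f := fun x hx => by
    filter_upwards [D.eventually_notMem_sing_nhds x hx] with y hy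
    simp [hy]
  refine ⟨fun x => if x ∈ D.sing then 0 else f x, ⟨?_, fun x hx => by simp [hx]⟩, e⟩
  refine hf.congr (fun x _ => ?_) fun x _ hx => (e x hx).symm
  filter_upwards [D.eventually_notMem_sing x] with y hy
  simp [hy]

lemma solSpace_eq_zero (hδ : ∀ k, 2 * D.δ k ∉ D.L.lattice) {f : ℂ → ℂ} (hf : f ∈ D.solSpace)
    {x₀ : ℂ} (hx₀ : x₀ ∉ D.sing) (h0 : f x₀ = 0) (h1 : deriv f x₀ = 0) : f = 0 := by
  ext x
  by_cases hx : x ∈ D.sing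
  · exact hf.2 x hx
  · exact Sol.eq_zero hδ hf.1 hx₀ h0 h1 x hx

/-- Translation by a period. -/
def translate (D : HKData) {l : ℂ} (hl : l ∈ D.L.lattice) : D.solSpace →ₗ[ℂ] D.solSpace where
  toFun f := ⟨fun x => f.1 (x + l), f.2.1.comp_add hl, fun _ hx => f.2.2 _ ((add_mem_sing hl).mpr hx)⟩
  map_add' _ _ := rfl
  map_smul' _ _ := rfl

lemma exists_notMem_sing (D : HKData) : ∃ x, x ∉ D.sing := (D.eventually_notMem_sing 0).exists

lemma finiteDimensional_solSpace (hδ : ∀ k, 2 * D.δ k ∉ D.L.lattice) :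
    FiniteDimensional ℂ D.solSpace := by
  obtain ⟨x₀, hx₀⟩ := D.exists_notMem_sing
  let ev : D.solSpace →ₗ[ℂ] ℂ × ℂ :=
    { toFun := fun f => (f.1 x₀, deriv f.1 x₀)
      map_add' := fun f g => by
        have := deriv_add (f.2.1.an x₀ (Set.mem_univ _) hx₀).differentiableAt
          (g.2.1.an x₀ (Set.mem_univ _) hx₀).differentiableAt
        ext
        · rfl
        · exact this
      map_smul' := fun c f => by
        have := deriv_const_smul c (f.2.1.an x₀ (Set.mem_univ _) hx₀).differentiableAt
        ext
        · rfl
        · exact this }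
  refine FiniteDimensional.of_injective ev ((injective_iff_map_eq_zero ev).mpr fun f hf => ?_)
  have h := Prod.ext_iff.mp hf
  exact Subtype.ext (solSpace_eq_zero hδ f.2 hx₀ h.1 h.2)

/-- There is a common eigenfunction of the two period translations. -/
lemma exists_quasiPer (hδ : ∀ k, 2 * D.δ k ∉ D.L.lattice) (hb : Function.Injective D.b)
    (hlog : ∀ k, NoLogarithmicSolution D.fuchsP D.fuchsQ (D.b k)) :
    ∃ f ∈ D.solSpace, f ≠ 0 ∧ ∃ μ₁ μ₂ : ℂ, QuasiPer D.L μ₁ μ₂ f := by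
  have := finiteDimensional_solSpace hδ
  obtain ⟨x₀, hx₀⟩ := D.exists_notMem_sing
  obtain ⟨f, hf, hf0, -⟩ := fullOn_hg hδ hb hlog x₀ (Set.mem_univ _) hx₀ 1 0
  obtain ⟨g, hg, hgf⟩ := exists_solSpace_eq hf
  have : Nontrivial D.solSpace := ⟨⟨g, hg⟩, 0, fun h => by
    have h1 : g x₀ = 0 := congrFun (congrArg Subtype.val h) x₀
    rw [(hgf x₀ hx₀).eq_of_nhds, hf0] at h1
    exact one_ne_zero h1⟩
  let T₁ : Module.End ℂ D.solSpace := D.translate D.L.ω₁_mem_lattice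
  let T₂ : Module.End ℂ D.solSpace := D.translate D.L.ω₂_mem_lattice
  obtain ⟨μ₁, hμ₁⟩ := Module.End.exists_eigenvalue T₁
  have hmaps : ∀ f ∈ T₁.eigenspace μ₁, T₂ f ∈ T₁.eigenspace μ₁ := by
    intro f hf
    rw [Module.End.mem_eigenspace_iff] at hf ⊢
    have hc : T₁ (T₂ f) = T₂ (T₁ f) := Subtype.ext (funext fun x => by
      change f.1 (x + D.L.ω₁ + D.L.ω₂) = f.1 (x + D.L.ω₂ + D.L.ω₁)
      rw [add_right_comm])
    rw [hc, hf, map_smul]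
  have : Nontrivial (T₁.eigenspace μ₁) := (Submodule.nontrivial_iff_ne_bot).mpr hμ₁
  let R : Module.End ℂ (T₁.eigenspace μ₁) := T₂.restrict hmaps
  obtain ⟨μ₂, hμ₂⟩ := Module.End.exists_eigenvalue (K := ℂ) (V := T₁.eigenspace μ₁) R
  obtain ⟨F, hF, hF0⟩ := hμ₂.exists_hasEigenvector
  refine ⟨F.1.1, F.1.2, fun h => hF0 (Subtype.ext (Subtype.ext h)), μ₁, μ₂, ?_, ?_⟩
  · have := Module.End.mem_eigenspace_iff.mp F.2
    exact fun x => congrFun (congrArg Subtype.val this) x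
  · have := congrArg Subtype.val (Module.End.mem_eigenspace_iff.mp hF)
    exact fun x => congrFun (congrArg Subtype.val this) x

/-- A nonzero solution does not vanish identically near any point. -/
lemma solSpace_eventually_ne_zero (hδ : ∀ k, 2 * D.δ k ∉ D.L.lattice) {f : ℂ → ℂ}
    (hf : f ∈ D.solSpace) (h0 : f ≠ 0) (x : ℂ) : ∀ᶠ y in 𝓝[≠] x, f y ≠ 0 := by
  refine ((hf.1.mero x (Set.mem_univ x)).eventually_eq_zero_or_eventually_ne_zero).resolve_left
    fun h => h0 ?_
  have h1 : f =ᶠ[𝓝[≠] x] fun _ => 0 := h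
  obtain ⟨y, ⟨hy, hy'⟩, hyS⟩ := ((h1.and (EventuallyEq.nhdsNE_deriv h1)).and
    (D.eventually_notMem_sing x)).exists
  exact solSpace_eq_zero hδ hf hyS hy (by simpa using hy')

end HKData
end HermiteKrichever

end

/-! ### The symmetric square and the existence of `Ξ` -/

noncomputable section
namespace HermiteKrichever

lemma pow_mem_ordGE {x : ℂ} {n : ℤ} {f : ℂ → ℂ} (hf : f ∈ ordGE x n) (m : ℕ) :
    (fun z => f z ^ m) ∈ ordGE x (m * n) := by
  induction m with
  | zero => simpa using ordGE_const x 1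
  | succ m ih =>
    have := mul_mem_ordGE ih hf
    rw [show ((m + 1 : ℕ) : ℤ) * n = m * n + n by push_cast; ring]
    simpa only [pow_succ] using this

lemma prod_mem_ordGE {ι : Type*} {s : Finset ι} {x : ℂ} {n : ι → ℤ} {f : ι → ℂ → ℂ}
    (hf : ∀ i ∈ s, f i ∈ ordGE x (n i)) : (fun z => ∏ i ∈ s, f i z) ∈ ordGE x (∑ i ∈ s, n i) := by
  classical
  induction s using Finset.induction_on with
  | empty => simpa using ordGE_const x 1
  | insert a s ha ih =>
    simp only [Finset.prod_insert ha, Finset.sum_insert ha]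
    exact mul_mem_ordGE (hf a (Finset.mem_insert_self a s))
      (ih fun i hi => hf i (Finset.mem_insert_of_mem hi))

/-- A function symmetric about a point has even order there. -/
lemma mem_ordGE_of_symm {f : ℂ → ℂ} {w : ℂ} {n : ℤ} (hf : f ∈ ordGE w (2 * n - 1))
    (hs : ∀ z, f (2 * w - z) = f z) : f ∈ ordGE w (2 * n) := by
  obtain ⟨g, hg, hfg⟩ := mem_ordGE_iff.mp hf
  have hrefl : Tendsto (fun z : ℂ => 2 * w - z) (𝓝[≠] w) (𝓝[≠] w) := by
    refine tendsto_nhdsWithin_iff.mpr ⟨?_, ?_⟩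
    · exact (Continuous.tendsto' (by fun_prop) _ _ (by ring)).mono_left nhdsWithin_le_nhds
    · filter_upwards [self_mem_nhdsWithin] with z hz h
      exact hz (by
        have : 2 * w - z = w := h
        rw [Set.mem_singleton_iff]; linear_combination -this)
  -- After removal of an odd power of `z - w`, the symmetric function leaves an antisymmetric `g`,
  -- which vanishes at `w`.
  have h1 : (fun z => g (2 * w - z)) =ᶠ[𝓝[≠] w] fun z => -g z := by
    filter_upwards [hfg, hrefl.eventually hfg, self_mem_nhdsWithin] with z h1 h2 hz
    have h0 : z - w ≠ 0 := sub_ne_zero.mpr hz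
    rw [hs, h1, show 2 * w - z - w = -1 * (z - w) by ring, mul_zpow,
      Odd.neg_one_zpow (by exact ⟨n - 1, by ring⟩)] at h2
    apply mul_left_cancel₀ (zpow_ne_zero (2 * n - 1) h0)
    linear_combination h2
  have h2 : g w = 0 := by
    have hc : ContinuousAt (fun z => g (2 * w - z)) w :=
      ContinuousAt.comp (f := fun z => 2 * w - z)
        (by rw [show 2 * w - w = w by ring]; exact hg.continuousAt) (by fun_prop)
    have := eq_of_eventuallyEq_nhdsNE hc hg.continuousAt.neg h1
    simp only [Pi.neg_apply] at this
    rw [show 2 * w - w = w by ring] at this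
    linear_combination (1 / 2 : ℂ) * this
  have h3 : g ∈ ordGE w 1 := mem_ordGE_one_of_tendsto hg.meromorphicAt (by
    rw [← h2]; exact hg.continuousAt.tendsto.mono_left nhdsWithin_le_nhds)
  refine (ordGE_congr hfg).mpr ?_
  have := mul_mem_ordGE (zpow_mem_ordGE w (2 * n - 1)) h3
  rwa [sub_add_cancel] at this

/-- Successive removal of the poles of a function by a family `G i j`. -/
lemma exists_sub_sum_mem {ι : Type*} [Fintype ι] (W : Submodule ℂ (ℂ → ℂ))
    (B : ι → ℕ → Submodule ℂ (ℂ → ℂ)) (N : ι → ℕ) (G : ι → ℕ → ℂ → ℂ)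
    (hW : ∀ i, ∀ j < N i, G i j ∈ W) (hB : ∀ i, ∀ j < N i, ∀ i' ≠ i, G i j ∈ B i' 0)
    (step : ∀ i, ∀ n < N i, ∀ f ∈ W, f ∈ B i (n + 1) → ∃ c : ℂ, f - c • G i n ∈ B i n)
    {f : ℂ → ℂ} (hf : f ∈ W) (hfB : ∀ i, f ∈ B i (N i)) :
    ∃ c : ι → ℕ → ℂ, f - (∑ i, ∑ j ∈ Finset.range (N i), c i j • G i j) ∈ W ∧
      ∀ i, f - (∑ i, ∑ j ∈ Finset.range (N i), c i j • G i j) ∈ B i 0 := by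
  classical
  -- `B i n` bounds the pole at the `i`-th point, and `B i 0` means that it is gone. Since each `G
  -- i' j` with `i' ≠ i` lies in `B i 0`, the poles at different points can be removed
  -- independently.
  have single : ∀ i, ∀ n ≤ N i, ∀ f ∈ W, f ∈ B i n →
      ∃ c : ℕ → ℂ, f - (∑ j ∈ Finset.range n, c j • G i j) ∈ B i 0 := by
    intro i n
    induction n with
    | zero => exact fun _ f _ hf => ⟨0, by simpa using hf⟩
    | succ n ih =>
      intro hn f hfW hf
      obtain ⟨a, ha⟩ := step i n (by omega) f hfW hf
      obtain ⟨c, hc⟩ := ih (by omega) _ (W.sub_mem hfW (W.smul_mem a (hW i n (by omega)))) ha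
      refine ⟨fun j => if j = n then a else c j, ?_⟩
      rw [Finset.sum_range_succ]
      beta_reduce
      rw [if_pos rfl]
      have : ∑ j ∈ Finset.range n, (if j = n then a else c j) • G i j =
          ∑ j ∈ Finset.range n, c j • G i j := Finset.sum_congr rfl fun j hj => by
        rw [if_neg (Finset.mem_range.mp hj).ne]
      rw [this]
      convert hc using 1
      abel
  choose c hc using fun i => single i (N i) le_rfl f hf (hfB i)
  refine ⟨c, W.sub_mem hf (W.sum_mem fun i _ => W.sum_mem fun j hj =>
    W.smul_mem _ (hW i j (Finset.mem_range.mp hj))), fun i => ?_⟩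
  rw [← Finset.add_sum_erase _ _ (Finset.mem_univ i), ← sub_sub]
  exact (B i 0).sub_mem (hc i) ((B i 0).sum_mem fun i' hi' => (B i 0).sum_mem fun j hj =>
    (B i 0).smul_mem _ (hB i' j (Finset.mem_range.mp hj) i (Finset.ne_of_mem_erase hi').symm))

namespace HKData

variable {D : HKData}

/-- The square of `Ψ_g`. -/
def prodB (D : HKData) (x : ℂ) : ℂ := ∏ k, (D.L.weierstrassP x - D.b k) ^ D.r k

lemma prodB_ne_zero (hδ : ∀ k, 2 * D.δ k ∉ D.L.lattice) {x : ℂ} (hx : x ∉ D.sing) :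
    D.prodB x ≠ 0 :=
  Finset.prod_ne_zero_iff.mpr fun k _ => pow_ne_zero _ (((notMem_sing_iff hδ).mp hx).2 k)

lemma hasDerivAt_prodB (hδ : ∀ k, 2 * D.δ k ∉ D.L.lattice) {x : ℂ} (hx : x ∉ D.sing) :
    HasDerivAt D.prodB (D.hgA x * D.prodB x) x := by
  obtain ⟨h1, h2⟩ := (notMem_sing_iff hδ).mp hx
  have hl := notMem_lattice_of_notMem_halfLattice h1
  have h := hasDerivAt_prod_pow Finset.univ (g := fun k z => D.L.weierstrassP z - D.b k)
    (u := fun k => D.L.derivWeierstrassP x / (D.L.weierstrassP x - D.b k)) (x := x) D.r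
    fun k _ => by
      refine ((hasDerivAt_wp D.L hl).sub_const _).congr_deriv ?_
      have := h2 k
      field_simp
  refine h.congr_deriv ?_
  simp only [hgA, mul_div_assoc]
  rfl

lemma prodB_neg (D : HKData) (x : ℂ) : D.prodB (-x) = D.prodB x := by
  simp only [prodB, D.L.weierstrassP_neg]

lemma prodB_add (D : HKData) {l : ℂ} (hl : l ∈ D.L.lattice) (x : ℂ) :
    D.prodB (x + l) = D.prodB x := by
  simp only [prodB, wp_add_mem D.L hl]

/-- The product of two solutions of `H_g`, divided by `Ψ_g ^ 2`, satisfies the symmetric square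
equation. -/
lemma symmetric_square (hδ : ∀ k, 2 * D.δ k ∉ D.L.lattice) (hb : Function.Injective D.b)
    {f g : ℂ → ℂ} (hf : D.Sol f) (hg : D.Sol g) {x : ℂ} (hx : x ∉ D.sing) :
    iteratedDeriv 3 (fun z => f z * g z / D.prodB z) x -
      4 * (D.v x - D.E) * deriv (fun z => f z * g z / D.prodB z) x -
      2 * deriv D.v x * (f x * g x / D.prodB x) = 0 := by
  -- The functions `p`, `q`, `s`, namely `f g`, `(f g)'` and `f' g'` over `Ψ_g ^ 2`, satisfy a
  -- closed first order linear system, from which the third order equation is read off.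
  set p : ℂ → ℂ := fun z => f z * g z / D.prodB z with hp
  set q : ℂ → ℂ := fun z => (deriv f z * g z + f z * deriv g z) / D.prodB z with hq
  set s : ℂ → ℂ := fun z => deriv f z * deriv g z / D.prodB z with hs
  have dp : ∀ y ∉ D.sing, HasDerivAt p (q y - D.hgA y * p y) y := fun y hy => by
    have f1 := (hf.an y (Set.mem_univ _) hy).differentiableAt.hasDerivAt
    have g1 := (hg.an y (Set.mem_univ _) hy).differentiableAt.hasDerivAt
    have h0 := prodB_ne_zero hδ hy
    refine ((f1.fun_mul g1).fun_div (hasDerivAt_prodB hδ hy) h0).congr_deriv ?_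
    simp only [hp, hq]
    field_simp
  have dq : ∀ y ∉ D.sing, HasDerivAt q (2 * D.hgB y * p y + 2 * s y) y := fun y hy => by
    have f1 := (hf.an y (Set.mem_univ _) hy).differentiableAt.hasDerivAt
    have g1 := (hg.an y (Set.mem_univ _) hy).differentiableAt.hasDerivAt
    have f2 := (hf.an y (Set.mem_univ _) hy).deriv.differentiableAt.hasDerivAt
    have g2 := (hg.an y (Set.mem_univ _) hy).deriv.differentiableAt.hasDerivAt
    have h0 := prodB_ne_zero hδ hy
    refine (((f2.fun_mul g1).fun_add (f1.fun_mul g2)).fun_div (hasDerivAt_prodB hδ hy) h0).congr_deriv ?_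
    rw [hf.eq y (Set.mem_univ _) hy, hg.eq y (Set.mem_univ _) hy]
    simp only [hp, hs]
    field_simp
    ring
  have ds : ∀ y ∉ D.sing, HasDerivAt s (D.hgA y * s y + D.hgB y * q y) y := fun y hy => by
    have f2 := (hf.an y (Set.mem_univ _) hy).deriv.differentiableAt.hasDerivAt
    have g2 := (hg.an y (Set.mem_univ _) hy).deriv.differentiableAt.hasDerivAt
    have h0 := prodB_ne_zero hδ hy
    refine ((f2.fun_mul g2).fun_div (hasDerivAt_prodB hδ hy) h0).congr_deriv ?_
    rw [hf.eq y (Set.mem_univ _) hy, hg.eq y (Set.mem_univ _) hy]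
    simp only [hq, hs]
    field_simp
    ring
  have dA : ∀ y u', HasDerivAt D.gauge u' y → HasDerivAt D.hgA (2 * u') y := fun y u' h => by
    have := h.const_mul 2
    rwa [← show D.hgA = fun y => 2 * D.gauge y from funext D.hgA_eq] at this
  have e1 : ∀ y ∉ D.sing, deriv p =ᶠ[𝓝 y] fun z => q z - D.hgA z * p z := fun y hy => by
    filter_upwards [D.eventually_notMem_sing_nhds y hy] with z hz using (dp z hz).deriv
  have e2 : ∀ y ∉ D.sing, deriv (deriv p) y =
      (2 * (D.v y - D.E) + D.hgA y ^ 2 / 2) * p y - D.hgA y * q y + 2 * s y := fun y hy => by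
    obtain ⟨u', hu', hB⟩ := gauge_identity hδ hb hy
    rw [(e1 y hy).deriv_eq, ((dq y hy).fun_sub ((dA y u' hu').fun_mul (dp y hy))).deriv, hB, hgA_eq]
    ring
  have e3 : deriv (deriv p) =ᶠ[𝓝 x] fun y =>
      (2 * (D.v y - D.E) + D.hgA y ^ 2 / 2) * p y - D.hgA y * q y + 2 * s y := by
    filter_upwards [D.eventually_notMem_sing_nhds x hx] with z hz using e2 z hz
  obtain ⟨u', hu', hB⟩ := gauge_identity hδ hb hx
  have hv := (analyticAt_v hδ hx).differentiableAt.hasDerivAt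
  have hA := dA x u' hu'
  rw [iteratedDeriv_succ, iteratedDeriv_succ, iteratedDeriv_succ, iteratedDeriv_zero, e3.deriv_eq,
    ((((((hv.sub_const D.E).const_mul 2).fun_add ((hA.fun_pow 2).div_const 2)).fun_mul
      (dp x hx)).fun_sub (hA.fun_mul (dq x hx))).fun_add ((ds x hx).const_mul 2)).deriv,
    (e1 x hx).eq_of_nhds, hB, hgA_eq]
  simp only [Nat.cast_ofNat, Nat.add_one_sub_one, pow_one]
  ring

/-- Even elliptic functions, holomorphic outside the singular set. -/
def evenEll (D : HKData) : Submodule ℂ (ℂ → ℂ) where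
  carrier := {f | (∀ x, f (-x) = f x) ∧ (∀ l ∈ D.L.lattice, ∀ x, f (x + l) = f x) ∧
    ∀ x ∉ D.sing, AnalyticAt ℂ f x}
  zero_mem' := ⟨fun _ => rfl, fun _ _ _ => rfl, fun _ _ => analyticAt_const⟩
  add_mem' {f g} hf hg := ⟨fun x => by simp [hf.1, hg.1], fun l hl x => by
    simp [hf.2.1 l hl, hg.2.1 l hl], fun x hx => (hf.2.2 x hx).add (hg.2.2 x hx)⟩
  smul_mem' c f hf := ⟨fun x => by simp [hf.1], fun l hl x => by simp [hf.2.1 l hl],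
    fun x hx => (hf.2.2 x hx).const_smul⟩

/-- Periodicity and evenness move any singular point to one of the listed representatives; in
particular `-δ k` follows from `δ k`. Liouville's theorem then applies. -/
lemma eventually_const_of_evenEll {f : ℂ → ℂ} (hf : f ∈ D.evenEll)
    (h1 : ∀ i, f ∈ ordGE (-D.ω i) 0) (h2 : ∀ k, f ∈ ordGE (D.δ k) 0) :
    ∃ C : ℂ, ∀ x ∉ D.sing, f x = C := by
  have hell : Ell D.L f := ell_iff.mpr hf.2.1
  have hadd : ∀ x, ∀ l ∈ D.L.lattice, f ∈ ordGE x 0 → f ∈ ordGE (x + l) 0 := fun x l hl h =>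
    QuasiPer.mem_ordGE_add hell one_ne_zero one_ne_zero hl h
  have hall : ∀ x, f ∈ ordGE x 0 := by
    intro x
    by_cases hx : x ∈ D.sing
    · rcases hx with hx | ⟨k, hk | hk⟩
      · obtain ⟨i, hi⟩ := D.exists_sub_ω_mem hx
        have := hadd (-D.ω i) _ (add_mem hi (D.two_mul_ω_mem i)) (h1 i)
        rwa [show -D.ω i + (x - D.ω i + 2 * D.ω i) = x by ring] at this
      · have := hadd _ _ hk (h2 k)
        rwa [add_sub_cancel] at this
      · have h3 : (fun z => f (-z)) ∈ ordGE (-D.δ k) 0 := ordGE_comp_neg (by simpa using h2 k)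
        rw [funext hf.1] at h3
        have := hadd _ _ hk h3
        rwa [show -D.δ k + (x + D.δ k) = x by ring] at this
    · exact (hf.2.2 x hx).mem_ordGE
  obtain ⟨C, hC⟩ := Ell.eventually_const hell hall
  exact ⟨C, fun x hx => eq_of_eventuallyEq_nhdsNE (hf.2.2 x hx).continuousAt continuousAt_const (hC x)⟩

/-- Expansion of even elliptic functions with prescribed poles. -/
lemma evenEll_expansion (hδ : ∀ k, 2 * D.δ k ∉ D.L.lattice) (hb : Function.Injective D.b)
    {f : ℂ → ℂ} (hf : f ∈ D.evenEll)
    (h1 : ∀ i, f ∈ ordGE (-D.ω i) (2 * -(D.l i : ℤ))) (h2 : ∀ k, f ∈ ordGE (D.δ k) (-(D.r k : ℤ))) :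
    ∃ (c₀ : ℂ) (c : Fin 4 → ℕ → ℂ) (d : Fin D.M → ℕ → ℂ), ∀ x ∉ D.sing,
    f x = c₀
      + (∑ i, ∑ j ∈ Finset.range (D.l i), c i j * D.L.weierstrassP (x + D.ω i) ^ (D.l i - j))
      + ∑ k, ∑ j ∈ Finset.range (D.r k), d k j / (D.L.weierstrassP x - D.b k) ^ (D.r k - j) := by
  have hδh : ∀ k, D.δ k ∉ D.halfLattice := fun k h => hδ k h
  have hωL : ∀ i j, j ≠ i → -D.ω j + D.ω i ∉ D.L.lattice := fun i j hij h =>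
    D.ω_sub_ω_notMem hij.symm (by rwa [neg_add_eq_sub] at h)
  have hω0 : ∀ i j : Fin 4, j ≠ i → (fun z => D.L.weierstrassP (z + D.ω i)) ∈ ordGE (-D.ω j) 0 :=
    fun i j hij => (analyticAt_wp_add D.L (hωL i j hij)).mem_ordGE
  have hωhalf : ∀ i, -D.ω i ∈ D.halfLattice := fun i => D.add_ω_mem_halfLattice (i := i) (by simp)
  set G : Fin 4 ⊕ Fin D.M → ℕ → ℂ → ℂ := fun ι n z => Sum.elim
    (fun i => D.L.weierstrassP (z + D.ω i) ^ (n + 1))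
    (fun k => (D.L.weierstrassP z - D.b k)⁻¹ ^ (n + 1)) ι with hG
  set B : Fin 4 ⊕ Fin D.M → ℕ → Submodule ℂ (ℂ → ℂ) := fun ι n =>
    Sum.elim (fun i => ordGE (-D.ω i) (2 * -(n : ℤ))) (fun k => ordGE (D.δ k) (-(n : ℤ))) ι with hBdef
  suffices key : ∃ c : Fin 4 ⊕ Fin D.M → ℕ → ℂ,
      f - (∑ ι, ∑ j ∈ Finset.range (Sum.elim D.l D.r ι), c ι j • G ι j) ∈ D.evenEll ∧
      ∀ ι, f - (∑ ι, ∑ j ∈ Finset.range (Sum.elim D.l D.r ι), c ι j • G ι j) ∈ B ι 0 by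
    obtain ⟨c, hcW, hcB⟩ := key
    obtain ⟨C, hC⟩ := eventually_const_of_evenEll hcW (fun i => by simpa [hBdef] using hcB (Sum.inl i))
      (fun k => by simpa [hBdef] using hcB (Sum.inr k))
    -- The removal produces exponents `j + 1` in increasing order; the stated expansion lists them
    -- in decreasing order, hence the reflection of the index.
    refine ⟨C, fun i j => c (Sum.inl i) (D.l i - 1 - j), fun k j => c (Sum.inr k) (D.r k - 1 - j),
      fun x hx => ?_⟩
    have := hC x hx
    simp only [Pi.sub_apply, Pi.add_apply, Finset.sum_apply, Pi.smul_apply, smul_eq_mul, Fintype.sum_sum_type,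
      Sum.elim_inl, Sum.elim_inr, hG] at this
    have e1 : ∀ i, ∑ j ∈ Finset.range (D.l i), c (Sum.inl i) (D.l i - 1 - j) *
        D.L.weierstrassP (x + D.ω i) ^ (D.l i - j) =
        ∑ j ∈ Finset.range (D.l i), c (Sum.inl i) j * D.L.weierstrassP (x + D.ω i) ^ (j + 1) :=
      fun i => by
        rw [← Finset.sum_range_reflect (fun j => c (Sum.inl i) j *
          D.L.weierstrassP (x + D.ω i) ^ (j + 1))]
        refine Finset.sum_congr rfl fun j hj => ?_
        have := Finset.mem_range.mp hj
        rw [show D.l i - 1 - j + 1 = D.l i - j by omega]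
    have e2 : ∀ k, ∑ j ∈ Finset.range (D.r k), c (Sum.inr k) (D.r k - 1 - j) /
        (D.L.weierstrassP x - D.b k) ^ (D.r k - j) =
        ∑ j ∈ Finset.range (D.r k), c (Sum.inr k) j * (D.L.weierstrassP x - D.b k)⁻¹ ^ (j + 1) :=
      fun k => by
        rw [← Finset.sum_range_reflect (fun j => c (Sum.inr k) j *
          (D.L.weierstrassP x - D.b k)⁻¹ ^ (j + 1))]
        refine Finset.sum_congr rfl fun j hj => ?_
        have := Finset.mem_range.mp hj
        rw [show D.r k - 1 - j + 1 = D.r k - j by omega, div_eq_mul_inv, inv_pow]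
    simp only [e1, e2]
    linear_combination this
  refine exists_sub_sum_mem D.evenEll B (Sum.elim D.l D.r) G ?_ ?_ ?_ hf ?_
  · rintro (i | k) j -
    · refine ⟨fun x => ?_, fun l hl x => ?_, fun x hx => ?_⟩
      · simp only [hG, Sum.elim_inl, wp_neg_add_ω]
      · simp only [hG, Sum.elim_inl, add_right_comm x l, wp_add_mem D.L hl]
      · exact (analyticAt_wp_add D.L fun h => notMem_halfLattice_of_notMem_sing hx
          (D.add_ω_mem_halfLattice h)).fun_pow _
    · refine ⟨fun x => ?_, fun l hl x => ?_, fun x hx => ?_⟩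
      · simp only [hG, Sum.elim_inr, D.L.weierstrassP_neg]
      · simp only [hG, Sum.elim_inr, wp_add_mem D.L hl]
      · obtain ⟨h1, h2⟩ := (notMem_sing_iff hδ).mp hx
        exact (((analyticAt_wp D.L (notMem_lattice_of_notMem_halfLattice h1)).fun_sub
          analyticAt_const).fun_inv (h2 k)).fun_pow _
  · rintro (i | k) j - (i' | k') hne
    · have := pow_mem_ordGE (hω0 i i' fun h => hne (congrArg _ h)) (j + 1)
      simpa [hG, hBdef] using this
    · have := pow_mem_ordGE (analyticAt_wp_add D.L (x := D.δ k') (c := D.ω i) fun h =>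
        hδh k' (D.add_ω_mem_halfLattice h)).mem_ordGE (j + 1)
      simpa [hG, hBdef] using this
    · have := pow_mem_ordGE (inv_wp_sub_b_mem hδ (k := k)
        (notMem_delta_of_mem_halfLattice hδ (hωhalf i') k)) (j + 1)
      simpa [hG, hBdef] using this
    · have hk : k' ≠ k := fun h => hne (congrArg _ h)
      have := pow_mem_ordGE (((analyticAt_wp D.L (δ_notMem hδ k')).fun_sub
        analyticAt_const).fun_inv (sub_ne_zero.mpr fun h => hk (hb h))).mem_ordGE (j + 1)
      simpa [hG, hBdef] using this
  · rintro (i | k) n - f hfW hf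
    · simp only [hBdef, Sum.elim_inl] at hf ⊢
      have hm : MeromorphicAt (G (Sum.inl i) n) (-D.ω i) := by
        have : MeromorphicAt (fun z => D.L.weierstrassP (z + D.ω i)) (-D.ω i) :=
          MeromorphicAt.comp_analyticAt (g := fun x => x + D.ω i) (D.L.meromorphic_weierstrassP _)
            (by fun_prop)
        exact this.fun_pow (n + 1)
      have hord : meromorphicOrderAt (G (Sum.inl i) n) (-D.ω i) =
          ((2 * -((n + 1 : ℕ) : ℤ) : ℤ) : WithTop ℤ) := by
        refine order_eq_of_tendsto hm one_ne_zero ?_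
        have h := tendsto_sub_nhdsNE (-D.ω i) (-D.ω i)
        rw [sub_self] at h
        have := ((tendsto_sq_mul_wp D.L).comp h).pow (n + 1)
        rw [one_pow] at this
        refine this.congr fun z => ?_
        simp only [hG, Sum.elim_inl, Function.comp_apply, mul_pow, sub_neg_eq_add, ← pow_mul]
        rw [show -(2 * -((n + 1 : ℕ) : ℤ)) = ((2 * (n + 1) : ℕ) : ℤ) by push_cast; ring,
          zpow_natCast]
      obtain ⟨c, hc⟩ := exists_sub_smul_mem_ordGE hf hm hord
      -- Subtracting a multiple of a power of `℘` raises the order by one only; symmetry about the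
      -- half period gives the second unit. Thus level `n` means pole order at most `2 n`.
      refine ⟨c, mem_ordGE_of_symm (n := -(n : ℤ)) ?_ fun z => ?_⟩
      · rwa [show 2 * -((n + 1 : ℕ) : ℤ) + 1 = 2 * -(n : ℤ) - 1 by push_cast; ring] at hc
      · have e1 : f (2 * -D.ω i - z) = f z := by
          rw [← hfW.1, show -(2 * -D.ω i - z) = z + 2 * D.ω i by ring,
            hfW.2.1 _ (D.two_mul_ω_mem i)]
        have e2 : D.L.weierstrassP (2 * -D.ω i - z + D.ω i) = D.L.weierstrassP (z + D.ω i) := by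
          rw [← D.L.weierstrassP_neg]; ring_nf
        simp only [Pi.sub_apply, Pi.smul_apply, e1, hG, Sum.elim_inl, e2]
    · simp only [hBdef, Sum.elim_inr] at hf ⊢
      have hm : MeromorphicAt (G (Sum.inr k) n) (D.δ k) :=
        (meromorphicAt_wp_sub D.L (D.b k) _).fun_inv.fun_pow (n + 1)
      have hord : meromorphicOrderAt (G (Sum.inr k) n) (D.δ k) =
          ((-((n + 1 : ℕ) : ℤ) : ℤ) : WithTop ℤ) := by
        have h := order_wp_sub_b_delta (hδh k) (k := k) rfl
        rw [show G (Sum.inr k) n = (fun z => D.L.weierstrassP z - D.b k)⁻¹ ^ (n + 1) from rfl,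
          meromorphicOrderAt_pow (meromorphicAt_wp_sub D.L (D.b k) _).inv, meromorphicOrderAt_inv, h]
        norm_cast
        simp [Int.negSucc_eq]
      obtain ⟨c, hc⟩ := exists_sub_smul_mem_ordGE hf hm hord
      refine ⟨c, ?_⟩
      rwa [show (-((n + 1 : ℕ) : ℤ)) + 1 = -(n : ℤ) by omega] at hc
  · rintro (i | k)
    · exact h1 i
    · exact h2 k

/-- Existence of `Ξ`. -/
lemma exists_isXi (hδ : ∀ k, 2 * D.δ k ∉ D.L.lattice) (hb : Function.Injective D.b)
    (hlog : ∀ k, NoLogarithmicSolution D.fuchsP D.fuchsQ (D.b k)) : ∃ Ξ, D.IsXi Ξ := by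
  obtain ⟨f, hf, hf0, μ₁, μ₂, hμ⟩ := exists_quasiPer hδ hb hlog
  obtain ⟨hμ1, hμ2⟩ := hμ.multiplier_ne_zero hf0
  have hfn := hf.1.comp_neg
  -- The multiplier of `f(-x)` is inverse to that of `f(x)`, so the product is elliptic; evenness is
  -- built in.
  set Ξ : ℂ → ℂ := fun z => f z * f (-z) / D.prodB z with hΞ
  have heven : ∀ x, Ξ (-x) = Ξ x := fun x => by
    simp only [hΞ, neg_neg, prodB_neg]; ring
  have hper : ∀ l ∈ D.L.lattice, ∀ x, Ξ (x + l) = Ξ x := fun l hl x => by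
    obtain ⟨c, hc, h⟩ := QuasiPer.exists_mul hμ hμ1 hμ2 hl
    have := h (-x - l)
    rw [sub_add_cancel] at this
    simp only [hΞ, prodB_add D hl, h, neg_add', this]
    ring
  have han : ∀ x ∉ D.sing, AnalyticAt ℂ Ξ x := fun x hx => by
    have hG : AnalyticAt ℂ D.prodB x := by
      rw [Complex.analyticAt_iff_eventually_differentiableAt]
      filter_upwards [D.eventually_notMem_sing_nhds x hx] with y hy using
        (hasDerivAt_prodB hδ hy).differentiableAt
    exact ((hf.1.an x (Set.mem_univ x) hx).fun_mul (hfn.an x (Set.mem_univ x) hx)).fun_div hG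
      (prodB_ne_zero hδ hx)
  have hinv : ∀ (x : ℂ) (n : Fin D.M → ℤ), (∀ k, (fun z => (D.L.weierstrassP z - D.b k)⁻¹) ∈ ordGE x (n k)) →
      (fun z => (D.prodB z)⁻¹) ∈ ordGE x (∑ k, D.r k * n k) := fun x n h => by
    have := prod_mem_ordGE (s := Finset.univ) fun k _ => pow_mem_ordGE (h k) (D.r k)
    simpa [prodB, ← Finset.prod_inv_distrib, inv_pow] using this
  have hlat : ∀ i, -D.ω i - D.ω i ∈ D.L.lattice := fun i => by
    have := neg_mem (D.two_mul_ω_mem i)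
    rwa [show -(2 * D.ω i) = -D.ω i - D.ω i by ring] at this
  have hωhalf : ∀ i, -D.ω i ∈ D.halfLattice := fun i => D.add_ω_mem_halfLattice (i := i) (by simp)
  have hmul : ∀ (x : ℂ) (m n : ℤ), f ∈ ordGE x m → (fun z => f (-z)) ∈ ordGE x m →
      (fun z => (D.prodB z)⁻¹) ∈ ordGE x n → Ξ ∈ ordGE x (m + m + n) := fun x m n h1 h2 h3 => by
    simpa only [hΞ, div_eq_mul_inv] using mul_mem_ordGE (mul_mem_ordGE h1 h2) h3
  refine ⟨Ξ, fun x _ => heven x, fun x _ => ⟨?_, ?_⟩, ?_, fun x hx => symmetric_square hδ hb hf.1 hfn hx,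
    evenEll_expansion hδ hb ⟨heven, hper, han⟩ (fun i => ?_) fun k => ?_⟩
  · exact hper _ (D.two_mul_ω_mem 1) x
  · exact hper _ (D.two_mul_ω_mem 3) x
  · have hn := solSpace_eventually_ne_zero hδ hf hf0
    have hneg : Tendsto (fun z : ℂ => -z) (𝓝[≠] 0) (𝓝[≠] 0) := by
      refine tendsto_nhdsWithin_iff.mpr ⟨?_, ?_⟩
      · exact (Continuous.tendsto' (by fun_prop) _ _ (by simp)).mono_left nhdsWithin_le_nhds
      · filter_upwards [self_mem_nhdsWithin] with z hz h
        exact hz (by simpa using h)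
    obtain ⟨x, ⟨h1, h2⟩, hx⟩ := (((hn 0).and (hneg.eventually (hn 0))).and
      (D.eventually_notMem_sing 0)).exists
    exact ⟨x, hx, div_ne_zero (mul_ne_zero h1 h2) (prodB_ne_zero hδ hx)⟩
  -- Order count: `-2 (l 0 + R) + 2 R = -2 l 0` at `0`, because `1 / prodB` vanishes there to order
  -- `2 R`, and `-2 l i` at the other half periods. At `δ k` only `1 / prodB` contributes, with
  -- order `-r k`.
  · have a1 := hf.1.mem_ordGE_half hδ (hlat i)
    have a2 := hfn.mem_ordGE_half hδ (hlat i)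
    induction i using Fin.cases with
    | zero =>
      have h0 : -D.ω 0 ∈ D.L.lattice := by simp [ω_zero]
      have := hmul _ _ _ a1 a2 (hinv _ _ fun k => inv_wp_sub_mem D.L h0 (D.b k))
      refine ordGE_mono (le_of_eq ?_) this
      rw [← Finset.sum_mul, show D.lt 0 = D.l 0 + D.R from rfl, R]
      push_cast; ring
    | succ i =>
      have := hmul _ _ _ a1 a2 (hinv _ (fun _ => 0) fun k => inv_wp_sub_b_mem hδ
        (notMem_delta_of_mem_halfLattice hδ (hωhalf i.succ) k))
      refine ordGE_mono (le_of_eq ?_) this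
      rw [show D.lt i.succ = D.l i.succ by fin_cases i <;> rfl]
      simp; ring_nf
  · have hk : D.δ k ∉ D.halfLattice := hδ k
    have := hmul _ _ _ (hf.1.mem_ordGE_zero hδ hb hk) (hfn.mem_ordGE_zero hδ hb hk)
      (hinv (D.δ k) (fun m => if m = k then -1 else 0) fun m => ?_)
    · refine ordGE_mono (le_of_eq ?_) this
      simp
    · refine mem_ordGE_of_eq (meromorphicAt_wp_sub D.L (D.b m) _).inv ?_
      rw [show (fun z => (D.L.weierstrassP z - D.b m)⁻¹) =
        (fun z => D.L.weierstrassP z - D.b m)⁻¹ from rfl, meromorphicOrderAt_inv]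
      split_ifs with h
      · rw [order_wp_sub_b_delta hk (h ▸ rfl)]; rfl
      · rw [order_wp_sub_b_of_notMem (δ_notMem hδ k) fun h' => h (hb h'.symm)]; rfl

end HKData
end HermiteKrichever

end

/-! ### The constant `Q` and the extension of branches of `Λ_g` -/

noncomputable section
namespace HermiteKrichever

/-- A meromorphic function can be redefined so as to be holomorphic wherever it has no pole. -/
lemma exists_normal_form {f : ℂ → ℂ} (hf : Meromorphic f) : ∃ g : ℂ → ℂ, Meromorphic g ∧
    (∀ x, g =ᶠ[𝓝[≠] x] f) ∧ (∀ x, f ∈ ordGE x 0 → AnalyticAt ℂ g x) ∧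
      ∀ x, AnalyticAt ℂ f x → g =ᶠ[𝓝 x] f := by
  have hm : MeromorphicOn f Set.univ := fun x _ => hf x
  have e : ∀ x, toMeromorphicNFOn f Set.univ =ᶠ[𝓝[≠] x] f := fun x =>
    hm.toMeromorphicNFOn_eq_self_on_nhdsNE (Set.mem_univ x)
  have han : ∀ x, f ∈ ordGE x 0 → AnalyticAt ℂ (toMeromorphicNFOn f Set.univ) x := fun x hx => by
    have h1 := meromorphicNFOn_toMeromorphicNFOn f Set.univ (Set.mem_univ x)
    rw [← h1.meromorphicOrderAt_nonneg_iff_analyticAt, meromorphicOrderAt_congr (e x)]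
    exact hx.2
  refine ⟨toMeromorphicNFOn f Set.univ, fun x => (hf x).congr (e x).symm, e, han, fun x hx => ?_⟩
  exact ((han x hx.mem_ordGE).continuousAt.eventuallyEq_nhds_iff_eventuallyEq_nhdsNE
    hx.continuousAt).mp (e x)

namespace HKData

variable {D : HKData}

lemma isOpen_compl_sing (D : HKData) : IsOpen D.singᶜ :=
  isOpen_iff_mem_nhds.mpr fun x hx => D.eventually_notMem_sing_nhds x hx

lemma isPreconnected_compl_sing (D : HKData) : IsPreconnected D.singᶜ := by
  have hc : Countable D.L.lattice := D.L.latticeEquivProd.toEquiv.countable_iff.mpr inferInstance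
  have hc' : (D.L.lattice : Set ℂ).Countable := Set.to_countable _
  have : D.sing.Countable := by
    have e : D.sing = (fun x : ℂ => 2 * x) ⁻¹' D.L.lattice ∪
        ⋃ k, ((fun x => x - D.δ k) ⁻¹' D.L.lattice ∪ (fun x => x + D.δ k) ⁻¹' D.L.lattice) := by
      ext x
      simp [sing, halfLattice]
    rw [e]
    refine (hc'.preimage_of_injOn fun x _ y _ h => by simpa using h).union
      (Set.countable_iUnion fun k => Set.Countable.union ?_ ?_)
    · exact hc'.preimage_of_injOn fun x _ y _ h => by simpa using h
    · exact hc'.preimage_of_injOn fun x _ y _ h => by simpa using h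
  exact (this.isConnected_compl_of_one_lt_rank (by simp)).isPreconnected

lemma IsXi.analyticAt (hδ : ∀ k, 2 * D.δ k ∉ D.L.lattice) {Ξ : ℂ → ℂ} (h : D.IsXi Ξ) {x : ℂ}
    (hx : x ∉ D.sing) : AnalyticAt ℂ Ξ x := by
  obtain ⟨c₀, c, d, he⟩ := h.expansion
  have e : (fun x => c₀
      + (∑ i, ∑ j ∈ Finset.range (D.l i), c i j * D.L.weierstrassP (x + D.ω i) ^ (D.l i - j))
      + ∑ k, ∑ j ∈ Finset.range (D.r k), d k j / (D.L.weierstrassP x - D.b k) ^ (D.r k - j))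
      =ᶠ[𝓝 x] Ξ := by
    filter_upwards [D.eventually_notMem_sing_nhds x hx] with y hy using (he y hy).symm
  refine AnalyticAt.congr ?_ e
  obtain ⟨h1, h2⟩ := (notMem_sing_iff hδ).mp hx
  have hl := analyticAt_wp D.L (notMem_lattice_of_notMem_halfLattice h1)
  refine (analyticAt_const.fun_add (Finset.analyticAt_fun_sum _ fun i _ =>
    Finset.analyticAt_fun_sum _ fun j _ => analyticAt_const.fun_mul ((analyticAt_wp_add D.L fun h =>
      h1 (D.add_ω_mem_halfLattice h)).fun_pow _))).fun_add
    (Finset.analyticAt_fun_sum _ fun k _ => Finset.analyticAt_fun_sum _ fun j _ => ?_)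
  exact analyticAt_const.fun_div ((hl.fun_sub analyticAt_const).fun_pow _) (pow_ne_zero _ (h2 k))

/-- `Q` is constant. -/
lemma IsXi.exists_Q (hδ : ∀ k, 2 * D.δ k ∉ D.L.lattice) {Ξ : ℂ → ℂ} (h : D.IsXi Ξ) :
    ∃ Q : ℂ, ∀ x ∉ D.sing, D.Qfun Ξ x = Q := by
  obtain ⟨x₀, hx₀⟩ := D.exists_notMem_sing
  have hd : ∀ x ∉ D.sing, HasDerivAt (D.Qfun Ξ) 0 x := fun x hx => by
    have a0 := h.analyticAt hδ hx
    have d0 := a0.differentiableAt.hasDerivAt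
    have d1 := a0.deriv.differentiableAt.hasDerivAt
    have d2 := a0.deriv.deriv.differentiableAt.hasDerivAt
    have hv := (analyticAt_v hδ hx).differentiableAt.hasDerivAt
    have heq := h.equation x hx
    rw [iteratedDeriv_succ, iteratedDeriv_succ, iteratedDeriv_succ, iteratedDeriv_zero] at heq
    refine ((((d0.fun_pow 2).fun_mul (hv.const_sub D.E)).fun_add
      ((d0.const_mul (1 / 2 : ℂ)).fun_mul d2)).fun_sub
      ((d1.fun_pow 2).const_mul (1 / 4 : ℂ))).congr_deriv ?_
    simp only [Nat.cast_ofNat, Nat.add_one_sub_one, pow_one]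
    -- The derivative of `Qfun` is `Ξ / 2` times the third order equation.
    linear_combination (1 / 2 : ℂ) * Ξ x * heq
  refine ⟨D.Qfun Ξ x₀, fun x hx => ?_⟩
  exact D.isOpen_compl_sing.is_const_of_deriv_eq_zero D.isPreconnected_compl_sing
    (fun y hy => (hd y hy).differentiableAt.differentiableWithinAt) (fun y hy => (hd y hy).deriv) hx hx₀

/-- A branch satisfies a first order equation and the equation of `H_g`. -/
lemma IsLambdaBranch.isSol (hδ : ∀ k, 2 * D.δ k ∉ D.L.lattice) (hb : Function.Injective D.b)
    {Ξ : ℂ → ℂ} (h : D.IsXi Ξ) {Q : ℂ} (hQ : ∀ x ∉ D.sing, D.Qfun Ξ x = Q) {U : Set ℂ} {F : ℂ → ℂ}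
    (hF : D.IsLambdaBranch Ξ Q U F) : IsSol D.hgA D.hgB D.sing U F ∧ (∀ x ∈ U, F x ≠ 0) ∧
      ∃ q : ℂ, ∀ x ∈ U, deriv F x = (D.gauge x + (deriv Ξ x / 2 + q) / Ξ x) * F x := by
  obtain ⟨hU, -, hUS, ψ, ξ, I, q, hq, hψ, hξ, hψ2, hξ2, hI, hF⟩ := hF
  have hd : ∀ x ∈ U, HasDerivAt F ((D.gauge x + (deriv Ξ x / 2 + q) / Ξ x) * F x) x := by
    intro x hx
    obtain ⟨hxS, hx0⟩ := hUS x hx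
    have a0 := h.analyticAt hδ hxS
    have d1 : HasDerivAt ψ (D.gauge x * ψ x) x := by
      refine hasDerivAt_of_sq (hψ.differentiableAt (hU.mem_nhds hx)) (G := D.prodB) ?_ ?_
        (prodB_ne_zero hδ hxS)
      · filter_upwards [hU.mem_nhds hx] with y hy using hψ2 y hy
      · rw [← hgA_eq]; exact hasDerivAt_prodB hδ hxS
    have d2 : HasDerivAt ξ (deriv Ξ x / (2 * Ξ x) * ξ x) x := by
      refine hasDerivAt_of_sq (hξ.differentiableAt (hU.mem_nhds hx)) (G := Ξ) ?_ ?_ hx0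
      · filter_upwards [hU.mem_nhds hx] with y hy using hξ2 y hy
      · refine a0.differentiableAt.hasDerivAt.congr_deriv ?_
        field_simp
    have e : (fun x => ψ x * ξ x * Complex.exp (I x)) =ᶠ[𝓝 x] F := by
      filter_upwards [hU.mem_nhds hx] with y hy using (hF y hy).symm
    refine (((d1.fun_mul d2).fun_mul (hI x hx).cexp).congr_of_eventuallyEq e.symm).congr_deriv ?_
    rw [hF x hx]
    field_simp
    ring
  have han : ∀ x ∈ U, AnalyticAt ℂ F x := fun x hx =>
    DifferentiableOn.analyticAt (s := U) (fun y hy => (hd y hy).differentiableAt.differentiableWithinAt)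
      (hU.mem_nhds hx)
  refine ⟨⟨fun x hx => (han x hx).meromorphicAt, fun x hx _ => han x hx, fun x hx hxS => ?_⟩,
    fun x hx => ?_, q, fun x hx => (hd x hx).deriv⟩
  · have hx0 := (hUS x hx).2
    have a0 := h.analyticAt hδ hxS
    obtain ⟨u', hu', hB⟩ := gauge_identity hδ hb hxS
    have e : deriv F =ᶠ[𝓝 x] fun x => (D.gauge x + (deriv Ξ x / 2 + q) / Ξ x) * F x := by
      filter_upwards [hU.mem_nhds hx] with y hy using (hd y hy).deriv
    -- For `y = (Ξ' / 2 + q) / Ξ` the Riccati equation `y' + y ^ 2 = v - E` amounts to `q ^ 2 = -Q`;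
    -- the gauge term turns it into the equation of `H_g`.
    have hQx := hQ x hxS
    rw [Qfun] at hQx
    rw [e.deriv_eq, e.eq_of_nhds, ((hu'.fun_add (((a0.deriv.differentiableAt.hasDerivAt.div_const
      2).add_const q).fun_div a0.differentiableAt.hasDerivAt hx0)).fun_mul (hd x hx)).deriv, hB, hgA_eq]
    field_simp
    linear_combination 4 * F x * hq + 4 * F x * hQx
  · rw [hF x hx]
    refine mul_ne_zero (mul_ne_zero (fun h0 => ?_) (fun h0 => ?_)) (Complex.exp_ne_zero _)
    · refine prodB_ne_zero hδ (hUS x hx).1 ?_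
      rw [prodB, ← hψ2 x hx, h0]; simp
    · refine (hUS x hx).2 ?_
      rw [← hξ2 x hx, h0]; simp

lemma IsXi.add_mem {Ξ : ℂ → ℂ} (h : D.IsXi Ξ) :
    (∀ x ∉ D.sing, Ξ (x + D.L.ω₁) = Ξ x) ∧ ∀ x ∉ D.sing, Ξ (x + D.L.ω₂) = Ξ x := by
  have h1 : 2 * D.ω 1 = D.L.ω₁ := mul_div_cancel₀ _ two_ne_zero
  have h3 : 2 * D.ω 3 = D.L.ω₂ := mul_div_cancel₀ _ two_ne_zero
  refine ⟨fun x hx => ?_, fun x hx => ?_⟩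
  · rw [← h1]; exact (h.periodic x hx).1
  · rw [← h3]; exact (h.periodic x hx).2

/-- A branch extends to a quasi-periodic global solution. -/
lemma IsLambdaBranch.exists_extension (hδ : ∀ k, 2 * D.δ k ∉ D.L.lattice)
    (hb : Function.Injective D.b) (hlog : ∀ k, NoLogarithmicSolution D.fuchsP D.fuchsQ (D.b k))
    {Ξ : ℂ → ℂ} (h : D.IsXi Ξ) {Q : ℂ} (hQ : ∀ x ∉ D.sing, D.Qfun Ξ x = Q) {U : Set ℂ} {F : ℂ → ℂ}
    (hF : D.IsLambdaBranch Ξ Q U F) : ∃ f ∈ D.solSpace, Set.EqOn f F U ∧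
      ∃ μ₁ μ₂ : ℂ, μ₁ ≠ 0 ∧ μ₂ ≠ 0 ∧ QuasiPer D.L μ₁ μ₂ f := by
  obtain ⟨hsol, hF0, q, hq⟩ := hF.isSol hδ hb h hQ
  obtain ⟨hU, hUc, hUS, -⟩ := hF
  obtain ⟨x₀, hx₀⟩ := hUc.nonempty
  have hx₀S := (hUS x₀ hx₀).1
  obtain ⟨f', hf', h0, h1⟩ := fullOn_hg hδ hb hlog x₀ (Set.mem_univ _) hx₀S (F x₀) (deriv F x₀)
  obtain ⟨f, hf, hff'⟩ := exists_solSpace_eq hf'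
  have hf0 : f x₀ = F x₀ := (hff' x₀ hx₀S).eq_of_nhds.trans h0
  have hf1 : deriv f x₀ = deriv F x₀ := (hff' x₀ hx₀S).deriv_eq.trans h1
  have hfan := fun x hx => hf.1.an x (Set.mem_univ x) hx
  have hsub := ((hf.1.mono (Set.subset_univ U)).sub hsol hU D.eventually_notMem_sing_nhds).eq_zero hU
    hUc.isPreconnected D.eventually_notMem_sing_nhds
    (fun x hx => analyticAt_hgA hδ hx) (fun x hx => analyticAt_hgB hδ hx) hx₀ hx₀S
    (by simp [hf0]) (by
      rw [deriv_sub (hfan _ hx₀S).differentiableAt (hsol.an _ hx₀ hx₀S).differentiableAt, hf1, sub_self])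
  have hEq : ∀ x ∈ U, f =ᶠ[𝓝 x] F := fun x hx => by
    filter_upwards [hsub.2 x hx (hUS x hx).1] with y hy
    simpa [sub_eq_zero] using hy
  have hfne : f ≠ 0 := fun h => hF0 x₀ hx₀ (by rw [← hf0, h]; rfl)
  -- The first order relation cleared of the denominator `Ξ` is analytic off the singular set, so it
  -- spreads from `U` to the whole connected complement by the identity theorem.
  set Dif : ℂ → ℂ := fun x => Ξ x * deriv f x - (Ξ x * D.gauge x + deriv Ξ x / 2 + q) * f x with hDif
  have hDan : AnalyticOnNhd ℂ Dif D.singᶜ := fun x hx => by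
    have a0 := h.analyticAt hδ hx
    have a1 : AnalyticAt ℂ D.gauge x := by
      have := (analyticAt_hgA hδ hx).fun_div (analyticAt_const (v := 2)) two_ne_zero
      simpa [hgA_eq] using this
    have a2 := hfan x hx
    exact (a0.fun_mul a2.deriv).fun_sub ((((a0.fun_mul a1).fun_add
      (a0.deriv.fun_div analyticAt_const two_ne_zero)).fun_add analyticAt_const).fun_mul a2)
  have hD0 : ∀ x ∉ D.sing, Dif x = 0 := by
    refine hDan.eqOn_zero_of_preconnected_of_eventuallyEq_zero D.isPreconnected_compl_sing hx₀S ?_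
    filter_upwards [hU.mem_nhds hx₀] with x hx
    have hne := (hUS x hx).2
    simp only [hDif, (hEq x hx).deriv_eq, (hEq x hx).eq_of_nhds, hq x hx, Pi.zero_apply]
    field_simp
    ring
  have key : ∀ l ∈ D.L.lattice, (∀ x ∉ D.sing, Ξ (x + l) = Ξ x) → ∃ μ, ∀ x, f (x + l) = μ * f x := by
    intro l hl hper
    have hx₀l : x₀ + l ∉ D.sing := by rwa [add_mem_sing hl]
    have hne := (hUS x₀ hx₀).2
    have hΞd : deriv Ξ (x₀ + l) = deriv Ξ x₀ := by
      rw [← deriv_comp_add_const]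
      refine EventuallyEq.deriv_eq ?_
      filter_upwards [D.eventually_notMem_sing_nhds x₀ hx₀S] with y hy using hper y hy
    have hg : D.gauge (x₀ + l) = D.gauge x₀ := by
      have := hgA_add D hl x₀
      rw [hgA_eq, hgA_eq] at this
      exact mul_left_cancel₀ two_ne_zero this
    have e1 := hD0 x₀ hx₀S
    have e2 := hD0 (x₀ + l) hx₀l
    simp only [hDif, hper x₀ hx₀S, hΞd, hg] at e1 e2
    have hne' : f x₀ ≠ 0 := hf0 ▸ hF0 x₀ hx₀
    -- The coefficients of the first order relation are periodic and `Ξ x₀ ≠ 0`, so `f` has the same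
    -- logarithmic derivative at `x₀` and, if nonzero there, at `x₀ + l`. Hence `f(x + l) - μ f(x)`
    -- has zero Cauchy data at `x₀`; the cross-multiplied form also covers `f (x₀ + l) = 0`.
    set μ := f (x₀ + l) / f x₀ with hμ
    have hT : (fun x => f (x + l)) - μ • f ∈ D.solSpace :=
      sub_mem (D.translate hl ⟨f, hf⟩).2 (D.solSpace.smul_mem μ hf)
    have hz : (fun x => f (x + l)) - μ • f = 0 := by
      refine solSpace_eq_zero hδ hT hx₀S ?_ ?_
      · simp [hμ, hne']
      · have d1 : DifferentiableAt ℂ (fun x => f (x + l)) x₀ :=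
          ((hf.1.comp_add hl).an x₀ (Set.mem_univ _) hx₀S).differentiableAt
        rw [deriv_sub d1 ((hfan x₀ hx₀S).differentiableAt.const_smul μ), deriv_const_smul_field,
          deriv_comp_add_const, hμ, smul_eq_mul]
        have e3 : f x₀ * deriv f (x₀ + l) = f (x₀ + l) * deriv f x₀ :=
          mul_left_cancel₀ hne (by linear_combination f x₀ * e2 - f (x₀ + l) * e1)
        field_simp
        linear_combination e3
    exact ⟨μ, fun x => by simpa [sub_eq_zero] using congrFun hz x⟩
  obtain ⟨μ₁, hμ₁⟩ := key _ D.L.ω₁_mem_lattice h.add_mem.1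
  obtain ⟨μ₂, hμ₂⟩ := key _ D.L.ω₂_mem_lattice h.add_mem.2
  have hquasi : QuasiPer D.L μ₁ μ₂ f := ⟨hμ₁, hμ₂⟩
  obtain ⟨m1, m2⟩ := hquasi.multiplier_ne_zero hfne
  exact ⟨f, hf, fun x hx => (hEq x hx).eq_of_nhds, μ₁, μ₂, m1, m2, hquasi⟩

end HKData
end HermiteKrichever

end

/-! ### Multipliers of quasi-periodic functions -/

noncomputable section
namespace HermiteKrichever

lemma meromorphicOrderAt_iteratedDeriv {f : ℂ → ℂ} {x : ℂ} {n : ℤ} (hn : n < 0)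
    (h : meromorphicOrderAt f x = n) (j : ℕ) :
    meromorphicOrderAt (iteratedDeriv j f) x = ((n - j : ℤ) : WithTop ℤ) := by
  induction j with
  | zero => simpa using h
  | succ j ih =>
    rw [iteratedDeriv_succ, meromorphicOrderAt_deriv_eq_sub_one ?_ ih]
    · congr 1; push_cast; ring
    · have : n - j ≠ 0 := by omega
      exact_mod_cast this

lemma meromorphicAt_iteratedDeriv {f : ℂ → ℂ} {x : ℂ} (h : MeromorphicAt f x) (j : ℕ) :
    MeromorphicAt (iteratedDeriv j f) x := by
  induction j with
  | zero => simpa using h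
  | succ j ih => rw [iteratedDeriv_succ]; exact ih.deriv

lemma analyticAt_iteratedDeriv {f : ℂ → ℂ} {x : ℂ} (h : AnalyticAt ℂ f x) (j : ℕ) :
    AnalyticAt ℂ (iteratedDeriv j f) x := by
  rw [iteratedDeriv_eq_iterate]; exact h.iterated_deriv j

lemma iteratedDeriv_add_of_add {f : ℂ → ℂ} {l μ : ℂ} (h : ∀ x, f (x + l) = μ * f x) (j : ℕ) (x : ℂ) :
    iteratedDeriv j f (x + l) = μ * iteratedDeriv j f x := by
  rw [← congrFun (iteratedDeriv_comp_add_const j f l) x, show (fun z => f (z + l)) =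
    fun z => μ * f z from funext h, iteratedDeriv_const_mul_field]

lemma analyticAt_exp_mul (κ x : ℂ) : AnalyticAt ℂ (fun z => Complex.exp (κ * z)) x :=
  (analyticAt_const.mul analyticAt_id).cexp

lemma exp_mul_mem_ordGE (κ : ℂ) {x : ℂ} {n : ℤ} {f : ℂ → ℂ} (hf : f ∈ ordGE x n) :
    (fun z => Complex.exp (κ * z) * f z) ∈ ordGE x n := by
  simpa using mul_mem_ordGE (analyticAt_exp_mul κ x).mem_ordGE hf

lemma meromorphicOrderAt_exp_mul (κ : ℂ) {x : ℂ} {n : ℤ} {f : ℂ → ℂ} (hf : MeromorphicAt f x)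
    (h : meromorphicOrderAt f x = n) :
    meromorphicOrderAt (fun z => Complex.exp (κ * z) * f z) x = n := by
  have ha := analyticAt_exp_mul κ x
  have h0 : meromorphicOrderAt (fun z => Complex.exp (κ * z)) x = 0 :=
    (tendsto_ne_zero_iff_meromorphicOrderAt_eq_zero ha.meromorphicAt).mp
      ⟨_, Complex.exp_ne_zero _, ha.continuousAt.tendsto.mono_left nhdsWithin_le_nhds⟩
  rw [show (fun z => Complex.exp (κ * z) * f z) = (fun z => Complex.exp (κ * z)) * f from rfl,
    meromorphicOrderAt_mul ha.meromorphicAt hf, h0, h, zero_add]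

lemma exp_mul_add {κ l μ : ℂ} {f : ℂ → ℂ} (h : ∀ x, f (x + l) = μ * f x) (x : ℂ) :
    Complex.exp (κ * (x + l)) * f (x + l) =
      Complex.exp (κ * l) * μ * (Complex.exp (κ * x) * f x) := by
  rw [h, mul_add, Complex.exp_add]; ring

/-- A quasi-periodic function without poles, not identically zero, has the multipliers of an
exponential. -/
lemma QuasiPer.exp_multipliers {L : PeriodPair} {μ₁ μ₂ : ℂ} {f : ℂ → ℂ} (h : QuasiPer L μ₁ μ₂ f)
    (h1 : μ₁ ≠ 0) (h2 : μ₂ ≠ 0) (hf : ∀ x, f ∈ ordGE x 0) :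
    (∀ x, f =ᶠ[𝓝[≠] x] 0) ∨
      ∃ lam : ℂ, μ₁ = Complex.exp (lam * L.ω₁) ∧ μ₂ = Complex.exp (lam * L.ω₂) := by
  obtain ⟨lam, e1, e2⟩ := exists_norm_exp_eq L h1 h2
  obtain ⟨C, hC⟩ := h.liouville hf e1 e2
  by_cases hC0 : C = 0
  · left
    intro x
    filter_upwards [hC x] with z hz
    simp [hz, hC0]
  right
  have key : ∀ w μ : ℂ, (∀ x, f (x + w) = μ * f x) → μ = Complex.exp (lam * w) := by
    intro w μ hw
    have ht : Tendsto (fun z : ℂ => z + w) (𝓝[≠] 0) (𝓝[≠] w) := by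
      simpa using tendsto_sub_nhdsNE (-w) 0
    obtain ⟨z, hz, hz'⟩ := ((hC 0).and (ht.eventually (hC w))).exists
    beta_reduce at hz hz'
    rw [hw, hz, mul_add, Complex.exp_add] at hz'
    have := Complex.exp_ne_zero (lam * z)
    apply mul_left_cancel₀ (mul_ne_zero hC0 this)
    linear_combination hz'
  exact ⟨lam, key _ _ h.1, key _ _ h.2⟩

/-- Either the multipliers are those of an exponential, or they are the multipliers of a function
`exp (κ x) Φ (x, α)` with `α` not a period. -/
lemma exists_multiplier (L : PeriodPair) {μ₁ μ₂ : ℂ} (h1 : μ₁ ≠ 0) (h2 : μ₂ ≠ 0) :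
    (∃ lam : ℂ, μ₁ = Complex.exp (lam * L.ω₁) ∧ μ₂ = Complex.exp (lam * L.ω₂)) ∨
      ∃ α κ : ℂ, α ∉ L.lattice ∧
        μ₁ = Complex.exp (-2 * zeta L (L.ω₁ / 2) * α + κ * L.ω₁) ∧
        μ₂ = Complex.exp (-2 * zeta L (L.ω₂ / 2) * α + κ * L.ω₂) := by
  -- Two linear equations for `α`, `κ`, with determinant a nonzero multiple of that of
  -- `zeta_det_ne_zero`.
  obtain ⟨α, κ, a1, a2⟩ : ∃ α κ : ℂ, -2 * zeta L (L.ω₁ / 2) * α + κ * L.ω₁ = Complex.log μ₁ ∧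
      -2 * zeta L (L.ω₂ / 2) * α + κ * L.ω₂ = Complex.log μ₂ := by
    have hd := zeta_det_ne_zero L
    set a := zeta L (L.ω₁ / 2)
    set b := zeta L (L.ω₂ / 2)
    set d := a * L.ω₂ - b * L.ω₁ with hdd
    refine ⟨-(L.ω₂ * Complex.log μ₁ - L.ω₁ * Complex.log μ₂) / (2 * d),
      (a * Complex.log μ₂ - b * Complex.log μ₁) / d, ?_, ?_⟩
    · field_simp; rw [hdd]; ring
    · field_simp; rw [hdd]; ring
  have b1 : μ₁ = Complex.exp (-2 * zeta L (L.ω₁ / 2) * α + κ * L.ω₁) := by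
    rw [a1, Complex.exp_log h1]
  have b2 : μ₂ = Complex.exp (-2 * zeta L (L.ω₂ / 2) * α + κ * L.ω₂) := by
    rw [a2, Complex.exp_log h2]
  by_cases hα : α ∈ L.lattice
  swap
  · exact Or.inr ⟨α, κ, hα, b1, b2⟩
  left
  -- When `α` is a period, the zeros of `σ(x - α)` cancel the poles of `1 / σ(x)`. So `τ` has the
  -- given multipliers and no poles, and is not identically zero; Liouville makes the multipliers
  -- exponential.
  set τ : ℂ → ℂ := fun x => Complex.exp (κ * x) * (sigma L (x - α) * (sigma L x)⁻¹) with hτ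
  have hper : ∀ w, w ∉ L.lattice → 2 * w ∈ L.lattice → ∀ x, τ (x + 2 * w) =
      Complex.exp (-2 * zeta L w * α + κ * (2 * w)) * τ x := by
    intro w hw h2w x
    have : ∀ x, sigma L (x + 2 * w - α) * (sigma L (x + 2 * w))⁻¹ =
        Complex.exp (-2 * zeta L w * α) * (sigma L (x - α) * (sigma L x)⁻¹) := by
      intro x
      rw [show x + 2 * w - α = x - α + 2 * w by ring, sigma_add_two_mul L hw h2w,
        sigma_add_two_mul L hw h2w, show 2 * zeta L w * (x - α + w) =
          -2 * zeta L w * α + 2 * zeta L w * (x + w) by ring, Complex.exp_add, mul_inv, neg_mul,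
          inv_neg]
      have := Complex.exp_ne_zero (2 * zeta L w * (x + w))
      field_simp
    have := exp_mul_add (κ := κ) (f := fun x => sigma L (x - α) * (sigma L x)⁻¹) this x
    rw [hτ]
    beta_reduce at this ⊢
    rw [this, Complex.exp_add]; ring
  have hq : QuasiPer L μ₁ μ₂ τ := by
    have p1 := hper (L.ω₁ / 2) L.ω₁_div_two_notMem_lattice two_mul_half_mem₁
    have p2 := hper (L.ω₂ / 2) L.ω₂_div_two_notMem_lattice two_mul_half_mem₂
    simp only [mul_div_cancel₀ _ (two_ne_zero (α := ℂ))] at p1 p2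
    rw [← b1] at p1
    rw [← b2] at p2
    exact ⟨p1, p2⟩
  have hτ0 : ∀ x ∉ L.lattice, τ x ≠ 0 := fun x hx => mul_ne_zero (Complex.exp_ne_zero _)
    (mul_ne_zero (sigma_ne_zero L fun h => hx (by simpa using add_mem h hα))
      (inv_ne_zero (sigma_ne_zero L hx)))
  have han : ∀ x, AnalyticAt ℂ (fun z => sigma L (z - α)) x := fun x =>
    AnalyticAt.fun_comp (f := fun z => z - α) (analyticAt_sigma L _) (by fun_prop)
  have hord : ∀ x, τ ∈ ordGE x 0 := by
    have h0 : τ ∈ ordGE 0 0 := by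
      have i1 : (fun z => sigma L (z - α)) ∈ ordGE 0 1 := by
        refine mem_ordGE_one_of_tendsto (han 0).meromorphicAt ?_
        have := (han 0).continuousAt.tendsto.mono_left (nhdsWithin_le_nhds (s := {0}ᶜ))
        rwa [zero_sub, (sigma_eq_zero_iff L).mpr (neg_mem hα)] at this
      have i2 : (fun z => (sigma L z)⁻¹) ∈ ordGE 0 (0 - 1) := by
        refine mem_ordGE_of_zpow_mul (mem_ordGE_zero_of_tendsto (c := 1) ?_ ?_)
        · exact MeromorphicAt.fun_mul (by fun_prop) (analyticAt_sigma L 0).meromorphicAt.fun_inv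
        · refine (tendsto_sigma_div L).congr fun z => ?_
          simp [div_eq_mul_inv]
      exact exp_mul_mem_ordGE κ (by simpa using mul_mem_ordGE i1 i2)
    intro x
    by_cases hx : x ∈ L.lattice
    · simpa using hq.mem_ordGE_add h1 h2 hx h0
    · exact exp_mul_mem_ordGE κ
        ((han x).fun_mul ((analyticAt_sigma L x).fun_inv (sigma_ne_zero L hx))).mem_ordGE
  rcases hq.exp_multipliers h1 h2 hord with h | h
  · obtain ⟨z, hz, hz'⟩ := ((h 0).and (eventually_notMem_lattice L 0)).exists
    exact absurd hz (hτ0 z hz')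
  · exact h

end HermiteKrichever

end

/-! ### The generic form -/

noncomputable section
namespace HermiteKrichever
namespace HKData
variable {D : HKData}

/-- The quasi-periodic functions without poles off the half lattice. -/
def quasiSpace (D : HKData) (μ₁ μ₂ : ℂ) : Submodule ℂ (ℂ → ℂ) where
  carrier := {f | QuasiPer D.L μ₁ μ₂ f ∧ ∀ x ∉ D.halfLattice, f ∈ ordGE x 0}
  zero_mem' := ⟨⟨by simp, by simp⟩, fun x _ => (ordGE x 0).zero_mem⟩
  add_mem' := fun {f g} hf hg => ⟨⟨fun x => by simp [hf.1.1, hg.1.1]; ring,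
    fun x => by simp [hf.1.2, hg.1.2]; ring⟩, fun x hx => (ordGE x 0).add_mem (hf.2 x hx) (hg.2 x hx)⟩
  smul_mem' := fun c f hf => ⟨⟨fun x => by simp [hf.1.1]; ring,
    fun x => by simp [hf.1.2]; ring⟩, fun x hx => (ordGE x 0).smul_mem c (hf.2 x hx)⟩

lemma neg_ω_add_ω_notMem {i j : Fin 4} (h : j ≠ i) : -D.ω j + D.ω i ∉ D.L.lattice := fun hm =>
  D.ω_sub_ω_notMem h.symm (by rwa [neg_add_eq_sub] at hm)

lemma mem_ordGE_zero_of_mem_quasiSpace {μ₁ μ₂ : ℂ} (h1 : μ₁ ≠ 0) (h2 : μ₂ ≠ 0) {f : ℂ → ℂ}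
    (hf : f ∈ D.quasiSpace μ₁ μ₂) {x : ℂ} (h : ∀ i, x + D.ω i ∈ D.L.lattice →
      f ∈ ordGE (-D.ω i) 0) : f ∈ ordGE x 0 := by
  by_cases hx : x ∈ D.halfLattice
  · obtain ⟨i, hi⟩ := D.exists_sub_ω_mem hx
    have hi' : x + D.ω i ∈ D.L.lattice := by
      have := add_mem hi (D.two_mul_ω_mem i)
      rwa [show x - D.ω i + 2 * D.ω i = x + D.ω i by ring] at this
    have := hf.1.mem_ordGE_add h1 h2 hi' (h i hi')
    rwa [show -D.ω i + (x + D.ω i) = x by ring] at this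
  · exact hf.2 x hx

lemma two_mul_ω_one (D : HKData) : 2 * D.ω 1 = D.L.ω₁ := mul_div_cancel₀ _ two_ne_zero

lemma two_mul_ω_three (D : HKData) : 2 * D.ω 3 = D.L.ω₂ := mul_div_cancel₀ _ two_ne_zero

lemma Phi_add (D : HKData) (i : Fin 4) (α : ℂ) {j : Fin 4} (hj : j ≠ 0) (x : ℂ) :
    D.Phi i α (x + 2 * D.ω j) =
      Complex.exp (-2 * D.η j * α + 2 * D.ω j * zeta D.L α) * D.Phi i α x := by
  have hw := D.ω_notMem hj
  have h2w := D.two_mul_ω_mem j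
  unfold Phi η
  rw [show x + 2 * D.ω j + D.ω i - α = x + D.ω i - α + 2 * D.ω j by ring,
    show x + 2 * D.ω j + D.ω i = x + D.ω i + 2 * D.ω j by ring, sigma_add_two_mul D.L hw h2w,
    sigma_add_two_mul D.L hw h2w, show 2 * zeta D.L (D.ω j) * (x + D.ω i - α + D.ω j) =
      -2 * zeta D.L (D.ω j) * α + 2 * zeta D.L (D.ω j) * (x + D.ω i + D.ω j) by ring,
    Complex.exp_add, show zeta D.L α * (x + 2 * D.ω j) = 2 * D.ω j * zeta D.L α + zeta D.L α * x by
      ring, Complex.exp_add (2 * D.ω j * zeta D.L α), Complex.exp_add _ (2 * D.ω j * zeta D.L α)]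
  have := Complex.exp_ne_zero (2 * zeta D.L (D.ω j) * (x + D.ω i + D.ω j))
  field_simp

lemma analyticAt_Phi (D : HKData) {i : Fin 4} (α : ℂ) {x : ℂ} (hx : x + D.ω i ∉ D.L.lattice) :
    AnalyticAt ℂ (D.Phi i α) x := by
  have h1 : AnalyticAt ℂ (fun z => sigma D.L (z + D.ω i - α)) x :=
    AnalyticAt.fun_comp (f := fun z => z + D.ω i - α) (analyticAt_sigma D.L _) (by fun_prop)
  have h2 : AnalyticAt ℂ (fun z => sigma D.L (z + D.ω i)) x :=
    AnalyticAt.fun_comp (f := fun z => z + D.ω i) (analyticAt_sigma D.L _) (by fun_prop)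
  exact (h1.fun_div h2 (sigma_ne_zero D.L hx)).fun_mul (analyticAt_exp_mul _ x)

/-- The zero of the denominator is simple and the numerator has the value `σ(-α)`, which is nonzero
precisely because `α` is not a period. -/
lemma meromorphicOrderAt_Phi (D : HKData) (i : Fin 4) {α : ℂ} (hα : α ∉ D.L.lattice) :
    MeromorphicAt (D.Phi i α) (-D.ω i) ∧
      meromorphicOrderAt (D.Phi i α) (-D.ω i) = ((-1 : ℤ) : WithTop ℤ) := by
  have h1 : AnalyticAt ℂ (fun z => sigma D.L (z + D.ω i - α)) (-D.ω i) :=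
    AnalyticAt.fun_comp (f := fun z => z + D.ω i - α) (analyticAt_sigma D.L _) (by fun_prop)
  have h2 : AnalyticAt ℂ (fun z => sigma D.L (z + D.ω i)) (-D.ω i) :=
    AnalyticAt.fun_comp (f := fun z => z + D.ω i) (analyticAt_sigma D.L _) (by fun_prop)
  have h3 := analyticAt_exp_mul (zeta D.L α) (-D.ω i)
  have hm : MeromorphicAt (D.Phi i α) (-D.ω i) :=
    (h1.meromorphicAt.fun_div h2.meromorphicAt).fun_mul h3.meromorphicAt
  refine ⟨hm, order_eq_of_tendsto hm (c := sigma D.L (-α) * 1 *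
    Complex.exp (zeta D.L α * -D.ω i)) ?_ ?_⟩
  · exact mul_ne_zero (mul_ne_zero (sigma_ne_zero D.L (by simpa using hα)) one_ne_zero)
      (Complex.exp_ne_zero _)
  · have t := tendsto_sub_nhdsNE (-D.ω i) (-D.ω i)
    rw [sub_self] at t
    have t1 := h1.continuousAt.tendsto.mono_left (nhdsWithin_le_nhds (s := {-D.ω i}ᶜ))
    have t3 := h3.continuousAt.tendsto.mono_left (nhdsWithin_le_nhds (s := {-D.ω i}ᶜ))
    rw [neg_add_cancel, zero_sub] at t1
    refine ((t1.mul ((tendsto_sigma_div D.L).comp t)).mul t3).congr fun z => ?_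
    simp only [Phi, Function.comp_apply, sub_neg_eq_add, neg_neg, zpow_one]
    ring

/-- The generic form. -/
lemma exists_ansatz {α κ : ℂ} (hα : α ∉ D.L.lattice) {μ₁ μ₂ : ℂ}
    (h1 : μ₁ = Complex.exp (-2 * zeta D.L (D.L.ω₁ / 2) * α + κ * D.L.ω₁))
    (h2 : μ₂ = Complex.exp (-2 * zeta D.L (D.L.ω₂ / 2) * α + κ * D.L.ω₂))
    (hexp : ¬∃ lam : ℂ, μ₁ = Complex.exp (lam * D.L.ω₁) ∧ μ₂ = Complex.exp (lam * D.L.ω₂))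
    {f : ℂ → ℂ} (hf : f ∈ D.quasiSpace μ₁ μ₂) (hfB : ∀ i, f ∈ ordGE (-D.ω i) (-(D.lt i : ℤ))) :
    ∃ c : Fin 4 → ℕ → ℂ, ∀ x, f =ᶠ[𝓝[≠] x] fun x => Complex.exp ((κ - zeta D.L α) * x) *
      ∑ i, ∑ j ∈ Finset.range (D.lt i), c i j * iteratedDeriv j (D.Phi i α) x := by
  have n1 : μ₁ ≠ 0 := h1 ▸ Complex.exp_ne_zero _
  have n2 : μ₂ ≠ 0 := h2 ▸ Complex.exp_ne_zero _
  -- The exponent `κ - ζ(α)` compensates the factor `exp(ζ(α) x)` inside `Φ_i`, so that `G i j` has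
  -- exactly the multipliers `μ₁`, `μ₂`; its pole at `-ω i` has order `j + 1`.
  set G : Fin 4 → ℕ → ℂ → ℂ := fun i j x =>
    Complex.exp ((κ - zeta D.L α) * x) * iteratedDeriv j (D.Phi i α) x with hG
  have hper : ∀ i j, QuasiPer D.L μ₁ μ₂ (G i j) := by
    intro i j
    refine ⟨fun x => ?_, fun x => ?_⟩
    · rw [← two_mul_ω_one]
      refine (exp_mul_add (κ := κ - zeta D.L α) (fun x => iteratedDeriv_add_of_add
        (D.Phi_add i α (j := 1) (by decide)) j x) x).trans ?_
      rw [two_mul_ω_one, h1, ← Complex.exp_add, hG]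
      congr 2
      simp only [η]
      rw [show D.ω 1 = D.L.ω₁ / 2 from rfl]; ring
    · rw [← two_mul_ω_three]
      refine (exp_mul_add (κ := κ - zeta D.L α) (fun x => iteratedDeriv_add_of_add
        (D.Phi_add i α (j := 3) (by decide)) j x) x).trans ?_
      rw [two_mul_ω_three, h2, ← Complex.exp_add, hG]
      congr 2
      simp only [η]
      rw [show D.ω 3 = D.L.ω₂ / 2 from rfl]; ring
  have hreg : ∀ i j x, x + D.ω i ∉ D.L.lattice → G i j ∈ ordGE x 0 := fun i j x hx =>
    exp_mul_mem_ordGE _ (analyticAt_iteratedDeriv (D.analyticAt_Phi α hx) j).mem_ordGE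
  obtain ⟨c, hc, hcB⟩ := exists_sub_sum_mem (D.quasiSpace μ₁ μ₂)
    (fun i n => ordGE (-D.ω i) (-(n : ℤ))) D.lt G
    (fun i j _ => ⟨hper i j, fun x hx => hreg i j x fun h => hx (D.add_ω_mem_halfLattice h)⟩)
    (fun i j _ i' hi' => by simpa using hreg i j _ (neg_ω_add_ω_notMem hi'))
    (fun i n _ g _ hg => by
      have hP := D.meromorphicOrderAt_Phi i hα
      have hm := meromorphicAt_iteratedDeriv hP.1 n
      have ho := meromorphicOrderAt_exp_mul (κ - zeta D.L α) hm
        (meromorphicOrderAt_iteratedDeriv (by norm_num) hP.2 n)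
      rw [show -((n + 1 : ℕ) : ℤ) = -1 - n by omega] at hg
      obtain ⟨c, hc⟩ := exists_sub_smul_mem_ordGE hg
        ((analyticAt_exp_mul _ _).meromorphicAt.fun_mul hm) ho
      refine ⟨c, ?_⟩
      rwa [show (-1 - n + 1 : ℤ) = -n by ring] at hc) hf hfB
  refine ⟨c, fun x => ?_⟩
  -- The remainder has no poles; were it nonzero, its multipliers would be those of an exponential.
  rcases hc.1.exp_multipliers n1 n2 (fun x => mem_ordGE_zero_of_mem_quasiSpace n1 n2 hc
    fun i _ => by simpa using hcB i) with h | h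
  · filter_upwards [h x] with z hz
    simp only [Pi.sub_apply, Finset.sum_apply, Pi.smul_apply, smul_eq_mul, hG, Pi.zero_apply] at hz
    rw [sub_eq_zero.mp hz]
    simp only [Finset.mul_sum]
    exact Finset.sum_congr rfl fun i _ => Finset.sum_congr rfl fun j _ => by ring
  · exact absurd h hexp

end HKData
end HermiteKrichever

end

/-! ### The degenerate form -/

noncomputable section
namespace HermiteKrichever
namespace HKData
variable {D : HKData}

/-- In the `σ`-quotient for `℘(z) - ℘(x)` at a half period `x`, quasi-periodicity turns `σ(z + x)`
into an exponential times `-σ(z - x)`, so the numerator contains `σ(z - x) ^ 2`. -/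
lemma order_wp_sub_e {x : ℂ} {i : Fin 4} (hi : i ≠ 0) (hx : x + D.ω i ∈ D.L.lattice) :
    meromorphicOrderAt (fun z => D.L.weierstrassP z - D.e i) x = ((2 : ℤ) : WithTop ℤ) := by
  have h2x : 2 * x ∈ D.L.lattice := D.add_ω_mem_halfLattice hx
  have hxL : x ∉ D.L.lattice := fun h => D.ω_notMem hi (by simpa using sub_mem hx h)
  have he : D.e i = D.L.weierstrassP x := by
    rw [e, ← D.L.weierstrassP_neg (D.ω i), ← wp_add_mem D.L hx]; simp
  refine order_eq_of_tendsto (meromorphicAt_wp_sub D.L _ x)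
    (c := Complex.exp (2 * zeta D.L x * x) * (1⁻¹) ^ 2 / (sigma D.L x ^ 2 * sigma D.L x ^ 2)) ?_ ?_
  · have := sigma_ne_zero D.L hxL
    simp [this]
  have t := tendsto_sub_nhdsNE x x
  rw [sub_self] at t
  have t1 := (((tendsto_sigma_div D.L).comp t).inv₀ one_ne_zero).pow 2
  have t2 := (analyticAt_exp_mul (2 * zeta D.L x) x).continuousAt.tendsto.mono_left
    (nhdsWithin_le_nhds (s := {x}ᶜ))
  have t3 := (analyticAt_sigma D.L x).continuousAt.tendsto.mono_left (nhdsWithin_le_nhds (s := {x}ᶜ))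
  refine ((t2.mul t1).div ((t3.pow 2).mul_const (sigma D.L x ^ 2)) ?_).congr' ?_
  · have := sigma_ne_zero D.L hxL
    simp [this]
  filter_upwards [eventually_notMem_lattice D.L x] with z hz
  rw [he, wp_sub_wp D.L hxL hz, show z + x = z - x + 2 * x by ring,
    sigma_add_two_mul D.L hxL h2x, sub_add_cancel]
  simp only [Function.comp_apply, inv_div, Pi.div_apply]
  rw [show (-2 : ℤ) = -((2 : ℕ) : ℤ) by norm_num, zpow_neg, zpow_natCast, div_pow]
  ring

/-- The functions `℘' / (℘ - e i)` have simple poles at the points of `L` and of `ω i + L`. -/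
lemma logDeriv_wp_sub_e (D : HKData) {i : Fin 4} (hi : i ≠ 0) (x : ℂ) :
    MeromorphicAt (fun z => D.L.derivWeierstrassP z / (D.L.weierstrassP z - D.e i)) x ∧
    (x ∉ D.L.lattice → x + D.ω i ∉ D.L.lattice →
      (fun z => D.L.derivWeierstrassP z / (D.L.weierstrassP z - D.e i)) ∈ ordGE x 0) ∧
    (x ∈ D.L.lattice ∨ x + D.ω i ∈ D.L.lattice → meromorphicOrderAt
      (fun z => D.L.derivWeierstrassP z / (D.L.weierstrassP z - D.e i)) x =
        ((-1 : ℤ) : WithTop ℤ)) := by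
  have hm : MeromorphicAt (fun z => D.L.derivWeierstrassP z / (D.L.weierstrassP z - D.e i)) x :=
    (D.L.meromorphic_derivWeierstrassP x).fun_div (meromorphicAt_wp_sub D.L _ x)
  have key : ∀ n : ℤ, n ≠ 0 → meromorphicOrderAt (fun z => D.L.weierstrassP z - D.e i) x = n →
      meromorphicOrderAt
      (fun z => D.L.derivWeierstrassP z / (D.L.weierstrassP z - D.e i)) x =
        ((-1 : ℤ) : WithTop ℤ) := fun n hn h => by
    refine order_eq_of_tendsto hm (c := n) (by exact_mod_cast hn) ?_
    refine (tendsto_mul_logDeriv (meromorphicAt_wp_sub D.L _ x) h).congr' ?_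
    filter_upwards [eventually_notMem_lattice D.L x] with z hz
    rw [((hasDerivAt_wp D.L hz).sub_const (D.e i)).deriv, neg_neg, zpow_one]
  refine ⟨hm, fun h1 h2 => ?_, ?_⟩
  · exact ((analyticAt_wp' D.L h1).fun_div ((analyticAt_wp D.L h1).fun_sub analyticAt_const)
      (sub_ne_zero.mpr fun h => by
        rcases (wp_eq_wp_iff D.L (D.ω_notMem hi) h1).mp h with h | h
        · refine h2 ?_
          have := add_mem h (D.two_mul_ω_mem i)
          rwa [show x - D.ω i + 2 * D.ω i = x + D.ω i by ring] at this
        · exact h2 h)).mem_ordGE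
  · rintro (h | h)
    · exact key _ (by norm_num) (order_wp_sub D.L h _)
    · exact key _ (by norm_num) (order_wp_sub_e hi h)

lemma wp_comp_add_order (D : HKData) (i : Fin 4) :
    MeromorphicAt (fun z => D.L.weierstrassP (z + D.ω i)) (-D.ω i) ∧
      meromorphicOrderAt (fun z => D.L.weierstrassP (z + D.ω i)) (-D.ω i) =
        ((-2 : ℤ) : WithTop ℤ) := by
  have hm : MeromorphicAt (fun z => D.L.weierstrassP (z + D.ω i)) (-D.ω i) :=
    MeromorphicAt.comp_analyticAt (g := fun x => x + D.ω i) (D.L.meromorphic_weierstrassP _)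
      (by fun_prop)
  refine ⟨hm, order_eq_of_tendsto hm one_ne_zero ?_⟩
  have h := tendsto_sub_nhdsNE (-D.ω i) (-D.ω i)
  rw [sub_self] at h
  refine ((tendsto_sq_mul_wp D.L).comp h).congr fun z => ?_
  simp only [Function.comp_apply, sub_neg_eq_add]
  norm_cast

/-- The degenerate form. -/
lemma exists_degenerateAnsatz {κ : ℂ} {f : ℂ → ℂ}
    (hf : f ∈ D.quasiSpace (Complex.exp (κ * D.L.ω₁)) (Complex.exp (κ * D.L.ω₂)))
    (hfB : ∀ i, f ∈ ordGE (-D.ω i) (-(D.lt i : ℤ))) :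
    ∃ (c₀ : ℂ) (c : Fin 4 → ℕ → ℂ) (c' : Fin 3 → ℂ),
      ∀ x, f =ᶠ[𝓝[≠] x] fun x => Complex.exp (κ * x) *
      (c₀ + (∑ i, ∑ j ∈ Finset.range (D.lt i - 1),
          c i j * iteratedDeriv j (fun y => D.L.weierstrassP (y + D.ω i)) x)
        + ∑ i : Fin 3, c' i * (D.L.derivWeierstrassP x / (D.L.weierstrassP x - D.e i.succ))) := by
  set W := D.quasiSpace (Complex.exp (κ * D.L.ω₁)) (Complex.exp (κ * D.L.ω₂)) with hW
  have n1 := Complex.exp_ne_zero (κ * D.L.ω₁)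
  have n2 := Complex.exp_ne_zero (κ * D.L.ω₂)
  have hexpW : ∀ g : ℂ → ℂ, (∀ l ∈ D.L.lattice, ∀ x, g (x + l) = g x) →
      (∀ x ∉ D.halfLattice, g ∈ ordGE x 0) → (fun x => Complex.exp (κ * x) * g x) ∈ W := by
    intro g hg hx
    refine ⟨⟨fun x => ?_, fun x => ?_⟩, fun x h => exp_mul_mem_ordGE _ (hx x h)⟩
    · simp only [hg _ D.L.ω₁_mem_lattice, mul_add, Complex.exp_add]; ring
    · simp only [hg _ D.L.ω₂_mem_lattice, mul_add, Complex.exp_add]; ring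
  set G : Fin 4 → ℕ → ℂ → ℂ := fun i j x => Complex.exp (κ * x) *
    iteratedDeriv j (fun y => D.L.weierstrassP (y + D.ω i)) x with hG
  have hreg : ∀ i j x, x + D.ω i ∉ D.L.lattice →
      iteratedDeriv j (fun y => D.L.weierstrassP (y + D.ω i)) ∈ ordGE x 0 := fun i j x hx =>
    (analyticAt_iteratedDeriv (analyticAt_wp_add D.L hx) j).mem_ordGE
  obtain ⟨c, hc, hcB⟩ := exists_sub_sum_mem W
    -- The `j`-th derivative of `℘` has a pole of order `j + 2`, so simple poles cannot be removed
    -- here: level `n` stands for pole order at most `n + 1`.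
    (fun i n => ordGE (-D.ω i) (-((n + 1 : ℕ) : ℤ))) (fun i => D.lt i - 1) G
    (fun i j _ => hexpW _ (fun l hl x => by
      have := iteratedDeriv_add_of_add (f := fun y => D.L.weierstrassP (y + D.ω i)) (l := l) (μ := 1)
        (fun x => by rw [add_right_comm, wp_add_mem D.L hl, one_mul]) j x
      rwa [one_mul] at this) fun x hx => hreg i j x fun h => hx (D.add_ω_mem_halfLattice h))
    (fun i j _ i' hi' => ordGE_mono (by norm_num)
      (exp_mul_mem_ordGE κ (hreg i j _ (neg_ω_add_ω_notMem hi'))))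
    (fun i n _ g _ hg => by
      have hP := D.wp_comp_add_order i
      have hm := meromorphicAt_iteratedDeriv hP.1 n
      have ho := meromorphicOrderAt_exp_mul κ hm
        (meromorphicOrderAt_iteratedDeriv (by norm_num) hP.2 n)
      rw [show -((n + 1 + 1 : ℕ) : ℤ) = -2 - n by omega] at hg
      obtain ⟨c, hc⟩ := exists_sub_smul_mem_ordGE hg
        ((analyticAt_exp_mul _ _).meromorphicAt.fun_mul hm) ho
      refine ⟨c, ?_⟩
      rwa [show (-2 - n + 1 : ℤ) = -((n + 1 : ℕ) : ℤ) by omega] at hc) hf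
    -- For `lt i = 0` the truncated difference `lt i - 1` is `0`, and the bound by a simple pole is
    -- merely weaker.
    (fun i => ordGE_mono (by omega) (hfB i))
  set g := f - ∑ i, ∑ j ∈ Finset.range (D.lt i - 1), c i j • G i j with hg
  set G' : Fin 3 → ℕ → ℂ → ℂ := fun i _ x => Complex.exp (κ * x) *
    (D.L.derivWeierstrassP x / (D.L.weierstrassP x - D.e i.succ)) with hG'
  have hωL : ∀ i : Fin 4, i ≠ 0 → -D.ω i ∉ D.L.lattice := fun i hi h =>
    D.ω_notMem hi (by simpa using neg_mem h)
  -- The functions `℘' / (℘ - e i)` remove the simple poles at `ω 1`, `ω 2`, `ω 3` at the price of a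
  -- simple pole at `0`, which the ambient space permits.
  obtain ⟨c', hc', hcB'⟩ := exists_sub_sum_mem (W ⊓ ordGE 0 (-1))
    (fun i : Fin 3 => fun n => ordGE (-D.ω i.succ) (-(n : ℤ))) (fun _ => 1) G'
    (fun i j _ => ⟨hexpW _ (fun l hl x => by rw [wp_add_mem D.L hl, wp'_add_mem D.L hl]) fun x hx =>
      (D.logDeriv_wp_sub_e i.succ_ne_zero x).2.1 (notMem_lattice_of_notMem_halfLattice hx)
        fun h => hx (D.add_ω_mem_halfLattice h),
      exp_mul_mem_ordGE κ (mem_ordGE_of_eq (D.logDeriv_wp_sub_e i.succ_ne_zero 0).1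
        ((D.logDeriv_wp_sub_e i.succ_ne_zero 0).2.2 (Or.inl (zero_mem _))))⟩)
    (fun i j _ i' hi' => by
      simpa using exp_mul_mem_ordGE κ ((D.logDeriv_wp_sub_e i.succ_ne_zero _).2.1
        (hωL i'.succ i'.succ_ne_zero) (neg_ω_add_ω_notMem (by simpa using hi'))))
    (fun i n hn u _ hu => by
      obtain rfl : n = 0 := by omega
      have hP := D.logDeriv_wp_sub_e i.succ_ne_zero (-D.ω i.succ)
      obtain ⟨a, ha⟩ := exists_sub_smul_mem_ordGE (n := -1) (by simpa using hu)
        ((analyticAt_exp_mul κ _).meromorphicAt.fun_mul hP.1)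
        (meromorphicOrderAt_exp_mul κ hP.1 (hP.2.2 (Or.inr (by simp))))
      exact ⟨a, by simpa using ha⟩)
    (f := g) ⟨hc, by simpa [ω_zero] using hcB 0⟩ (fun i => by simpa using hcB i.succ)
  set u := g - ∑ i, ∑ j ∈ Finset.range 1, c' i j • G' i j with hu
  have hell : Ell D.L (fun x => Complex.exp (-κ * x) * u x) := by
    refine ⟨fun x => ?_, fun x => ?_⟩
    · refine (exp_mul_add hc'.1.1.1 x).trans ?_
      rw [← Complex.exp_add]; simp
    · refine (exp_mul_add hc'.1.1.2 x).trans ?_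
      rw [← Complex.exp_add]; simp
  -- Only a simple pole at the periods can be left, so the elliptic quotient by the exponential is
  -- constant.
  obtain ⟨C, hC⟩ := hell.eventually_const_of_simple_pole (exp_mul_mem_ordGE _ hc'.2) fun x hx =>
    exp_mul_mem_ordGE _ (mem_ordGE_zero_of_mem_quasiSpace n1 n2 hc'.1 fun i hi => by
      obtain rfl | ⟨j, rfl⟩ := Fin.eq_zero_or_eq_succ i
      · exact absurd (by simpa [ω_zero] using hi) hx
      · simpa using hcB' j)
  refine ⟨C, c, fun i => c' i 0, fun x => ?_⟩
  filter_upwards [hC x] with z hz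
  have hE : Complex.exp (κ * z) * Complex.exp (-κ * z) = 1 := by rw [← Complex.exp_add]; simp
  have hz' : u z = Complex.exp (κ * z) * C := by
    rw [← hz, ← mul_assoc, hE, one_mul]
  simp only [hu, hg, hG, hG', Pi.sub_apply, Finset.sum_apply, Pi.smul_apply, smul_eq_mul,
    Finset.sum_range_one] at hz'
  rw [sub_sub, sub_eq_iff_eq_add] at hz'
  rw [hz', mul_add, mul_add]
  simp only [Finset.mul_sum]
  rw [add_assoc]
  congr 1
  congr 1
  · exact Finset.sum_congr rfl fun i _ => Finset.sum_congr rfl fun j _ => by ring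
  · exact Finset.sum_congr rfl fun i _ => by ring

end HKData
end HermiteKrichever

end

/-! ### The dichotomy and the multipliers of the two forms -/

noncomputable section
namespace HermiteKrichever
namespace HKData
variable {D : HKData}

/-- The two cases are whether or not the multipliers are those of an exponential. The expansions
hold on punctured neighbourhoods, and since both sides are continuous off the half lattice they hold
at each of its points. -/
lemma exists_ansatz_or_degenerateAnsatz (hδ : ∀ k, 2 * D.δ k ∉ D.L.lattice)
    (hb : Function.Injective D.b) {f : ℂ → ℂ} (hf : D.Sol f) {μ₁ μ₂ : ℂ} (h1 : μ₁ ≠ 0)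
    (h2 : μ₂ ≠ 0) (hq : QuasiPer D.L μ₁ μ₂ f) {Λ : ℂ → ℂ} (hΛ : AnalyticOnNhd ℂ Λ D.halfLatticeᶜ)
    (hΛf : ∀ x, Λ =ᶠ[𝓝[≠] x] f) :
    (∃ (α κ : ℂ) (c : Fin 4 → ℕ → ℂ), D.IsAnsatz Λ α κ c) ∨
      (∃ (κ c₀ : ℂ) (c : Fin 4 → ℕ → ℂ) (c' : Fin 3 → ℂ), D.IsDegenerateAnsatz Λ κ c₀ c c') := by
  have hW : f ∈ D.quasiSpace μ₁ μ₂ := ⟨hq, fun x hx => hf.mem_ordGE_zero hδ hb hx⟩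
  have hB : ∀ i, f ∈ ordGE (-D.ω i) (-(D.lt i : ℤ)) := fun i => hf.mem_ordGE_half hδ (by
    rw [show -D.ω i - D.ω i = -(2 * D.ω i) by ring]
    exact neg_mem (D.two_mul_ω_mem i))
  by_cases hexp : ∃ lam : ℂ, μ₁ = Complex.exp (lam * D.L.ω₁) ∧ μ₂ = Complex.exp (lam * D.L.ω₂)
  · right
    obtain ⟨κ, rfl, rfl⟩ := hexp
    obtain ⟨c₀, c, c', hc⟩ := exists_degenerateAnsatz hW hB
    refine ⟨κ, c₀, c, c', fun x hx => eq_of_eventuallyEq_nhdsNE (hΛ x hx).continuousAt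
      (AnalyticAt.continuousAt (𝕜 := ℂ) ?_) ((hΛf x).trans (hc x))⟩
    have hxL := notMem_lattice_of_notMem_halfLattice hx
    refine (analyticAt_exp_mul κ x).fun_mul ((analyticAt_const.fun_add
      (Finset.analyticAt_fun_sum _ fun i _ => Finset.analyticAt_fun_sum _ fun j _ =>
        analyticAt_const.fun_mul (analyticAt_iteratedDeriv (analyticAt_wp_add D.L fun h =>
          hx (D.add_ω_mem_halfLattice h)) j))).fun_add
      (Finset.analyticAt_fun_sum _ fun i _ => analyticAt_const.fun_mul ?_))
    exact (analyticAt_wp' D.L hxL).fun_div ((analyticAt_wp D.L hxL).fun_sub analyticAt_const)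
      (D.wp_sub_e_ne_zero hx i.succ_ne_zero)
  · left
    obtain ⟨α, κ, hα, e1, e2⟩ := (exists_multiplier D.L h1 h2).resolve_left hexp
    obtain ⟨c, hc⟩ := exists_ansatz hα e1 e2 hexp hW hB
    refine ⟨α, κ - zeta D.L α, c, hα, fun x hx => eq_of_eventuallyEq_nhdsNE
      (hΛ x hx).continuousAt (AnalyticAt.continuousAt (𝕜 := ℂ) ?_) ((hΛf x).trans (hc x))⟩
    exact (analyticAt_exp_mul _ x).fun_mul
      (Finset.analyticAt_fun_sum _ fun i _ => Finset.analyticAt_fun_sum _ fun j _ =>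
        analyticAt_const.fun_mul (analyticAt_iteratedDeriv (D.analyticAt_Phi α fun h =>
          hx (D.add_ω_mem_halfLattice h)) j))

lemma IsAnsatz.add_two_mul_ω {Λ : ℂ → ℂ} {α κ : ℂ} {c : Fin 4 → ℕ → ℂ} (h : D.IsAnsatz Λ α κ c)
    {j : Fin 4} (hj : j ≠ 0) {x : ℂ} (hx : x ∉ D.halfLattice) :
    Λ (x + 2 * D.ω j) = Complex.exp (-2 * D.η j * α + 2 * D.ω j * zeta D.L α
      + 2 * κ * D.ω j) * Λ x := by
  rw [h.2 x hx, h.2 _ fun h' => hx ((add_mem_halfLattice (D.two_mul_ω_mem j)).mp h')]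
  simp only [iteratedDeriv_add_of_add (D.Phi_add _ α hj)]
  rw [mul_add κ, Complex.exp_add, Complex.exp_add _ (2 * κ * D.ω j),
    show κ * (2 * D.ω j) = 2 * κ * D.ω j by ring]
  simp only [mul_left_comm (c _ _), ← Finset.mul_sum]
  ring

lemma IsDegenerateAnsatz.add_two_mul_ω {Λ : ℂ → ℂ} {κ c₀ : ℂ} {c : Fin 4 → ℕ → ℂ} {c' : Fin 3 → ℂ}
    (h : D.IsDegenerateAnsatz Λ κ c₀ c c') (j : Fin 4) {x : ℂ} (hx : x ∉ D.halfLattice) :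
    Λ (x + 2 * D.ω j) = Complex.exp (2 * κ * D.ω j) * Λ x := by
  have hl := D.two_mul_ω_mem j
  have hper : ∀ i n, iteratedDeriv n (fun y => D.L.weierstrassP (y + D.ω i)) (x + 2 * D.ω j) =
      iteratedDeriv n (fun y => D.L.weierstrassP (y + D.ω i)) x := fun i n => by
    have := iteratedDeriv_add_of_add (f := fun y => D.L.weierstrassP (y + D.ω i)) (l := 2 * D.ω j)
      (μ := 1) (fun x => by rw [add_right_comm, wp_add_mem D.L hl, one_mul]) n x
    rwa [one_mul] at this
  rw [h x hx, h _ fun h' => hx ((add_mem_halfLattice hl).mp h')]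
  simp only [hper, wp_add_mem D.L hl, wp'_add_mem D.L hl]
  rw [mul_add κ, Complex.exp_add, show κ * (2 * D.ω j) = 2 * κ * D.ω j by ring]
  ring

end HKData
end HermiteKrichever

end

theorem mainTheorem1 (D : HermiteKrichever.HKData)
    (hr : ∀ k, 0 < D.r k)
    (hδ : ∀ k, 2 * D.δ k ∉ D.L.lattice)
    (hb : Function.Injective D.b)
    (happ : ∀ k, HermiteKrichever.IsApparent D.fuchsP D.fuchsQ (D.b k)) :
    (∃ Ξ : ℂ → ℂ, D.IsXi Ξ) ∧
    ∀ Ξ : ℂ → ℂ, D.IsXi Ξ →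
      ∃ Q : ℂ, (∀ x ∉ D.sing, D.Qfun Ξ x = Q) ∧
        ∀ (U : Set ℂ) (F : ℂ → ℂ), D.IsLambdaBranch Ξ Q U F →
          ∃ Λ : ℂ → ℂ,
            (Meromorphic Λ ∧ AnalyticOnNhd ℂ Λ D.halfLatticeᶜ ∧ Set.EqOn Λ F U ∧
              ∀ x ∉ D.sing, D.Hg Λ x - (D.E + D.Cg) * Λ x = 0) ∧
            ((∃ (α κ : ℂ) (c : Fin 4 → ℕ → ℂ), D.IsAnsatz Λ α κ c) ∨
              (∃ (κ c₀ : ℂ) (c : Fin 4 → ℕ → ℂ) (c' : Fin 3 → ℂ),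
                D.IsDegenerateAnsatz Λ κ c₀ c c')) ∧
            (∀ (α κ : ℂ) (c : Fin 4 → ℕ → ℂ), D.IsAnsatz Λ α κ c →
              ∀ j : Fin 4, j = 1 ∨ j = 3 → ∀ x ∉ D.halfLattice,
                Λ (x + 2 * D.ω j) =
                  Complex.exp (-2 * D.η j * α + 2 * D.ω j * HermiteKrichever.zeta D.L α
                    + 2 * κ * D.ω j) * Λ x) ∧
            (∀ (κ c₀ : ℂ) (c : Fin 4 → ℕ → ℂ) (c' : Fin 3 → ℂ),
              D.IsDegenerateAnsatz Λ κ c₀ c c' →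
              ∀ j : Fin 4, j = 1 ∨ j = 3 → ∀ x ∉ D.halfLattice,
                Λ (x + 2 * D.ω j) = Complex.exp (2 * κ * D.ω j) * Λ x) := by
  refine ⟨HermiteKrichever.HKData.exists_isXi hδ hb fun k => (happ k).2, fun Ξ hΞ => ?_⟩
  obtain ⟨Q, hQ⟩ := hΞ.exists_Q hδ
  refine ⟨Q, hQ, fun U F hF => ?_⟩
  obtain ⟨f, ⟨hf, -⟩, hfF, μ₁, μ₂, h1, h2, hq⟩ :=
    hF.exists_extension hδ hb (fun k => (happ k).2) hΞ hQ
  -- The solution `f` was given the value zero at `± δ k`; its normal form restores holomorphy there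
  -- without changing it off the singular set.
  obtain ⟨Λ, hΛ, hΛf, hΛan, hΛeq⟩ :=
    HermiteKrichever.exists_normal_form fun x => hf.mero x (Set.mem_univ x)
  have han : AnalyticOnNhd ℂ Λ D.halfLatticeᶜ := fun x hx => hΛan x (hf.mem_ordGE_zero hδ hb hx)
  have heq : ∀ x ∉ D.sing, Λ =ᶠ[nhds x] f := fun x hx => hΛeq x (hf.an x (Set.mem_univ x) hx)
  refine ⟨Λ, ⟨hΛ, han, fun x hx => ?_, fun x hx => ?_⟩,
    HermiteKrichever.HKData.exists_ansatz_or_degenerateAnsatz hδ hb hf h1 h2 hq han hΛf,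
    fun α κ c h j hj x hx => ?_, fun κ c₀ c c' h j _ x hx => h.add_two_mul_ω j hx⟩
  · rw [(heq x (hF.2.2.1 x hx).1).eq_of_nhds, hfF hx]
  · rw [HermiteKrichever.HKData.Hg_eq_iff, (heq x hx).deriv.deriv_eq, (heq x hx).deriv_eq,
      (heq x hx).eq_of_nhds, hf.eq x (Set.mem_univ x) hx]
  · exact h.add_two_mul_ω (by rcases hj with rfl | rfl <;> decide) hx
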